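/- Let $\mathcal S$ be the one-qubit state space, i.e. the set of complex $2\times2$ positive semidefinite Hermitian matrices of trace one, with Bloch coordinates $(x,y,z)$, $\rho=\frac12\begin{pmatrix}1+z & x-iy\\ x+iy & 1-z\end{pmatrix}$, which identify $\mathcal S$ with the closed unit ball of $\mathbb R^3$. Write $\mathcal S^{\rm faithful}$ for the states of full rank; a state is pure if it has rank one. Put $$d_{\rm B}(\rho,\sigma)=\sqrt{1-\mathrm{Tr}\sqrt{\sqrt\sigma\,\rho\sqrt\sigma}},\qquad D(\sigma\|\rho)=\mathrm{Tr}\,\sigma(\log\sigma-\log\rho)$$ (with $0\log0=0$, $\rho$ faithful), and let $d_{\rm E}$ be the Euclidean distance of the Bloch vectors. For distinct pure states $\sigma_1,\dots,\sigma_n$ ($n\ge1$) consider the following four Voronoi diagrams of $\mathcal S$, each given by its regions: 1. Bures: $V_{\rm B}^{(i)}=\{\rho\in\mathcal S: d_{\rm B}(\rho,\sigma_i)\le d_{\rm B}(\rho,\sigma_j)\ \forall j\}$; 2. Euclidean: $V_{\rm E}^{(i)}=\{\rho\in\mathcal S: d_{\rm E}(\rho,\sigma_i)\le d_{\rm E}(\rho,\sigma_j)\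 \forall j\}$; 3. divergence: $V_{D}^{(i)}$ is the closure of $\lim_{a\to1^-}\{\rho\in\mathcal S^{\rm faithful}: D(\rho\|\sigma_i(a))\le D(\rho\|\sigma_j(a))\ \forall j\}$, where $\sigma_i(a)=\frac12I+a(\sigma_i-\frac12I)$; 4. dual divergence: $V_{D^*}^{(i)}$ is the closure of $\{\rho\in\mathcal S^{\rm faithful}: D(\sigma_i\|\rho)\le D(\sigma_j\|\rho)\ \forall j\}$. Then the set limit in 3 exists (limit inferior and limit superior agree), and each of the four diagrams can be computed in $O(n^2)$ time, in the following sense. For each of them there is one program of a real RAM (exact real numbers with $+,-,\times,\div$, integer constants and comparisons; natural-number indices with $+$, truncated $-$ and comparisons, used as array addresses; unit cost for every operation, memory access, test and constant; no roots and no conversion of reals to integers) and a function $T(n)=O(n^2)$ such that, for all $n\ge1$ and all distinct pure $\sigma_1,\dots,\sigma_n$, the program, given $n$ and the Bloch coordinates of the sites, halts within $T(n)$ steps and outputs a complete description of the diagram $(V^{(i)})_i$. That is, it outputs a finite list of faces such that * for every set of the form $I(\rho)=\{i:\rho\in V^{(i)}\}$, $\rho\in\mathcal S$, the list contains exactly one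 face, recorded with the list, without repetition, of the elements of this set, and it contains no other faces (so all regions, pieces of bisectors, edges and vertices that occur, and their incidences, are listed); * the face recorded with $I$ comes with finite lists of points and of rays in $\mathbb R^3$ such that $\bigcap_{i\in I}V^{(i)}$ is, in Bloch coordinates, the part of the unit ball that lies in the polyhedron (convex hull of the points) $+$ (convex cone of the rays). -/

import Mathlib

open Filter Topology Asymptotics
open scoped Pointwise ComplexOrder

/-! ## One-qubit states, distances and divergence -/

noncomputable section

/-- Complex `2 × 2` matrices. -/
abbrev QMat : Type := Matrix (Fin 2) (Fin 2) ℂ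

/-- Euclidean three-space, in which the Bloch ball lives. -/
abbrev E3 : Type := EuclideanSpace ℝ (Fin 3)

/-- The one-qubit state space `𝒮`: all density matrices (Hermitian, positive semidefinite, of
trace one). -/
def qubitStates : Set QMat := {ρ | ρ.PosSemidef ∧ ρ.trace = 1}

/-- Pure states: density matrices of rank one. -/
def pureStates : Set QMat := {ρ | ρ ∈ qubitStates ∧ ρ.rank = 1}

/-- Faithful states: density matrices of full rank. -/
def faithfulStates : Set QMat := {ρ | ρ ∈ qubitStates ∧ ρ.rank = 2}

/-- The Bloch coordinates `(x, y, z)` of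
`ρ = !![(1 + z) / 2, (x - i y) / 2; (x + i y) / 2, (1 - z) / 2]`. -/
def bloch (ρ : QMat) : E3 := !₂[2 * (ρ 1 0).re, 2 * (ρ 1 0).im, (ρ 0 0).re - (ρ 1 1).re]

/-- The Euclidean distance of two states (in Bloch coordinates). -/
def euclidDist (ρ σ : QMat) : ℝ := dist (bloch ρ) (bloch σ)

/-- The Bures distance `√(1 - Tr √(√σ ρ √σ))`; functions of Hermitian matrices are taken
spectrally. -/
def buresDist (ρ σ : QMat) : ℝ :=
  Real.sqrt (1 - (Matrix.trace
    (cfc Real.sqrt (cfc Real.sqrt σ * ρ * cfc Real.sqrt σ))).re)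

/-- The quantum divergence `D(σ ‖ ρ) = Tr σ (log σ - log ρ)`, to be used for faithful `ρ` only.
Since `Real.log 0 = 0`, the convention `0 log 0 = 0` is in force for `σ`. -/
def divergence (σ ρ : QMat) : ℝ :=
  (Matrix.trace (σ * (cfc Real.log σ - cfc Real.log ρ))).re

/-- `σ(a) = I / 2 + a (σ - I / 2)`: the state whose Bloch vector is `a` times that of `σ`. -/
def shrink (a : ℝ) (σ : QMat) : QMat :=
  (1 / 2 : ℂ) • (1 : QMat) + (a : ℂ) • (σ - (1 / 2 : ℂ) • (1 : QMat))

/-! ## Voronoi regions -/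

/-- The Voronoi region of the site `p i`, in the space `X`, with respect to `d`
(first argument: the point of the space; second argument: the site). -/
def voronoiRegion {α : Type*} {n : ℕ} (X : Set α) (d : α → α → ℝ) (p : Fin n → α) (i : Fin n) :
    Set α :=
  {x | x ∈ X ∧ ∀ j, d x (p i) ≤ d x (p j)}

/-- The regions of the Bures Voronoi diagram in the whole state space. -/
def buresRegion {n : ℕ} (σ : Fin n → QMat) (i : Fin n) : Set QMat :=
  voronoiRegion qubitStates buresDist σ i

/-- The regions of the Euclidean Voronoi diagram in the whole state space. -/
def euclidRegion {n : ℕ} (σ : Fin n → QMat) (i : Fin n) : Set QMat :=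
  voronoiRegion qubitStates euclidDist σ i

/-- The regions, among the faithful states, of the diagram with respect to `D(ρ ‖ σᵢ(a))`, the
pure sites `σᵢ` being moved radially into the Bloch ball. -/
def divergenceRegionAt {n : ℕ} (σ : Fin n → QMat) (a : ℝ) (i : Fin n) : Set QMat :=
  voronoiRegion faithfulStates (fun ρ τ => divergence ρ τ) (fun j => shrink a (σ j)) i

/-- The regions of `V_D` for pure sites: the closure of the limit, as `a → 1` from below, of the
regions of the sites `σᵢ(a)`. (The set limit is taken pointwise; see `DivergenceLimitExists`.) -/
def divergenceRegion {n : ℕ} (σ : Fin n → QMat) (i : Fin n) : Set QMat :=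
  closure {ρ | ∀ᶠ a in 𝓝[<] (1 : ℝ), ρ ∈ divergenceRegionAt σ a i}

/-- The set limit in `divergenceRegion` exists: the limit superior of the sets is contained in
their limit inferior. -/
def DivergenceLimitExists {n : ℕ} (σ : Fin n → QMat) : Prop :=
  ∀ (i : Fin n) (ρ : QMat), (∃ᶠ a in 𝓝[<] (1 : ℝ), ρ ∈ divergenceRegionAt σ a i) →
    ∀ᶠ a in 𝓝[<] (1 : ℝ), ρ ∈ divergenceRegionAt σ a i

/-- The regions of the dual divergence diagram `V_D*`, with respect to `D(σᵢ ‖ ρ)`: the closure of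
the regions among the faithful states. -/
def dualDivergenceRegion {n : ℕ} (σ : Fin n → QMat) (i : Fin n) : Set QMat :=
  closure (voronoiRegion faithfulStates (fun ρ τ => divergence τ ρ) σ i)

end

/-! ## The real random access machine

A structured real RAM. A program is a finite text; it owns finitely many index variables, real
variables, index arrays and real arrays. Indices are natural numbers with addition and (truncated)
subtraction and serve as addresses; reals are exact and carry the field operations and comparisons.
There is no rounding, no root, and no conversion of reals to indices. Each operation, memory access,
test and constant costs one unit of time. -/

namespace RealRAM

/-- Index expressions. -/
inductive IExpr : Type
  | const : ℕ → IExpr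
  | var : ℕ → IExpr
  | get : ℕ → IExpr → IExpr
  | add : IExpr → IExpr → IExpr
  | sub : IExpr → IExpr → IExpr

/-- Real expressions; the only constants are integers. -/
inductive RExpr : Type
  | const : ℤ → RExpr
  | var : ℕ → RExpr
  | get : ℕ → IExpr → RExpr
  | add : RExpr → RExpr → RExpr
  | sub : RExpr → RExpr → RExpr
  | mul : RExpr → RExpr → RExpr
  | div : RExpr → RExpr → RExpr

/-- Tests. -/
inductive Test : Type
  | ilt : IExpr → IExpr → Test
  | ieq : IExpr → IExpr → Test
  | rlt : RExpr → RExpr → Test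
  | req : RExpr → RExpr → Test
  | neg : Test → Test
  | both : Test → Test → Test

/-- Programs. -/
inductive Prog : Type
  | skip : Prog
  | setIVar : ℕ → IExpr → Prog
  | setRVar : ℕ → RExpr → Prog
  | setIArr : ℕ → IExpr → IExpr → Prog
  | setRArr : ℕ → IExpr → RExpr → Prog
  | seq : Prog → Prog → Prog
  | cond : Test → Prog → Prog → Prog
  | loop : Test → Prog → Prog

/-- Memory contents: variables, and arrays (first argument: the name of the array, second argument:
the position in it). -/
structure Mem where
  iVar : ℕ → ℕ
  rVar : ℕ → ℝ
  iArr : ℕ → ℕ → ℕ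
  rArr : ℕ → ℕ → ℝ

/-- Value of an index expression. -/
def IExpr.val (s : Mem) : IExpr → ℕ
  | .const c => c
  | .var k => s.iVar k
  | .get b e => s.iArr b (e.val s)
  | .add e f => e.val s + f.val s
  | .sub e f => e.val s - f.val s

/-- Time to evaluate an index expression. -/
def IExpr.cost : IExpr → ℕ
  | .const _ => 1
  | .var _ => 1
  | .get _ e => e.cost + 1
  | .add e f => e.cost + f.cost + 1
  | .sub e f => e.cost + f.cost + 1

/-- Value of a real expression (a division by zero returns zero; a program can test for it). -/
noncomputable def RExpr.val (s : Mem) : RExpr → ℝ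
  | .const c => (c : ℝ)
  | .var k => s.rVar k
  | .get b e => s.rArr b (e.val s)
  | .add e f => e.val s + f.val s
  | .sub e f => e.val s - f.val s
  | .mul e f => e.val s * f.val s
  | .div e f => e.val s / f.val s

/-- Time to evaluate a real expression. -/
def RExpr.cost : RExpr → ℕ
  | .const _ => 1
  | .var _ => 1
  | .get _ e => e.cost + 1
  | .add e f => e.cost + f.cost + 1
  | .sub e f => e.cost + f.cost + 1
  | .mul e f => e.cost + f.cost + 1
  | .div e f => e.cost + f.cost + 1

/-- A test succeeds in the given memory. -/
def Test.Holds (s : Mem) : Test → Prop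
  | .ilt e f => e.val s < f.val s
  | .ieq e f => e.val s = f.val s
  | .rlt e f => e.val s < f.val s
  | .req e f => e.val s = f.val s
  | .neg b => ¬ b.Holds s
  | .both b c => b.Holds s ∧ c.Holds s

/-- Time to evaluate a test. -/
def Test.cost : Test → ℕ
  | .ilt e f => e.cost + f.cost + 1
  | .ieq e f => e.cost + f.cost + 1
  | .rlt e f => e.cost + f.cost + 1
  | .req e f => e.cost + f.cost + 1
  | .neg b => b.cost + 1
  | .both b c => b.cost + c.cost + 1

/-- Writing an entry of an array. -/
def write {β : Type} (A : ℕ → ℕ → β) (b k : ℕ) (v : β) : ℕ → ℕ → β :=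
  Function.update A b (Function.update (A b) k v)

/-- `Exec P s t s'`: the program `P`, started with memory `s`, halts after exactly `t` units of time
with memory `s'`. -/
inductive Exec : Prog → Mem → ℕ → Mem → Prop
  | skip (s : Mem) : Exec .skip s 1 s
  | setIVar (s : Mem) (k : ℕ) (e : IExpr) :
      Exec (.setIVar k e) s (e.cost + 1) { s with iVar := Function.update s.iVar k (e.val s) }
  | setRVar (s : Mem) (k : ℕ) (e : RExpr) :
      Exec (.setRVar k e) s (e.cost + 1) { s with rVar := Function.update s.rVar k (e.val s) }
  | setIArr (s : Mem) (b : ℕ) (k e : IExpr) :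
      Exec (.setIArr b k e) s (k.cost + e.cost + 1)
        { s with iArr := write s.iArr b (k.val s) (e.val s) }
  | setRArr (s : Mem) (b : ℕ) (k : IExpr) (e : RExpr) :
      Exec (.setRArr b k e) s (k.cost + e.cost + 1)
        { s with rArr := write s.rArr b (k.val s) (e.val s) }
  | seq {P Q : Prog} {s s' s'' : Mem} {t t' : ℕ} (hP : Exec P s t s') (hQ : Exec Q s' t' s'') :
      Exec (.seq P Q) s (t + t') s''
  | condTrue {b : Test} {P Q : Prog} {s s' : Mem} {t : ℕ} (hb : b.Holds s) (hP : Exec P s t s') :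
      Exec (.cond b P Q) s (b.cost + t) s'
  | condFalse {b : Test} {P Q : Prog} {s s' : Mem} {t : ℕ} (hb : ¬ b.Holds s)
      (hQ : Exec Q s t s') : Exec (.cond b P Q) s (b.cost + t) s'
  | loopDone {b : Test} {P : Prog} {s : Mem} (hb : ¬ b.Holds s) : Exec (.loop b P) s b.cost s
  | loopStep {b : Test} {P : Prog} {s s' s'' : Mem} {t t' : ℕ} (hb : b.Holds s)
      (hP : Exec P s t s') (hL : Exec (.loop b P) s' t' s'') :
      Exec (.loop b P) s (b.cost + t + t') s''

end RealRAM

/-! ## Input, output, and computability of a Voronoi diagram -/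

noncomputable section

/-- The input: index variable `0` holds the number `n` of sites, and the real arrays `0`, `1`, `2`
hold the Bloch coordinates `x`, `y`, `z` of the sites; all other memory is zero. -/
def inputMem {n : ℕ} (σ : Fin n → QMat) : RealRAM.Mem where
  iVar := fun k => if k = 0 then n else 0
  rVar := fun _ => 0
  iArr := fun _ _ => 0
  rArr := fun b k => if hb : b < 3 then (if hk : k < n then bloch (σ ⟨k, hk⟩) ⟨b, hb⟩ else 0) else 0

/-- A face of a polyhedral subdivision: the indices of the sites to whose regions it belongs, and
the points and rays which span it. -/
structure FaceRecord where
  sites : List ℕ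
  points : List E3
  rays : List E3

/-- The polyhedron spanned by the points and rays of a record: convex hull of the points plus convex
cone of the rays. -/
def FaceRecord.polyhedron (f : FaceRecord) : Set E3 :=
  convexHull ℝ {x | x ∈ f.points} + (Submodule.span NNReal {x | x ∈ f.rays} : Set E3)

/-- The entries `A lo, …, A (hi - 1)` of an array. -/
def slice {β : Type} (A : ℕ → β) (lo hi : ℕ) : List β := (List.Ico lo hi).map A

/-- The `k`-th face that is written in memory. Its site indices are the entries of index array `1`
from position `iArr 0 k` up to (excluding) position `iArr 0 (k + 1)`; its points are found, in the
same way, through index array `2` in the real arrays `3`, `4`, `5` and its rays through index array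
`3` in the real arrays `6`, `7`, `8`. -/
def faceAt (s : RealRAM.Mem) (k : ℕ) : FaceRecord where
  sites := slice (s.iArr 1) (s.iArr 0 k) (s.iArr 0 (k + 1))
  points := slice (fun t => !₂[s.rArr 3 t, s.rArr 4 t, s.rArr 5 t])
    (s.iArr 2 k) (s.iArr 2 (k + 1))
  rays := slice (fun t => !₂[s.rArr 6 t, s.rArr 7 t, s.rArr 8 t])
    (s.iArr 3 k) (s.iArr 3 (k + 1))

/-- The output: the list of all faces that are written in memory; their number is held by index
variable `1`. -/
def outputFaces (s : RealRAM.Mem) : List FaceRecord := (List.range (s.iVar 1)).map (faceAt s)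

/-- The indices of the regions that contain the state `ρ`. -/
def owners {n : ℕ} (V : Fin n → Set QMat) (ρ : QMat) : Set ℕ :=
  {k | ∃ h : k < n, ρ ∈ V ⟨k, h⟩}

/-- The list `F` is a complete description, as a polyhedral subdivision of the state space, of the
diagram with regions `V`: its faces correspond one to one to the sets of sites which own a
common state and no other site does (regions, bisector parts, edges, vertices), and each record
gives the exact shape of the intersection of the regions of its sites, as the part of the state
space that lies in the polyhedron of the record. -/
structure DescribesDiagram {n : ℕ} (V : Fin n → Set QMat) (F : List FaceRecord) : Prop where
  sites_nodup : ∀ f ∈ F, f.sites.Nodup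
  faces_nodup : (F.map fun f => f.sites.toFinset).Nodup
  faces_iff : ∀ I : Set ℕ, (∃ f ∈ F, {k | k ∈ f.sites} = I) ↔ ∃ ρ ∈ qubitStates, owners V ρ = I
  shape : ∀ f ∈ F, {ρ | ρ ∈ qubitStates ∧ ∀ i : Fin n, (i : ℕ) ∈ f.sites → ρ ∈ V i} =
    {ρ | ρ ∈ qubitStates ∧ bloch ρ ∈ f.polyhedron}

/-- The Voronoi diagrams with regions `V σ` of `n ≥ 1` distinct pure one-qubit sites `σ` can be
computed in time `O(g n)`: one program of the real RAM halts for all `n` and all such sites, within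
`T n = O(g n)` units of time, with a complete description of the diagram as its output. -/
def PureSiteDiagramComputableInTime (V : ∀ n : ℕ, (Fin n → QMat) → Fin n → Set QMat)
    (g : ℕ → ℝ) : Prop :=
  ∃ (P : RealRAM.Prog) (T : ℕ → ℕ), ((fun n => (T n : ℝ)) =O[atTop] g) ∧
    ∀ (n : ℕ), 1 ≤ n → ∀ σ : Fin n → QMat, Function.Injective σ → (∀ i, σ i ∈ pureStates) →
      ∃ (t : ℕ) (s : RealRAM.Mem), RealRAM.Exec P (inputMem σ) t s ∧ t ≤ T n ∧
        DescribesDiagram (V n σ) (outputFaces s)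

end

/-!
The four diagrams coincide, and a real RAM can find their common combinatorial structure with
rational operations. Write `r` for the Bloch vector of a state `ρ` and `s j` for that of the pure
state `σ j`, a unit vector. Each of the four quantities that are compared is a decreasing function
of the inner product of `r` and `s j`, so that in all cases the region of `σ i` is the part of the
ball where this product is largest at `i` (`coneRegion`).
* For the Bures distance, `σ` is a projection of rank one, so `σ ρ σ = ((1 + ⟨r, s⟩) / 2) σ`, and
  the trace of the square root of this is `√((1 + ⟨r, s⟩) / 2)` (`buresRegion_eq`). For the
  Euclidean distance expand the square (`euclidRegion_eq`).
* A function of a two by two Hermitian matrix is affine in the matrix, with coefficients that depend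
  on the spectrum only; for the logarithm of a faithful state the slope is positive
  (`exists_log_affine`). In `D(ρ ‖ σ_j(a))` the states `σ_j(a)` have the same spectrum, and in
  `D(σ_j ‖ ρ)` the logarithm is that of a single state, while `σ_j log σ_j = 0`. So the faithful
  part of a region is that of the cone region, for every `a` (`divergenceRegionAt_eq`,
  `dualDivergence_eq`); in particular the limit exists. The closure restores the boundary, since
  shrinking a state towards the centre stays in the cone (`closure_faithful`).

Hence the diagram is cut out of the ball by the normal fan of the convex hull of the points `s j`:
its faces are the sets of maximizers of linear functionals, with the cones of functionals that are
maximal there. Every site is a vertex of the hull, and no three are collinear. For sites that do not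
lie in a plane, the fan is found by gift wrapping around each site `i`. The nearest site is a
neighbour (`Sites.adj_of_nearest`), and from a neighbour the next one is found by one scan, since
the order of the sites around an edge is a linear one (`exists_scan_key`,
`Sites.next_of_scan`). As successors are unique backwards (`Next.pred_unique`), the walk returns to
its start; it meets every neighbour, and the cones of `i`, of the edges at `i` and of the facets at
`i` can be read off from it (`IsMarch.isLocal`). A face is written only at its least site, whence
every face occurs once (`isComplete_of_local`).

A step of the walk, and the output of a facet with all sites in its plane, take time `O(n)`. The
number of steps is the number of neighbours, so the time is quadratic if the hull has `O(n)` edges.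
Instead of Euler's formula this uses a direct count (`card_up_edges_le`): with respect to a generic
height, an upward edge from `i` to `j` and the next neighbour of `i` after `j` are charged to the
middle one of these three sites, and each site is charged at most three times, as the supporting
planes through it can cross the horizontal plane only once in each sense.

Sites in a plane are the vertices of a polygon, whose two neighbours at each vertex are found by two
scans (`IsTurn.isLocal`); one or two sites are treated by themselves. The programs are verified by
rules for the effect and the time of a program on an abstract memory (`Does`), and they combine to
`exists_fan_program`.
-/

/-! ### Vector algebra in three-space -/

namespace BlochFan

/-- The Euclidean inner product of `E3`, written out in coordinates. -/
def dot (a b : E3) : ℝ := a 0 * b 0 + a 1 * b 1 + a 2 * b 2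

/-- The vector product of `E3`. -/
def cross (a b : E3) : E3 :=
  !₂[a 1 * b 2 - a 2 * b 1, a 2 * b 0 - a 0 * b 2, a 0 * b 1 - a 1 * b 0]

/-- The determinant of three vectors. -/
def det (a b c : E3) : ℝ := dot (cross a b) c

@[simp] lemma cross_zero (a b : E3) : cross a b 0 = a 1 * b 2 - a 2 * b 1 := rfl
@[simp] lemma cross_one (a b : E3) : cross a b 1 = a 2 * b 0 - a 0 * b 2 := rfl
@[simp] lemma cross_two (a b : E3) : cross a b 2 = a 0 * b 1 - a 1 * b 0 := rfl

lemma ext3 {a b : E3} (h0 : a 0 = b 0) (h1 : a 1 = b 1) (h2 : a 2 = b 2) : a = b := by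
  ext i; fin_cases i <;> assumption

lemma dot_comm (a b : E3) : dot a b = dot b a := by simp only [dot]; ring

@[simp] lemma dot_add_right (a b c : E3) : dot a (b + c) = dot a b + dot a c := by
  simp only [dot, PiLp.add_apply]; ring
@[simp] lemma dot_sub_right (a b c : E3) : dot a (b - c) = dot a b - dot a c := by
  simp only [dot, PiLp.sub_apply]; ring
@[simp] lemma dot_smul_right (r : ℝ) (a b : E3) : dot a (r • b) = r * dot a b := by
  simp only [dot, PiLp.smul_apply, smul_eq_mul]; ring
@[simp] lemma dot_neg_right (a b : E3) : dot a (-b) = - dot a b := by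
  simp only [dot, PiLp.neg_apply]; ring
@[simp] lemma dot_zero_right (a : E3) : dot a 0 = 0 := by simp [dot]
@[simp] lemma dot_add_left (a b c : E3) : dot (a + b) c = dot a c + dot b c := by
  simp only [dot, PiLp.add_apply]; ring
@[simp] lemma dot_sub_left (a b c : E3) : dot (a - b) c = dot a c - dot b c := by
  simp only [dot, PiLp.sub_apply]; ring
@[simp] lemma dot_smul_left (r : ℝ) (a b : E3) : dot (r • a) b = r * dot a b := by
  simp only [dot, PiLp.smul_apply, smul_eq_mul]; ring
@[simp] lemma dot_neg_left (a b : E3) : dot (-a) b = - dot a b := by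
  simp only [dot, PiLp.neg_apply]; ring
@[simp] lemma dot_zero_left (a : E3) : dot 0 a = 0 := by simp [dot]

lemma dot_self_nonneg (a : E3) : 0 ≤ dot a a := by
  simp only [dot]; nlinarith [sq_nonneg (a 0), sq_nonneg (a 1), sq_nonneg (a 2)]

lemma dot_self_eq_zero {a : E3} : dot a a = 0 ↔ a = 0 := by
  constructor
  · intro h
    simp only [dot] at h
    have h0 : a 0 = 0 := by nlinarith [sq_nonneg (a 0), sq_nonneg (a 1), sq_nonneg (a 2)]
    have h1 : a 1 = 0 := by nlinarith [sq_nonneg (a 0), sq_nonneg (a 1), sq_nonneg (a 2)]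
    have h2 : a 2 = 0 := by nlinarith [sq_nonneg (a 0), sq_nonneg (a 1), sq_nonneg (a 2)]
    exact ext3 h0 h1 h2
  · rintro rfl; simp

lemma dot_self_pos {a : E3} (h : a ≠ 0) : 0 < dot a a :=
  lt_of_le_of_ne (dot_self_nonneg a) fun h' => h (dot_self_eq_zero.1 h'.symm)

lemma det_rotate (a b c : E3) : det a b c = det b c a := by
  simp only [det, dot, cross_zero, cross_one, cross_two]; ring
lemma det_swap (a b c : E3) : det a b c = - det b a c := by
  simp only [det, dot, cross_zero, cross_one, cross_two]; ring
@[simp] lemma det_self_right (a b : E3) : det a b b = 0 := by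
  simp only [det, dot, cross_zero, cross_one, cross_two]; ring
@[simp] lemma det_self_outer (a b : E3) : det a b a = 0 := by
  simp only [det, dot, cross_zero, cross_one, cross_two]; ring
@[simp] lemma det_zero_right (a b : E3) : det a b 0 = 0 := by simp [det]

/-- A vector in terms of its products with three given vectors. -/
lemma det_smul_eq (a b c u : E3) : det a b c • u =
    dot u c • cross a b + dot u a • cross b c + dot u b • cross c a := by
  apply ext3 <;>
    (simp only [det, dot, cross_zero, cross_one, cross_two, PiLp.add_apply, PiLp.smul_apply,
      smul_eq_mul]; ring)

/-- Cramer's rule. -/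
lemma cramer (a b c u : E3) : det a b c • u =
    det u b c • a + det a u c • b + det a b u • c := by
  apply ext3 <;>
    (simp only [det, dot, cross_zero, cross_one, cross_two, PiLp.add_apply, PiLp.smul_apply,
      smul_eq_mul]; ring)

/-- The linear relation between four vectors, tested against a functional. -/
lemma four_term (u a b c d : E3) : dot u a * det b c d - dot u b * det a c d
    + dot u c * det a b d - dot u d * det a b c = 0 := by
  simp only [det, dot, cross_zero, cross_one, cross_two]; ring

lemma cross_cross (a b c : E3) : cross (cross a b) (cross b c) = det a b c • b := by
  apply ext3 <;>
    (simp only [det, dot, cross_zero, cross_one, cross_two, PiLp.smul_apply, smul_eq_mul]; ring)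

lemma eq_zero_of_orthogonal {a b c u : E3} (h : det a b c ≠ 0) (ha : dot u a = 0)
    (hb : dot u b = 0) (hc : dot u c = 0) : u = 0 := by
  have := det_smul_eq a b c u
  rw [ha, hb, hc] at this
  simpa [h] using this

/-- If `c` is in the plane of `a` and `b`, then it is a combination of them; the coefficient of `a`
has the sign opposite to that of `(a × b) · (b × c)`. -/
lemma exists_comb_of_det_eq_zero {a b c : E3} (h : cross a b ≠ 0) (hd : det a b c = 0) :
    ∃ r t : ℝ, c = r • a + t • b ∧
      r * dot (cross a b) (cross a b) = - dot (cross a b) (cross b c) := by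
  have hpos := dot_self_pos h
  refine ⟨- dot (cross a b) (cross b c) / dot (cross a b) (cross a b),
    dot (cross a b) (cross a c) / dot (cross a b) (cross a b), ?_, by field_simp⟩
  have h1 := cramer a b (cross a b) c
  have h2 : det a b (cross a b) = dot (cross a b) (cross a b) := rfl
  have h3 : det c b (cross a b) = - dot (cross a b) (cross b c) := by
    simp only [det, dot, cross_zero, cross_one, cross_two]; ring
  have h4 : det a c (cross a b) = dot (cross a b) (cross a c) := by
    simp only [det, dot, cross_zero, cross_one, cross_two]; ring
  rw [h2, h3, h4, hd, zero_smul, add_zero] at h1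
  have h5 := congrArg (fun x => (dot (cross a b) (cross a b))⁻¹ • x) h1
  simp only [smul_smul, smul_add, inv_mul_cancel₀ hpos.ne', one_smul] at h5
  refine h5.trans ?_
  congr 2 <;> field_simp

lemma comb_unique {a b : E3} (h : cross a b ≠ 0) {r t r' t' : ℝ}
    (he : r • a + t • b = r' • a + t' • b) : r = r' ∧ t = t' := by
  have hpos := dot_self_pos h
  have h1 := congrArg (fun x => dot (cross a b) (cross x b)) he
  have h2 := congrArg (fun x => dot (cross a b) (cross a x)) he
  have e1 : ∀ r t : ℝ, dot (cross a b) (cross (r • a + t • b) b)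
      = r * dot (cross a b) (cross a b) := by
    intro r t
    simp only [dot, cross_zero, cross_one, cross_two, PiLp.add_apply, PiLp.smul_apply, smul_eq_mul]
    ring
  have e2 : ∀ r t : ℝ, dot (cross a b) (cross a (r • a + t • b))
      = t * dot (cross a b) (cross a b) := by
    intro r t
    simp only [dot, cross_zero, cross_one, cross_two, PiLp.add_apply, PiLp.smul_apply, smul_eq_mul]
    ring
  simp only [e1, e2] at h1 h2
  exact ⟨mul_right_cancel₀ hpos.ne' h1, mul_right_cancel₀ hpos.ne' h2⟩

lemma cross_swap (a b : E3) : cross b a = - cross a b := by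
  apply ext3 <;> simp only [cross_zero, cross_one, cross_two, PiLp.neg_apply] <;> ring

/-- A functional `u` which vanishes on `c` and is positive on the vectors `x k` turns the order
around the axis `c` into a lexicographic order of numbers: first the slope, then, for vectors in the
same half-plane, a height in the direction of `c`, here measured by `e`. As this is a linear order,
a minimum can be found in a single pass. -/
lemma exists_scan_key {c u e : E3} {ι : Type*} {x : ι → E3} {X : ι → Prop} (huc : dot u c = 0)
    (hu : ∀ k, X k → 0 < dot u (x k)) (hec : 0 < dot e c) :
    ∃ key : ι → ℝ ×ₗ ℝ, ∀ k l, X k → X l →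
      ((det c (x k) (x l) < 0 ∨ (det c (x k) (x l) = 0 ∧
        0 < dot (cross c (x k)) (cross (x k) (x l)))) ↔ key l < key k) := by
  refine ⟨fun k => toLex (dot (cross c u) (x k) / dot u (x k), dot e (x k) / dot u (x k)), ?_⟩
  intro k l hk hl
  have huk := hu k hk
  have hul := hu l hl
  have hu0 : 0 < dot u u := dot_self_pos (by rintro rfl; simp at huk)
  have hν : cross c (x k) ≠ 0 := by
    intro h0
    have h2 : dot (cross u (cross c (x k))) (cross u (cross c (x k))) = 0 := by
      rw [h0]; simp [dot]
    have h3 : cross u (cross c (x k)) = dot u (x k) • c - dot u c • x k := by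
      apply ext3 <;> (simp only [dot, cross_zero, cross_one, cross_two, PiLp.sub_apply,
        PiLp.smul_apply, smul_eq_mul]; ring)
    rw [h3, huc, zero_smul, sub_zero, dot_smul_left, dot_smul_right] at h2
    have hc0 : 0 < dot c c := dot_self_pos (by rintro rfl; simp at hec)
    have : 0 < dot u (x k) * (dot u (x k) * dot c c) := by positivity
    linarith
  have hνpos := dot_self_pos hν
  have key1 : dot u u * det c (x k) (x l) = dot u (x k) * dot (cross c u) (x l)
      - dot (cross c u) (x k) * dot u (x l) + dot u c * det u (x k) (x l) := by
    simp only [det, dot, cross_zero, cross_one, cross_two]; ring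
  rw [huc, zero_mul, add_zero] at key1
  rw [Prod.Lex.toLex_lt_toLex]
  have hA : det c (x k) (x l) < 0 ↔
      dot (cross c u) (x l) / dot u (x l) < dot (cross c u) (x k) / dot u (x k) := by
    rw [div_lt_div_iff₀ hul huk]
    constructor
    · intro h; nlinarith [mul_neg_of_pos_of_neg hu0 h]
    · intro h; by_contra hcon; push Not at hcon; nlinarith [mul_nonneg hu0.le hcon]
  have hB : det c (x k) (x l) = 0 ↔
      dot (cross c u) (x l) / dot u (x l) = dot (cross c u) (x k) / dot u (x k) := by
    rw [div_eq_div_iff hul.ne' huk.ne']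
    constructor
    · intro h; rw [h, mul_zero] at key1; linarith
    · intro h
      have : dot u u * det c (x k) (x l) = 0 := by rw [key1]; linarith
      exact (mul_eq_zero.1 this).resolve_left hu0.ne'
  apply or_congr hA
  constructor
  · rintro ⟨h1, h2⟩
    refine ⟨hB.1 h1, ?_⟩
    obtain ⟨r, t, hx, hr⟩ := exists_comb_of_det_eq_zero hν h1
    have hr0 : r < 0 := by
      by_contra hcon; push Not at hcon; nlinarith [mul_nonneg hcon hνpos.le]
    have hul' : dot u (x l) = t * dot u (x k) := by rw [hx]; simp [huc]
    have hel : dot e (x l) = r * dot e c + t * dot e (x k) := by rw [hx]; simp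
    rw [div_lt_div_iff₀ hul huk, hul', hel]
    nlinarith [mul_pos (mul_pos (neg_pos.2 hr0) hec) huk]
  · rintro ⟨h1, h2⟩
    have h1 := hB.2 h1
    refine ⟨h1, ?_⟩
    obtain ⟨r, t, hx, hr⟩ := exists_comb_of_det_eq_zero hν h1
    have hul' : dot u (x l) = t * dot u (x k) := by rw [hx]; simp [huc]
    have hel : dot e (x l) = r * dot e c + t * dot e (x k) := by rw [hx]; simp
    rw [div_lt_div_iff₀ hul huk, hul', hel] at h2
    by_contra hcon; push Not at hcon
    have hr0 : 0 ≤ r := by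
      by_contra h; push Not at h; nlinarith [mul_neg_of_neg_of_pos h hνpos]
    nlinarith [mul_nonneg (mul_nonneg hr0 hec.le) huk.le]

/-! ### Distinct points on the unit sphere and their neighbours -/

/-- The points `p 0, …, p (n - 1)` are distinct points of the unit sphere. -/
structure Sites (n : ℕ) (p : ℕ → E3) : Prop where
  unit : ∀ k < n, dot (p k) (p k) = 1
  inj : ∀ k < n, ∀ l < n, p k = p l → k = l

/-- The site `j`, different from `i`, spans an edge of the convex hull of the sites together with
`i`: some functional is minimal, among the sites, exactly at `i` and `j`. -/
def Adj (n : ℕ) (p : ℕ → E3) (i j : ℕ) : Prop :=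
  j < n ∧ j ≠ i ∧ ∃ u : E3, dot u (p j - p i) = 0 ∧
    ∀ k < n, k ≠ i → k ≠ j → 0 < dot u (p k - p i)

/-- Seen from the site `i`, the sites `j` and `j'` span, in this order, a facet of the convex hull:
all sites lie on one side of the plane of `i`, `j`, `j'`, and those in the plane lie in the angle
between `j` and `j'`. -/
def Next (n : ℕ) (p : ℕ → E3) (i j j' : ℕ) : Prop :=
  j' < n ∧ j' ≠ i ∧ j' ≠ j ∧ ∀ k < n, 0 ≤ det (p j - p i) (p j' - p i) (p k - p i) ∧
    (det (p j - p i) (p j' - p i) (p k - p i) = 0 →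
      ∃ r t : ℝ, 0 ≤ r ∧ 0 ≤ t ∧ p k - p i = r • (p j - p i) + t • (p j' - p i))

section
variable {n : ℕ} {p : ℕ → E3}

lemma Sites.dot_diff (hp : Sites n p) {i k : ℕ} (hi : i < n) (hk : k < n) :
    dot (p k - p i) (p k - p i) = - 2 * dot (p i) (p k - p i) := by
  have h1 := hp.unit i hi
  have h2 := hp.unit k hk
  simp only [dot_sub_left, dot_sub_right, h1, h2, dot_comm (p k) (p i)]
  ring

lemma Sites.diff_ne_zero (hp : Sites n p) {i k : ℕ} (hi : i < n) (hk : k < n) (h : k ≠ i) :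
    p k - p i ≠ 0 :=
  fun h0 => h (hp.inj k hk i hi (sub_eq_zero.1 h0))

lemma Sites.dot_diff_neg (hp : Sites n p) {i k : ℕ} (hi : i < n) (hk : k < n) (h : k ≠ i) :
    dot (p i) (p k - p i) < 0 := by
  have := hp.dot_diff hi hk
  have := dot_self_pos (hp.diff_ne_zero hi hk h)
  linarith

/-- No three sites are collinear. -/
lemma Sites.cross_ne_zero (hp : Sites n p) {i k l : ℕ} (hi : i < n) (hk : k < n) (hl : l < n)
    (hki : k ≠ i) (hli : l ≠ i) (hkl : k ≠ l) : cross (p k - p i) (p l - p i) ≠ 0 := by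
  intro h0
  have hk0 := dot_self_pos (hp.diff_ne_zero hi hk hki)
  have hl0 := dot_self_pos (hp.diff_ne_zero hi hl hli)
  have hk1 := hp.dot_diff hi hk
  have hl1 := hp.dot_diff hi hl
  generalize ha : p k - p i = a at *
  generalize hb : p l - p i = b at *
  have hpar : dot a a • b = dot a b • a := by
    have : dot a a • b - dot a b • a = cross (cross a b) a := by
      apply ext3 <;> (simp only [dot, cross_zero, cross_one, cross_two, PiLp.sub_apply,
        PiLp.smul_apply, smul_eq_mul]; ring)
    rw [h0] at this
    rw [← sub_eq_zero, this]
    apply ext3 <;> simp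
  have e1 : dot a a * dot b b = dot a b * dot a b := by
    have := congrArg (fun x => dot x b) hpar
    simpa using this
  have e2 : dot a a * dot (p i) b = dot a b * dot (p i) a := by
    have := congrArg (fun x => dot (p i) x) hpar
    simpa using this
  have e3 : dot a b = dot b b := by
    have h4 : dot a a * dot a b = dot a a * dot b b := by
      linear_combination 2 * e2 + dot a b * hk1 - dot a a * hl1
    exact mul_left_cancel₀ hk0.ne' h4
  have e4 : dot a a = dot b b := by
    rw [e3] at e1
    exact mul_right_cancel₀ hl0.ne' e1
  rw [e3, ← e4] at hpar
  have h5 : b = a := smul_right_injective E3 hk0.ne' hpar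
  rw [← ha, ← hb] at h5
  exact hkl (hp.inj k hk l hl (sub_left_injective h5).symm)

/-- A nearest site spans an edge of the convex hull. -/
lemma Sites.adj_of_nearest (hp : Sites n p) {i j : ℕ} (hi : i < n) (hj : j < n) (hji : j ≠ i)
    (h : ∀ k < n, k ≠ i → dot (p i) (p k) ≤ dot (p i) (p j)) : Adj n p i j := by
  refine ⟨hj, hji, -(p i + p j), ?_, ?_⟩
  · have h1 := hp.unit i hi
    have h2 := hp.unit j hj
    simp only [dot_neg_left, dot_add_left, dot_sub_right, h1, h2, dot_comm (p j) (p i)]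
    ring
  · intro k hk hki hkj
    have h1 := hp.unit i hi
    have h3 := h k hk hki
    have h4 : dot (p j) (p k) < 1 := by
      have h5 := hp.dot_diff_neg hj hk hkj
      rw [dot_sub_right, hp.unit j hj] at h5
      linarith
    simp only [dot_neg_left, dot_add_left, dot_sub_right, h1, dot_comm (p j) (p i)]
    linarith

/-- The step of gift wrapping: if no site beats `j'` in the order around the edge from `i` to `j`,
then `j'` is the next site. -/
lemma Sites.next_of_scan (hp : Sites n p) {i j j' : ℕ} (hi : i < n) (hj : Adj n p i j)
    (hj' : j' < n) (hji : j' ≠ i) (hjj : j' ≠ j)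
    (h : ∀ k < n, ¬ (det (p j - p i) (p j' - p i) (p k - p i) < 0 ∨
      (det (p j - p i) (p j' - p i) (p k - p i) = 0 ∧
        0 < dot (cross (p j - p i) (p j' - p i)) (cross (p j' - p i) (p k - p i))))) :
    Next n p i j j' := by
  obtain ⟨hjn, hji', u, hu, hpos⟩ := hj
  refine ⟨hj', hji, hjj, fun k hk => ?_⟩
  have hk' := h k hk
  push Not at hk'
  refine ⟨hk'.1, fun h0 => ?_⟩
  by_cases hki : k = i
  · exact ⟨0, 0, le_rfl, le_rfl, by simp [hki]⟩
  by_cases hkj : k = j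
  · exact ⟨1, 0, zero_le_one, le_rfl, by simp [hkj]⟩
  have hν := hp.cross_ne_zero hi hjn hj' hji' hji (Ne.symm hjj)
  obtain ⟨r, t, hx, hr⟩ := exists_comb_of_det_eq_zero hν h0
  have hν' := dot_self_pos hν
  have h1 := hk'.2 h0
  refine ⟨r, t, ?_, ?_, hx⟩
  · by_contra hcon; push Not at hcon; nlinarith [mul_neg_of_neg_of_pos hcon hν']
  · have h2 := hpos k hk hki hkj
    have h3 := hpos j' hj' hji hjj
    rw [hx, dot_add_right, dot_smul_right, dot_smul_right, hu, mul_zero, zero_add] at h2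
    exact (pos_of_mul_pos_left h2 h3.le).le

/-- Around the edge from `i` to `j` the other sites are linearly ordered by a key: `exists_scan_key`
applies to the functional which supports the edge, and to the depth below the tangent plane of the
sphere at `i`. So a single scan finds the next site. -/
lemma Sites.exists_key (hp : Sites n p) {i j : ℕ} (hi : i < n) (hj : Adj n p i j) :
    ∃ key : ℕ → ℝ ×ₗ ℝ, ∀ k l, (k < n ∧ k ≠ i ∧ k ≠ j) → (l < n ∧ l ≠ i ∧ l ≠ j) →
      ((det (p j - p i) (p k - p i) (p l - p i) < 0 ∨
      (det (p j - p i) (p k - p i) (p l - p i) = 0 ∧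
        0 < dot (cross (p j - p i) (p k - p i)) (cross (p k - p i) (p l - p i)))) ↔
        key l < key k) := by
  obtain ⟨hjn, hji, u, hu, hpos⟩ := hj
  refine exists_scan_key (c := p j - p i) (u := u) (e := - p i) (x := fun k => p k - p i)
    (X := fun k => k < n ∧ k ≠ i ∧ k ≠ j) hu (fun k hk => hpos k hk.1 hk.2.1 hk.2.2) ?_
  have := hp.dot_diff_neg hi hjn hji
  simpa using this

/-- The site `i` and the site on the axis never win a comparison in the scan around the axis. -/
lemma not_better_of_eq {c x y : E3} (h : y = 0 ∨ y = c) :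
    ¬ (det c x y < 0 ∨ (det c x y = 0 ∧ 0 < dot (cross c x) (cross x y))) := by
  rcases h with rfl | rfl
  · have : cross x 0 = 0 := by apply ext3 <;> simp
    simp [this]
  · have h1 : dot (cross y x) (cross x y) = - dot (cross y x) (cross y x) := by
      rw [cross_swap y x]; simp
    have := dot_self_nonneg (cross y x)
    simp only [det_self_outer, lt_self_iff_false, true_and, false_or, not_lt]
    linarith

lemma Sites.exists_next (hp : Sites n p) (hn : 3 ≤ n) {i j : ℕ} (hi : i < n) (hj : Adj n p i j) :
    ∃ j', Next n p i j j' := by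
  obtain ⟨key, hkey⟩ := hp.exists_key hi hj
  have hne : ((Finset.range n \ {i, j} : Finset ℕ)).Nonempty := by
    rw [← Finset.card_pos]
    have h1 := Finset.le_card_sdiff {i, j} (Finset.range n)
    have h2 : ({i, j} : Finset ℕ).card ≤ 2 := Finset.card_le_two
    rw [Finset.card_range] at h1
    omega
  obtain ⟨j', hj', hmin⟩ := Finset.exists_min_image _ key hne
  simp only [Finset.mem_sdiff, Finset.mem_range, Finset.mem_insert, Finset.mem_singleton,
    not_or] at hj' hmin
  refine ⟨j', hp.next_of_scan hi hj hj'.1 hj'.2.1 hj'.2.2 fun k hk => ?_⟩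
  by_cases hki : k = i
  · exact not_better_of_eq (Or.inl (by simp [hki]))
  by_cases hkj : k = j
  · exact not_better_of_eq (Or.inr (by simp [hkj]))
  rw [hkey j' k hj' ⟨hk, hki, hkj⟩]
  exact not_lt.2 (hmin k ⟨hk, hki, hkj⟩)

lemma Next.cross_ne_zero {i j j' : ℕ} (hp : Sites n p) (hi : i < n) (hj : j < n) (hji : j ≠ i)
    (h : Next n p i j j') :
    cross (p j - p i) (p j' - p i) ≠ 0 :=
  hp.cross_ne_zero hi hj h.1 hji h.2.1 h.2.2.1.symm

/-- Finitely many nonnegative numbers, which come with a positive correction where they vanish, are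
all made positive by a small multiple of the corrections. -/
lemma exists_pos_comb (S : Finset ℕ) (a b : ℕ → ℝ)
    (h : ∀ k ∈ S, 0 < a k ∨ (a k = 0 ∧ 0 < b k)) :
    ∃ ε : ℝ, 0 < ε ∧ ∀ k ∈ S, 0 < a k + ε * b k := by
  have h1 : ∀ᶠ ε in 𝓝[>] (0 : ℝ), ∀ k ∈ S, 0 < a k + ε * b k := by
    rw [Filter.eventually_all_finset]
    intro k hk
    rcases h k hk with h | ⟨h, h'⟩
    · have : Tendsto (fun ε : ℝ => a k + ε * b k) (𝓝[>] 0) (𝓝 (a k + 0 * b k)) :=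
        (Continuous.tendsto (by fun_prop) 0).mono_left nhdsWithin_le_nhds
      exact this.eventually (lt_mem_nhds (by simpa using h))
    · filter_upwards [self_mem_nhdsWithin] with ε hε
      rw [h, zero_add]
      exact mul_pos hε h'
  obtain ⟨ε, h2, h3⟩ := (h1.and self_mem_nhdsWithin).exists
  exact ⟨ε, h3, h2⟩

/-- Gift wrapping leads to a neighbour again: the facet functional, turned slightly around the edge
from `i` to `j'`, is strict. -/
lemma Next.adj {i j j' : ℕ} (hp : Sites n p) (hi : i < n) (hj : j < n) (hji : j ≠ i)
    (h : Next n p i j j') :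
    Adj n p i j' := by
  have hν := h.cross_ne_zero hp hi hj hji
  obtain ⟨hj', hji', hjj, hall⟩ := h
  have hν' := dot_self_pos hν
  set a := p j - p i with ha
  set b := p j' - p i with hb
  have hgb : dot (cross b (cross a b)) b = 0 := det_self_outer _ _
  have hga : dot (cross b (cross a b)) a = dot (cross a b) (cross a b) := by
    simp only [dot, cross_zero, cross_one, cross_two]; ring
  obtain ⟨ε, hε, hpos⟩ := exists_pos_comb (Finset.range n \ {i, j'})
    (fun k => det a b (p k - p i)) (fun k => dot (cross b (cross a b)) (p k - p i)) (by
      intro k hk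
      simp only [Finset.mem_sdiff, Finset.mem_range, Finset.mem_insert, Finset.mem_singleton,
        not_or] at hk
      obtain ⟨h1, h2⟩ := hall k hk.1
      rcases h1.lt_or_eq with h1 | h1
      · exact Or.inl h1
      refine Or.inr ⟨h1.symm, ?_⟩
      obtain ⟨r, t, hr, ht, hx⟩ := h2 h1.symm
      rw [hx, dot_add_right, dot_smul_right, dot_smul_right, hga, hgb, mul_zero, add_zero]
      refine mul_pos (lt_of_le_of_ne hr ?_) hν'
      rintro rfl
      apply hp.cross_ne_zero hi hk.1 hj' hk.2.1 hji' hk.2.2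
      rw [hx, zero_smul, zero_add, ← hb]
      apply ext3 <;> simp <;> ring)
  refine ⟨hj', hji', cross a b + ε • cross b (cross a b), ?_, ?_⟩
  · rw [dot_add_left, dot_smul_left, ← hb, hgb, mul_zero, add_zero]
    exact det_self_right _ _
  · intro k hk hki hkj
    have := hpos k (by simp [hk, hki, hkj])
    rw [dot_add_left, dot_smul_left]
    exact this

/-- A site has at most one predecessor. -/
lemma Next.pred_unique {i j k l : ℕ} (hp : Sites n p) (hi : i < n) (hj : j < n) (hk : k < n)
    (hji : j ≠ i) (hki : k ≠ i)
    (h : Next n p i j l) (h' : Next n p i k l) : j = k := by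
  by_contra hne
  have h1 := h.2.2.2 k hk
  have h2 := h'.2.2.2 j hj
  have h3 : det (p j - p i) (p l - p i) (p k - p i) =
      - det (p k - p i) (p l - p i) (p j - p i) := by
    simp only [det, dot, cross_zero, cross_one, cross_two]; ring
  obtain ⟨r, t, hr, ht, hx⟩ := h1.2 (by linarith [h1.1, h2.1])
  obtain ⟨r', t', hr', ht', hx'⟩ := h2.2 (by linarith [h1.1, h2.1])
  have hν := h.cross_ne_zero hp hi hj hji
  have h4 : (1 : ℝ) • (p j - p i) + (0 : ℝ) • (p l - p i)
      = (r' * r) • (p j - p i) + (r' * t + t') • (p l - p i) := by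
    rw [one_smul, zero_smul, add_zero]
    nth_rewrite 1 [hx', hx]
    module
  obtain ⟨h5, h6⟩ := comb_unique hν h4
  have h7 : r' * t = 0 := by nlinarith [mul_nonneg hr' ht]
  rcases mul_eq_zero.1 h7 with h8 | h8
  · rw [h8] at h5; simp at h5
  · apply hp.cross_ne_zero hi hj hk hji hki hne
    rw [hx, h8, zero_smul, add_zero]
    apply ext3 <;> simp <;> ring
end
end BlochFan

/-! ### The number of edges of the convex hull is linear -/
namespace BlochFan
variable {n : ℕ} {p : ℕ → E3}

/-- There is a direction in general position: no two sites have the same height. -/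
lemma exists_generic (hp : Sites n p) :
    ∃ f : E3, ∀ i < n, ∀ j < n, i ≠ j → dot f (p i) ≠ dot f (p j) := by
  obtain ⟨g, hg⟩ := Module.exists_dual_forall_apply_ne_zero (K := ℝ)
    (fun x : {x : Fin n × Fin n // x.1 ≠ x.2} => p x.1.1 - p x.1.2) (by
      rintro ⟨⟨i, j⟩, hij⟩ h0
      exact hij (Fin.ext (hp.inj i i.2 j j.2 (sub_eq_zero.1 h0))))
  refine ⟨!₂[g !₂[1, 0, 0], g !₂[0, 1, 0], g !₂[0, 0, 1]], fun i hi j hj hij h => ?_⟩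
  have hgx : ∀ x : E3, g x = dot !₂[g !₂[1, 0, 0], g !₂[0, 1, 0], g !₂[0, 0, 1]] x := by
    intro x
    have hx : x = x 0 • !₂[(1 : ℝ), 0, 0] + x 1 • !₂[(0 : ℝ), 1, 0] + x 2 • !₂[(0 : ℝ), 0, 1] := by
      apply ext3 <;> simp
    nth_rewrite 1 [hx]
    rw [map_add, map_add, map_smul, map_smul, map_smul]
    change x 0 * g !₂[1, 0, 0] + x 1 * g !₂[0, 1, 0] + x 2 * g !₂[0, 0, 1]
      = g !₂[1, 0, 0] * x 0 + g !₂[0, 1, 0] * x 1 + g !₂[0, 0, 1] * x 2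
    ring
  refine hg ⟨(⟨i, hi⟩, ⟨j, hj⟩), fun h => hij (Fin.mk.inj_iff.1 h)⟩ ?_
  exact (hgx _).trans (by rw [dot_sub_right, h, sub_self])

/-- Two planes which support the same vectors and cross the plane `f = 0` in the same sense
coincide. -/
lemma crossing {f a b a' b' : E3} (ha : 0 < dot f a) (hb : dot f b < 0) (ha' : 0 < dot f a')
    (hb' : dot f b' < 0) (h1 : 0 ≤ det a b a') (h2 : 0 ≤ det a b b') (h3 : 0 ≤ det a' b' a)
    (h4 : 0 ≤ det a' b' b) :
    det a b a' = 0 ∧ det a b b' = 0 ∧ det a' b' a = 0 ∧ det a' b' b = 0 := by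
  have h := four_term f a b a' b'
  rw [det_rotate b a' b', det_rotate a a' b'] at h
  have p1 := mul_nonneg ha.le h4
  have p2 := mul_nonneg (neg_nonneg.2 hb.le) h3
  have p3 := mul_nonneg ha'.le h2
  have p4 := mul_nonneg (neg_nonneg.2 hb'.le) h1
  refine ⟨?_, ?_, ?_, ?_⟩
  · exact (mul_eq_zero.1 (show dot f b' * det a b a' = 0 by linarith)).resolve_left hb'.ne
  · exact (mul_eq_zero.1 (show dot f a' * det a b b' = 0 by linarith)).resolve_left ha'.ne'
  · exact (mul_eq_zero.1 (show dot f b * det a' b' a = 0 by linarith)).resolve_left hb.ne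
  · exact (mul_eq_zero.1 (show dot f a * det a' b' b = 0 by linarith)).resolve_left ha.ne'

/-- At the site `i` at most one upward edge has a downward edge as its successor: the facets at `i`
cross the horizontal plane downwards only once. -/
lemma next_up_down_unique (hp : Sites n p) {f : E3} {i j j' k k' : ℕ} (hi : i < n) (hj : j < n)
    (hk : k < n) (h : Next n p i j j') (h' : Next n p i k k')
    (hfj : dot f (p i) < dot f (p j)) (hfj' : dot f (p j') < dot f (p i))
    (hfk : dot f (p i) < dot f (p k)) (hfk' : dot f (p k') < dot f (p i)) : j = k := by
  have hji : j ≠ i := by rintro rfl; exact lt_irrefl _ hfj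
  have hki : k ≠ i := by rintro rfl; exact lt_irrefl _ hfk
  by_contra hjk
  have hjk' : j ≠ k' := by rintro rfl; exact lt_asymm hfj hfk'
  obtain ⟨h1, h2, h3, h4⟩ := crossing (f := f) (a := p j - p i) (b := p j' - p i)
    (a' := p k - p i) (b' := p k' - p i) (by simpa using hfj) (by simpa using hfj')
    (by simpa using hfk) (by simpa using hfk') (h.2.2.2 k hk).1 (h.2.2.2 k' h'.1).1
    (h'.2.2.2 j hj).1 (h'.2.2.2 j' h.1).1
  obtain ⟨r1, t1, hr1, ht1, e1⟩ := (h.2.2.2 k hk).2 h1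
  obtain ⟨r2, t2, hr2, ht2, e2⟩ := (h.2.2.2 k' h'.1).2 h2
  obtain ⟨r3, t3, hr3, ht3, e3⟩ := (h'.2.2.2 j hj).2 h3
  have hν := h.cross_ne_zero hp hi hj hji
  have e4 : (1 : ℝ) • (p j - p i) + (0 : ℝ) • (p j' - p i)
      = (r3 * r1 + t3 * r2) • (p j - p i) + (r3 * t1 + t3 * t2) • (p j' - p i) := by
    rw [one_smul, zero_smul, add_zero]
    nth_rewrite 1 [e3, e1, e2]
    module
  obtain ⟨-, h5⟩ := comb_unique hν e4
  have h6 : r3 * t1 = 0 := by nlinarith [mul_nonneg hr3 ht1, mul_nonneg ht3 ht2]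
  rcases mul_eq_zero.1 h6 with h7 | h7
  · apply hp.cross_ne_zero hi hj h'.1 hji h'.2.1 hjk'
    rw [e3, h7, zero_smul, zero_add]
    apply ext3 <;> simp <;> ring
  · apply hp.cross_ne_zero hi hj hk hji hki hjk
    rw [e1, h7, zero_smul, add_zero]
    apply ext3 <;> simp <;> ring

/-- If the plane of `i`, `j`, `j'` contains `i'`, and that of `i'`, `k`, `k'` contains `i`, and `i`
and `i'` are the lowest sites of their triples, then `i = i'`. -/
lemma base_unique {f : E3} (hf : ∀ i < n, ∀ j < n, i ≠ j → dot f (p i) ≠ dot f (p j))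
    {i j j' i' k k' : ℕ} (hi : i < n) (hi' : i' < n) (h : Next n p i j j') (h' : Next n p i' k k')
    (hfj : dot f (p i) < dot f (p j)) (hfj' : dot f (p i) < dot f (p j'))
    (hfk : dot f (p i') < dot f (p k)) (hfk' : dot f (p i') < dot f (p k'))
    (h0 : det (p j - p i) (p j' - p i) (p i' - p i) = 0)
    (h0' : det (p k - p i') (p k' - p i') (p i - p i') = 0) : i = i' := by
  by_contra hne
  obtain ⟨r, t, hr, ht, e⟩ := (h.2.2.2 i' hi').2 h0
  obtain ⟨r', t', hr', ht', e'⟩ := (h'.2.2.2 i hi).2 h0'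
  have e1 := congrArg (dot f) e
  have e2 := congrArg (dot f) e'
  simp only [dot_sub_right, dot_add_right, dot_smul_right] at e1 e2
  have := mul_nonneg hr (sub_pos.2 hfj).le
  have := mul_nonneg ht (sub_pos.2 hfj').le
  have := mul_nonneg hr' (sub_pos.2 hfk).le
  have := mul_nonneg ht' (sub_pos.2 hfk').le
  exact hf i hi i' hi' hne (by linarith)

lemma det_change_base (a b c d : E3) :
    det (b - a) (c - a) (d - a) = det (c - b) (a - b) (d - b) := by
  simp only [det, dot, cross_zero, cross_one, cross_two, PiLp.sub_apply]; ring

/-- For a given `j`, there is at most one upward edge from some `i` to `j` whose successor around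
`i` ends above `j`: as seen from `j`, the facets of these pairs of edges cross the horizontal plane
in the same sense. -/
lemma next_up_mid_unique {f : E3} (hf : ∀ i < n, ∀ j < n, i ≠ j → dot f (p i) ≠ dot f (p j))
    {i i' j j' k' : ℕ} (hi : i < n) (hi' : i' < n) (h : Next n p i j j') (h' : Next n p i' j k')
    (hfi : dot f (p i) < dot f (p j)) (hfj : dot f (p j) < dot f (p j'))
    (hfi' : dot f (p i') < dot f (p j)) (hfk : dot f (p j) < dot f (p k')) : i = i' := by
  have g1 : ∀ k < n, 0 ≤ det (p j' - p j) (p i - p j) (p k - p j) := fun k hk => by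
    rw [← det_change_base]; exact (h.2.2.2 k hk).1
  have g2 : ∀ k < n, 0 ≤ det (p k' - p j) (p i' - p j) (p k - p j) := fun k hk => by
    rw [← det_change_base]; exact (h'.2.2.2 k hk).1
  obtain ⟨h1, h2, h3, h4⟩ := crossing (f := f) (a := p j' - p j) (b := p i - p j)
    (a' := p k' - p j) (b' := p i' - p j) (by simpa using hfj) (by simpa using hfi)
    (by simpa using hfk) (by simpa using hfi') (g1 _ h'.1) (g1 _ hi') (g2 _ h.1) (g2 _ hi)
  rw [← det_change_base] at h2 h4
  exact base_unique hf hi hi' h h' hfi (hfi.trans hfj) hfi' (hfi'.trans hfk) h2 h4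

/-- For a given `l`, there is at most one site `i` with an upward edge whose successor ends at `l`,
between the heights of the two ends of the edge: the same argument, seen from `l`. -/
lemma next_mid_up_unique {f : E3} (hf : ∀ i < n, ∀ j < n, i ≠ j → dot f (p i) ≠ dot f (p j))
    {i i' j k l : ℕ} (hi : i < n) (hi' : i' < n) (hj : j < n) (hk : k < n)
    (h : Next n p i j l) (h' : Next n p i' k l)
    (hfi : dot f (p i) < dot f (p l)) (hfj : dot f (p l) < dot f (p j))
    (hfi' : dot f (p i') < dot f (p l)) (hfk : dot f (p l) < dot f (p k)) : i = i' := by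
  have g1 : ∀ m < n, 0 ≤ det (p i - p l) (p j - p l) (p m - p l) := fun m hm => by
    rw [← det_change_base, ← det_change_base]; exact (h.2.2.2 m hm).1
  have g2 : ∀ m < n, 0 ≤ det (p i' - p l) (p k - p l) (p m - p l) := fun m hm => by
    rw [← det_change_base, ← det_change_base]; exact (h'.2.2.2 m hm).1
  obtain ⟨h1, h2, h3, h4⟩ := crossing (f := -f) (a := p i - p l) (b := p j - p l)
    (a' := p i' - p l) (b' := p k - p l) (by simpa using hfi) (by simpa using hfj)
    (by simpa using hfi') (by simpa using hfk) (g1 _ hi') (g1 _ hk) (g2 _ hi) (g2 _ hj)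
  rw [← det_change_base, ← det_change_base] at h1 h3
  exact base_unique hf hi hi' h h' (hfi.trans hfj) hfi (hfi'.trans hfk) hfi' h1 h3

open Classical in
/-- The number of edges of the convex hull at the site `i`. -/
noncomputable def degree (n : ℕ) (p : ℕ → E3) (i : ℕ) : ℕ :=
  ((Finset.range n).filter (Adj n p i)).card

open Classical in
/-- There are at most `3 n` upward edges. An upward edge from `i` to `j` is charged to `i`, to `j`
or to the next site after `j` around `i`: to the middle one of the three in the order of their
heights. Every site is charged at most once in each of the three ways. -/
lemma card_up_edges_le (hn : 3 ≤ n) (hp : Sites n p) {f : E3}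
    (hf : ∀ i < n, ∀ j < n, i ≠ j → dot f (p i) ≠ dot f (p j)) :
    ((Finset.range n ×ˢ Finset.range n).filter
      (fun x => Adj n p x.1 x.2 ∧ dot f (p x.1) < dot f (p x.2))).card ≤ 3 * n := by
  set U := (Finset.range n ×ˢ Finset.range n).filter
      (fun x => Adj n p x.1 x.2 ∧ dot f (p x.1) < dot f (p x.2)) with hU
  have hmem : ∀ x ∈ U, x.1 < n ∧ x.2 < n ∧ Adj n p x.1 x.2 ∧ dot f (p x.1) < dot f (p x.2) := by
    intro x hx
    simp only [hU, Finset.mem_filter, Finset.mem_product, Finset.mem_range] at hx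
    exact ⟨hx.1.1, hx.1.2, hx.2⟩
  have hex : ∀ x : ℕ × ℕ, ∃ l, x ∈ U → Next n p x.1 x.2 l := by
    intro x
    by_cases hx : x ∈ U
    · obtain ⟨l, hl⟩ := hp.exists_next hn (hmem x hx).1 (hmem x hx).2.2.1
      exact ⟨l, fun _ => hl⟩
    · exact ⟨0, fun h => absurd h hx⟩
  choose g hg using hex
  let U1 := U.filter (fun x => dot f (p (g x)) < dot f (p x.1))
  let U2 := U.filter (fun x => dot f (p x.2) < dot f (p (g x)))
  let U3 := U.filter (fun x => dot f (p x.1) < dot f (p (g x)) ∧ dot f (p (g x)) < dot f (p x.2))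
  have hsub : U ⊆ U1 ∪ U2 ∪ U3 := by
    intro x hx
    have h1 := hmem x hx
    have h2 := hg x hx
    simp only [U1, U2, U3, Finset.mem_union, Finset.mem_filter, hx, true_and]
    have h3 := hf (g x) h2.1 x.1 h1.1 h2.2.1
    have h4 := hf (g x) h2.1 x.2 h1.2.1 h2.2.2.1
    rcases h3.lt_or_gt with h5 | h5
    · exact Or.inl (Or.inl h5)
    · rcases h4.lt_or_gt with h6 | h6
      · exact Or.inr ⟨h5, h6⟩
      · exact Or.inl (Or.inr h6)
  have c1 : U1.card ≤ n := by
    rw [← Finset.card_range n]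
    refine Finset.card_le_card_of_injOn (fun x => x.1) ?_ ?_
    · intro x hx
      simpa using (hmem x (Finset.mem_filter.1 hx).1).1
    · rintro ⟨i, j⟩ hx ⟨i', j'⟩ hy hxy
      simp only [U1, Finset.coe_filter, Set.mem_ofPred_eq] at hx hy hxy
      subst hxy
      have a1 := hmem _ hx.1
      have a2 := hmem _ hy.1
      exact congrArg (Prod.mk i) (next_up_down_unique hp a1.1 a1.2.1 a2.2.1 (hg _ hx.1) (hg _ hy.1)
        a1.2.2.2 hx.2 a2.2.2.2 hy.2)
  have c2 : U2.card ≤ n := by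
    rw [← Finset.card_range n]
    refine Finset.card_le_card_of_injOn (fun x => x.2) ?_ ?_
    · intro x hx
      simpa using (hmem x (Finset.mem_filter.1 hx).1).2.1
    · rintro ⟨i, j⟩ hx ⟨i', j'⟩ hy hxy
      simp only [U2, Finset.coe_filter, Set.mem_ofPred_eq] at hx hy hxy
      subst hxy
      have a1 := hmem _ hx.1
      have a2 := hmem _ hy.1
      exact congrArg (fun x => (x, j)) (next_up_mid_unique hf a1.1 a2.1 (hg _ hx.1) (hg _ hy.1)
        a1.2.2.2 hx.2 a2.2.2.2 hy.2)
  have c3 : U3.card ≤ n := by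
    rw [← Finset.card_range n]
    refine Finset.card_le_card_of_injOn g ?_ ?_
    · intro x hx
      simpa using (hg x (Finset.mem_filter.1 hx).1).1
    · rintro ⟨i, j⟩ hx ⟨i', j'⟩ hy hxy
      simp only [U3, Finset.coe_filter, Set.mem_ofPred_eq] at hx hy
      have a1 := hmem _ hx.1
      have a2 := hmem _ hy.1
      have b1 := hg _ hx.1
      have b2 := hg _ hy.1
      rw [← hxy] at b2 hy
      have e1 : i = i' := next_mid_up_unique hf a1.1 a2.1 a1.2.1 a2.2.1 b1 b2 hx.2.1 hx.2.2
        hy.2.1 hy.2.2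
      subst e1
      have e2 : j = j' := Next.pred_unique hp a1.1 a1.2.1 a2.2.1 a1.2.2.1.2.1 a2.2.2.1.2.1 b1 b2
      rw [e2]
  calc U.card ≤ (U1 ∪ U2 ∪ U3).card := Finset.card_le_card hsub
    _ ≤ (U1 ∪ U2).card + U3.card := Finset.card_union_le _ _
    _ ≤ U1.card + U2.card + U3.card := by gcongr; exact Finset.card_union_le _ _
    _ ≤ 3 * n := by omega

open Classical in
/-- The convex hull of `n ≥ 3` points of the sphere has at most `3 n` edges, each with two ends. -/
lemma sum_degree_le (hn : 3 ≤ n) (hp : Sites n p) :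
    ∑ i ∈ Finset.range n, degree n p i ≤ 6 * n := by
  obtain ⟨f, hf⟩ := exists_generic hp
  have h1 := card_up_edges_le hn hp hf
  have h2 := card_up_edges_le hn hp (f := -f) (fun i hi j hj hij => by
    simpa using hf i hi j hj hij)
  have h3 : ∑ i ∈ Finset.range n, degree n p i =
      ((Finset.range n ×ˢ Finset.range n).filter (fun x => Adj n p x.1 x.2)).card := by
    rw [Finset.card_filter, Finset.sum_product]
    simp only [degree, Finset.card_filter]
  have h4 : (Finset.range n ×ˢ Finset.range n).filter (fun x => Adj n p x.1 x.2) ⊆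
      (Finset.range n ×ˢ Finset.range n).filter
        (fun x => Adj n p x.1 x.2 ∧ dot f (p x.1) < dot f (p x.2)) ∪
      (Finset.range n ×ˢ Finset.range n).filter
        (fun x => Adj n p x.1 x.2 ∧ dot (-f) (p x.1) < dot (-f) (p x.2)) := by
    intro x hx
    simp only [Finset.mem_filter, Finset.mem_product, Finset.mem_range, Finset.mem_union,
      dot_neg_left, neg_lt_neg_iff] at hx ⊢
    rcases (hf x.1 hx.1.1 x.2 hx.1.2 hx.2.2.1.symm).lt_or_gt with h | h
    · exact Or.inl ⟨hx.1, hx.2, h⟩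
    · exact Or.inr ⟨hx.1, hx.2, h⟩
  rw [h3]
  refine (Finset.card_le_card h4).trans ((Finset.card_union_le _ _).trans ?_)
  omega
end BlochFan

/-! ### Faces of the fan -/
namespace BlochFan
variable {n : ℕ} {p : ℕ → E3}

/-- The sites with the greatest inner product with `v`. -/
def argmaxSet (n : ℕ) (p : ℕ → E3) (v : E3) : Set ℕ :=
  {k | k < n ∧ ∀ l < n, dot v (p l) ≤ dot v (p k)}

/-- The record of a cone: its only point is the origin. -/
def coneRecord (sites : List ℕ) (rays : List E3) : FaceRecord := ⟨sites, [0], rays⟩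

lemma coneRecord_polyhedron (sites : List ℕ) (rays : List E3) :
    (coneRecord sites rays).polyhedron = (Submodule.span NNReal {x | x ∈ rays} : Set E3) := by
  have : {x : E3 | x ∈ [(0 : E3)]} = {0} := by ext; simp
  simp only [FaceRecord.polyhedron, coneRecord, this, convexHull_singleton]
  ext x
  simp

lemma smul_mem_cone {S : Set E3} {x : E3} (hx : x ∈ Submodule.span NNReal S) {c : ℝ} (hc : 0 ≤ c) :
    c • x ∈ Submodule.span NNReal S :=
  Submodule.smul_mem _ (⟨c, hc⟩ : NNReal) hx

lemma ray_mem_cone {l : List E3} {x : E3} (hx : x ∈ l) {c : ℝ} (hc : 0 ≤ c) :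
    c • x ∈ Submodule.span NNReal {x | x ∈ l} :=
  smul_mem_cone (Submodule.subset_span hx) hc

/-- The record describes a face of the fan of the sites: its site list is the set of maximizers of
some vector, and its polyhedron is the set of vectors which are maximal at all these sites. -/
structure IsFace (n : ℕ) (p : ℕ → E3) (f : FaceRecord) : Prop where
  nodup : f.sites.Nodup
  realized : ∃ v, {k | k ∈ f.sites} = argmaxSet n p v
  shape : ∀ v, v ∈ f.polyhedron ↔ ∀ k ∈ f.sites, k ∈ argmaxSet n p v

/-- The list consists of all faces of the fan of the sites, without repetition. -/
structure IsComplete (n : ℕ) (p : ℕ → E3) (F : List FaceRecord) : Prop where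
  face : ∀ f ∈ F, IsFace n p f
  nodup : (F.map fun f => f.sites.toFinset).Nodup
  complete : ∀ v, ∃ f ∈ F, {k | k ∈ f.sites} = argmaxSet n p v

/-- The list consists of those faces of the fan whose least site is `i`, except the face of all
sites. -/
structure IsLocal (n : ℕ) (p : ℕ → E3) (i : ℕ) (L : List FaceRecord) : Prop where
  face : ∀ f ∈ L, IsFace n p f
  mem : ∀ f ∈ L, i ∈ f.sites
  least : ∀ f ∈ L, ∀ k ∈ f.sites, i ≤ k
  proper : ∀ f ∈ L, ∃ k < n, k ∉ f.sites
  nodup : (L.map fun f => f.sites.toFinset).Nodup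
  complete : ∀ v, i ∈ argmaxSet n p v → (∀ k ∈ argmaxSet n p v, i ≤ k) →
    (∃ k < n, k ∉ argmaxSet n p v) → ∃ f ∈ L, {k | k ∈ f.sites} = argmaxSet n p v

lemma mem_argmaxSet {i : ℕ} {v : E3} :
    i ∈ argmaxSet n p v ↔ i < n ∧ ∀ l < n, 0 ≤ dot (-v) (p l - p i) := by
  simp [argmaxSet]

lemma mem_argmaxSet_iff {i k : ℕ} {v : E3} (hi : i ∈ argmaxSet n p v) :
    k ∈ argmaxSet n p v ↔ k < n ∧ dot v (p k - p i) = 0 := by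
  simp only [argmaxSet, Set.mem_ofPred_eq, dot_sub_right] at *
  constructor
  · rintro ⟨h1, h2⟩
    exact ⟨h1, by linarith [hi.2 k h1, h2 i hi.1]⟩
  · rintro ⟨h1, h2⟩
    exact ⟨h1, fun l hl => by linarith [hi.2 l hl]⟩

/-- The vectors which are maximal at given sites form a convex cone, so that a record is a face as
soon as its rays are in this cone and span it. -/
lemma isFace_coneRecord {sites : List ℕ} {rays : List E3} (hnd : sites.Nodup)
    (hre : ∃ v, {k | k ∈ sites} = argmaxSet n p v)
    (hrays : ∀ r ∈ rays, ∀ k ∈ sites, k ∈ argmaxSet n p r)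
    (hshape : ∀ v, (∀ k ∈ sites, k ∈ argmaxSet n p v) →
      v ∈ Submodule.span NNReal {x | x ∈ rays}) : IsFace n p (coneRecord sites rays) := by
  have hlt : ∀ k ∈ sites, k < n := by
    obtain ⟨v, hv⟩ := hre
    intro k hk
    have : k ∈ argmaxSet n p v := by rw [← hv]; exact hk
    exact this.1
  refine ⟨hnd, hre, fun v => ?_⟩
  rw [coneRecord_polyhedron]
  refine ⟨fun hv => ?_, hshape v⟩
  refine Submodule.span_induction (p := fun v _ => ∀ k ∈ sites, k ∈ argmaxSet n p v)
    (fun r hr => hrays r hr) ?_ ?_ ?_ hv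
  · intro k hk
    exact ⟨hlt k hk, fun l _ => by simp⟩
  · intro x y _ _ hx hy k hk
    exact ⟨hlt k hk, fun l hl => by
      rw [dot_add_left, dot_add_left]; exact add_le_add ((hx k hk).2 l hl) ((hy k hk).2 l hl)⟩
  · intro c x _ hx k hk
    refine ⟨hlt k hk, fun l hl => ?_⟩
    rw [NNReal.smul_def, dot_smul_left, dot_smul_left]
    exact mul_le_mul_of_nonneg_left ((hx k hk).2 l hl) c.2

/-- Every face other than that of all sites is listed exactly once, at its least site. -/
lemma isComplete_of_local {Ls : ℕ → List FaceRecord} {g : FaceRecord} (hn : 1 ≤ n)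
    (hL : ∀ i < n, IsLocal n p i (Ls i)) (hg : IsFace n p g) (hgs : g.sites = List.range n) :
    IsComplete n p ((List.range n).flatMap Ls ++ [g]) := by
  refine ⟨?_, ?_, ?_⟩
  · intro f hf
    rcases List.mem_append.1 hf with hf | hf
    · obtain ⟨i, hi, hf⟩ := List.mem_flatMap.1 hf
      exact (hL i (List.mem_range.1 hi)).face f hf
    · rw [List.mem_singleton.1 hf]; exact hg
  · rw [List.map_append, List.nodup_append', List.map_flatMap]
    refine ⟨?_, by simp, ?_⟩
    · rw [List.nodup_flatMap]
      refine ⟨fun i hi => (hL i (List.mem_range.1 hi)).nodup, ?_⟩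
      refine List.Pairwise.imp_of_mem ?_ (List.nodup_range (n := n))
      intro i j hi hj hij
      simp only [Function.onFun]
      intro x hx hy
      obtain ⟨f, hf, rfl⟩ := List.mem_map.1 hx
      obtain ⟨f', hf', he⟩ := List.mem_map.1 hy
      have h1 := (hL i (List.mem_range.1 hi)).mem f hf
      have h2 := (hL j (List.mem_range.1 hj)).mem f' hf'
      have h3 : j ∈ f.sites := by rw [← List.mem_toFinset, ← he, List.mem_toFinset]; exact h2
      have h4 : i ∈ f'.sites := by rw [← List.mem_toFinset, he, List.mem_toFinset]; exact h1
      exact hij (le_antisymm ((hL i (List.mem_range.1 hi)).least f hf j h3)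
        ((hL j (List.mem_range.1 hj)).least f' hf' i h4))
    · intro x hx hy
      obtain ⟨i, hi, hx⟩ := List.mem_flatMap.1 hx
      obtain ⟨f, hf, rfl⟩ := List.mem_map.1 hx
      obtain ⟨k, hk, hkf⟩ := (hL i (List.mem_range.1 hi)).proper f hf
      simp only [List.map_cons, List.map_nil, List.mem_singleton] at hy
      apply hkf
      rw [← List.mem_toFinset, hy, hgs]
      simpa using hk
  · intro v
    by_cases hall : ∀ k < n, k ∈ argmaxSet n p v
    · refine ⟨g, by simp, ?_⟩
      ext k
      simp only [hgs, List.mem_range, Set.mem_ofPred_eq]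
      exact ⟨hall k, fun h => h.1⟩
    · push Not at hall
      have hex : ∃ k, k ∈ argmaxSet n p v := by
        obtain ⟨k, hk, hmax⟩ := Finset.exists_max_image (Finset.range n) (fun k => dot v (p k))
          ⟨0, Finset.mem_range.2 hn⟩
        exact ⟨k, Finset.mem_range.1 hk, fun l hl => hmax l (Finset.mem_range.2 hl)⟩
      classical
      have h1 := Nat.find_spec hex
      obtain ⟨f, hf, he⟩ := (hL (Nat.find hex) h1.1).complete v h1
        (fun k hk => Nat.find_min' hex hk) hall
      refine ⟨f, List.mem_append_left _ (List.mem_flatMap.2 ⟨_, List.mem_range.2 h1.1, hf⟩), he⟩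

lemma Sites.argmaxSet_self (hp : Sites n p) {i : ℕ} (hi : i < n) : argmaxSet n p (p i) = {i} := by
  ext k
  have h1 := hp.unit i hi
  have h2 : ∀ l < n, l ≠ i → dot (p i) (p l) < 1 := fun l hl hli => by
    have := hp.dot_diff_neg hi hl hli
    rw [dot_sub_right, h1] at this; linarith
  simp only [argmaxSet, Set.mem_ofPred_eq, Set.mem_singleton_iff]
  constructor
  · rintro ⟨hk, h⟩
    by_contra hki
    linarith [h i hi, h2 k hk hki]
  · rintro rfl
    refine ⟨hi, fun l hl => ?_⟩
    by_cases hli : l = k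
    · rw [hli]
    · linarith [h2 l hl hli]

/-- The functional of an edge, with its sign changed, is maximal exactly at the two ends. -/
lemma argmaxSet_of_adj {i j : ℕ} (hi : i < n) (hj : j < n) {u : E3} (hu : dot u (p j - p i) = 0)
    (h : ∀ k < n, k ≠ i → k ≠ j → 0 < dot u (p k - p i)) : argmaxSet n p (-u) = {i, j} := by
  have hmem : i ∈ argmaxSet n p (-u) := by
    rw [mem_argmaxSet, neg_neg]
    refine ⟨hi, fun l hl => ?_⟩
    by_cases hli : l = i
    · simp [hli]
    by_cases hlj : l = j
    · rw [hlj, hu]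
    · exact (h l hl hli hlj).le
  ext k
  rw [mem_argmaxSet_iff hmem, dot_neg_left, neg_eq_zero]
  simp only [Set.mem_insert_iff, Set.mem_singleton_iff]
  constructor
  · rintro ⟨hk, h0⟩
    by_contra hcon
    push Not at hcon
    exact (h k hk hcon.1 hcon.2).ne' h0
  · rintro (rfl | rfl)
    · exact ⟨hi, by simp⟩
    · exact ⟨hj, hu⟩

/-! ### The facets around a site -/

/-- The sites affinely span the space. -/
def Spatial (n : ℕ) (p : ℕ → E3) : Prop :=
  ∀ i < n, ∀ u : E3, (∀ k < n, dot u (p k - p i) = 0) → u = 0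

/-- The sequence `A 0, …, A m = A 0` runs once around the neighbours of the site `i`. It is
continued by one more term, `A (m + 1) = A 1`, so that every neighbour `A (t + 1)` with `t < m` lies
between two consecutive facets. -/
structure IsMarch (n : ℕ) (p : ℕ → E3) (i m : ℕ) (A : ℕ → ℕ) : Prop where
  lt : i < n
  start : Adj n p i (A 0)
  pos : 0 < m
  step : ∀ t < m, Next n p i (A t) (A (t + 1))
  ret : A m = A 0
  ret_succ : A (m + 1) = A 1
  first : ∀ t, 0 < t → t < m → A t ≠ A 0

lemma adj_of_steps (hp : Sites n p) {i m : ℕ} {A : ℕ → ℕ} (hi : i < n) (h0 : Adj n p i (A 0))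
    (hs : ∀ t < m, Next n p i (A t) (A (t + 1))) : ∀ t ≤ m, Adj n p i (A t) := by
  intro t
  induction t with
  | zero => intro _; exact h0
  | succ t ih =>
    intro ht
    have := ih (by omega)
    exact (hs t (by omega)).adj hp hi this.1 this.2.1

/-- Before the first return, gift wrapping does not repeat a site. -/
lemma injOn_of_steps (hp : Sites n p) {i m : ℕ} {A : ℕ → ℕ} (hi : i < n) (h0 : Adj n p i (A 0))
    (hs : ∀ t < m, Next n p i (A t) (A (t + 1))) (hfirst : ∀ t, 0 < t → t ≤ m → A t ≠ A 0) :
    ∀ s t, s < t → t ≤ m → A s ≠ A t := by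
  have hadj := adj_of_steps hp hi h0 hs
  intro s
  induction s with
  | zero => intro t h1 h2; exact (hfirst t h1 h2).symm
  | succ s ih =>
    intro t h1 h2 h3
    obtain ⟨t, rfl⟩ : ∃ t', t = t' + 1 := ⟨t - 1, by omega⟩
    refine ih t (by omega) (by omega) ?_
    have a1 := hadj s (by omega)
    have a2 := hadj t (by omega)
    have b1 := hs s (by omega)
    have b2 := hs t (by omega)
    rw [← h3] at b2
    exact Next.pred_unique hp hi a1.1 a2.1 a1.2.1 a2.2.1 b1 b2

/-- A sequence which has not yet returned consists of different neighbours of `i`; hence gift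
wrapping ends after at most `degree n p i` steps. -/
lemma steps_le_degree (hp : Sites n p) {i m : ℕ} {A : ℕ → ℕ} (hi : i < n) (h0 : Adj n p i (A 0))
    (hs : ∀ t < m, Next n p i (A t) (A (t + 1))) (hfirst : ∀ t, 0 < t → t ≤ m → A t ≠ A 0) :
    m < degree n p i := by
  classical
  have hadj := adj_of_steps hp hi h0 hs
  have hinj := injOn_of_steps hp hi h0 hs hfirst
  rw [degree]
  have : (Finset.range (m + 1)).card ≤ ((Finset.range n).filter (Adj n p i)).card := by
    refine Finset.card_le_card_of_injOn A ?_ ?_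
    · intro t ht
      have := hadj t (by simpa [Nat.lt_succ_iff] using ht)
      simpa using ⟨this.1, this⟩
    · intro s hs t ht hst
      simp only [Finset.coe_range, Set.mem_Iio] at hs ht
      rcases lt_trichotomy s t with h | h | h
      · exact absurd hst (hinj s t h (by omega))
      · exact h
      · exact absurd hst.symm (hinj t s h (by omega))
  rw [Finset.card_range] at this
  exact Nat.lt_of_succ_le (by convert this)

/-- The only neighbours of `i` in the plane of the facet of `i`, `j`, `j'` are `j` and `j'`. -/
lemma Next.det_pos {i j j' q : ℕ} (hp : Sites n p) (hi : i < n) (h : Next n p i j j')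
    (hj : j < n) (hji : j ≠ i) (hq : Adj n p i q) (hqj : q ≠ j) (hqj' : q ≠ j') :
    0 < det (p j - p i) (p j' - p i) (p q - p i) := by
  obtain ⟨hqn, hqi, u, hu, hpos⟩ := hq
  obtain ⟨h1, h2⟩ := h.2.2.2 q hqn
  refine lt_of_le_of_ne h1 fun h0 => ?_
  obtain ⟨r, t, hr, ht, hx⟩ := h2 h0.symm
  have a1 := hpos j hj hji hqj.symm
  have a2 := hpos j' h.1 h.2.1 hqj'.symm
  rw [hx, dot_add_right, dot_smul_right, dot_smul_right] at hu
  have b1 := mul_nonneg hr a1.le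
  have b2 := mul_nonneg ht a2.le
  have hr0 : r = 0 :=
    (mul_eq_zero.1 (show r * dot u (p j - p i) = 0 by linarith)).resolve_right a1.ne'
  have ht0 : t = 0 :=
    (mul_eq_zero.1 (show t * dot u (p j' - p i) = 0 by linarith)).resolve_right a2.ne'
  apply hp.diff_ne_zero hi hqn hqi
  rw [hx, hr0, ht0]; simp

/-- Two neighbours follow each other in both directions only if all sites lie in a plane. -/
lemma Next.not_symm {i j j' : ℕ} (hp : Sites n p) (hs : Spatial n p) (hi : i < n)
    (hj : j < n) (hji : j ≠ i) (h : Next n p i j j') (h' : Next n p i j' j) : False := by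
  refine h.cross_ne_zero hp hi hj hji (hs i hi _ fun k hk => ?_)
  have h1 := (h.2.2.2 k hk).1
  have h2 := (h'.2.2.2 k hk).1
  rw [det_swap] at h2
  exact (le_antisymm (by linarith) h1 : det (p j - p i) (p j' - p i) (p k - p i) = 0)

/-- A discrete intermediate value theorem. -/
lemma exists_sign_change (g : ℕ → ℝ) {M : ℕ} (h1 : 0 ≤ g 1) (hM : g (M + 2) ≤ 0) :
    ∃ t, 1 ≤ t ∧ t ≤ M + 1 ∧ 0 ≤ g t ∧ g (t + 1) ≤ 0 := by
  induction M with
  | zero => exact ⟨1, le_rfl, le_rfl, h1, hM⟩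
  | succ M ih =>
    by_cases h : g (M + 2) ≤ 0
    · obtain ⟨t, a, b, c⟩ := ih h
      exact ⟨t, a, by omega, c⟩
    · exact ⟨M + 2, by omega, le_rfl, (not_le.1 h).le, hM⟩

/-- Two vectors orthogonal to the same plane are parallel. -/
lemma cross_eq_zero_of_orthogonal {a b x y : E3} (h : cross x y ≠ 0) (ha : dot a x = 0)
    (ha' : dot a y = 0) (hb : dot b x = 0) (hb' : dot b y = 0) : cross a b = 0 := by
  have hw := dot_self_pos h
  have key : ∀ c, dot c x = 0 → dot c y = 0 →
      c = (dot c (cross x y) / dot (cross x y) (cross x y)) • cross x y := by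
    intro c h1 h2
    have h3 := det_smul_eq x y (cross x y) c
    rw [h1, h2, zero_smul, zero_smul, add_zero, add_zero] at h3
    have h4 := congrArg (fun z => (dot (cross x y) (cross x y))⁻¹ • z) h3
    simp only [smul_smul, det, inv_mul_cancel₀ hw.ne', one_smul] at h4
    rw [div_eq_inv_mul]
    exact h4
  rw [key a ha ha', key b hb hb']
  apply ext3 <;> simp <;> ring

namespace IsMarch
variable {i m : ℕ} {A : ℕ → ℕ}

lemma adj (h : IsMarch n p i m A) (hp : Sites n p) {t : ℕ} (ht : t ≤ m + 1) :
    Adj n p i (A t) := by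
  have h1 := adj_of_steps hp h.lt h.start h.step
  rcases Nat.lt_or_ge t (m + 1) with h2 | h2
  · exact h1 t (by omega)
  · obtain rfl : t = m + 1 := by omega
    rw [h.ret_succ]; exact h1 1 h.pos

lemma next (h : IsMarch n p i m A) {t : ℕ} (ht : t ≤ m) : Next n p i (A t) (A (t + 1)) := by
  rcases ht.lt_or_eq with h2 | rfl
  · exact h.step t h2
  · rw [h.ret_succ, h.ret]; exact h.step 0 h.pos

lemma ne (h : IsMarch n p i m A) (hp : Sites n p) {s t : ℕ} (hst : s < t) (ht : t < m) :
    A s ≠ A t := by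
  refine injOn_of_steps hp h.lt h.start (m := m - 1) (fun t ht => h.step t (by omega))
    (fun t h0 ht => h.first t h0 (by omega)) s t hst (by omega)

lemma inj (h : IsMarch n p i m A) (hp : Sites n p) {s t : ℕ} (hs : s < m) (ht : t < m)
    (he : A s = A t) : s = t := by
  rcases lt_trichotomy s t with h1 | h1 | h1
  · exact absurd he (h.ne hp h1 ht)
  · exact h1
  · exact absurd he.symm (h.ne hp h1 hs)

lemma inj_succ (h : IsMarch n p i m A) (hp : Sites n p) {s t : ℕ} (hs : s < m) (ht : t < m)
    (he : A (s + 1) = A (t + 1)) : s = t := by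
  have a1 := h.adj hp (t := s) (by omega)
  have a2 := h.adj hp (t := t) (by omega)
  have b1 := h.step s hs
  rw [he] at b1
  exact h.inj hp hs ht (Next.pred_unique hp h.lt a1.1 a2.1 a1.2.1 a2.2.1 b1 (h.step t ht))

lemma three_le (h : IsMarch n p i m A) (hp : Sites n p) (hs : Spatial n p) : 3 ≤ m := by
  have h0 := h.pos
  have h1 := h.step 0 h0
  by_contra hcon
  rcases (by omega : m = 1 ∨ m = 2) with rfl | rfl
  · exact h1.2.2.1 h.ret
  · have h2 := h.step 1 (by omega)
    have h3 : A (1 + 1) = A 0 := h.ret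
    rw [h3] at h2
    exact Next.not_symm hp hs h.lt h.start.1 h.start.2.1 h1 h2

lemma ne_add_two (h : IsMarch n p i m A) (hp : Sites n p) (hs : Spatial n p) {t : ℕ} (ht : t < m) :
    A (t + 2) ≠ A t := by
  intro he
  have h1 := h.next (t := t + 1) (by omega)
  have h2 := h.step t ht
  have h3 := h.adj hp (t := t) (by omega)
  rw [show t + 1 + 1 = t + 2 from rfl, he] at h1
  exact Next.not_symm hp hs h.lt h3.1 h3.2.1 h2 h1

/-- Three consecutive neighbours of `i` are positively oriented as seen from `i`. -/
lemma corner_pos (h : IsMarch n p i m A) (hp : Sites n p) (hs : Spatial n p) {t : ℕ} (ht : t < m) :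
    0 < det (p (A t) - p i) (p (A (t + 1)) - p i) (p (A (t + 2)) - p i) := by
  have h3 := h.adj hp (t := t) (by omega)
  exact (h.step t ht).det_pos hp h.lt h3.1 h3.2.1 (h.adj hp (by omega)) (h.ne_add_two hp hs ht)
    (h.next (t := t + 1) (by omega)).2.2.1

/-- Gift wrapping around `i` meets every neighbour of `i`: the direction of a neighbour which it
misses would lie in the cone of the directions of `A 0` and of two consecutive neighbours, on all of
which the functional of its edge is positive. -/
lemma exists_eq (h : IsMarch n p i m A) (hp : Sites n p) (hs : Spatial n p) {q : ℕ}
    (hq : Adj n p i q) : ∃ t < m, A t = q := by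
  by_contra hcon
  push Not at hcon
  have hm := h.three_le hp hs
  obtain ⟨hqn, hqi, u, hu, hpos⟩ := id hq
  have hpos' : ∀ t < m, 0 < dot u (p (A t) - p i) := fun t ht =>
    hpos _ (h.adj hp (by omega)).1 (h.adj hp (by omega)).2.1 (hcon t ht)
  have hdet : ∀ t < m, 0 < det (p (A t) - p i) (p (A (t + 1)) - p i) (p q - p i) := by
    intro t ht
    have h3 := h.adj hp (t := t) (by omega)
    refine (h.step t ht).det_pos hp h.lt h3.1 h3.2.1 hq (hcon t ht).symm ?_
    rcases Nat.lt_or_ge (t + 1) m with h4 | h4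
    · exact (hcon _ h4).symm
    · rw [show t + 1 = m by omega, h.ret]; exact (hcon 0 h.pos).symm
  obtain ⟨t, h1, h2, h3, h4⟩ := exists_sign_change
    (fun t => det (p (A 0) - p i) (p (A t) - p i) (p q - p i)) (M := m - 3)
    (hdet 0 h.pos).le (by
      have := hdet (m - 1) (by omega)
      rw [show m - 1 + 1 = m by omega, h.ret, det_swap] at this
      rw [show m - 3 + 2 = m - 1 by omega]
      linarith)
  have h5 := four_term u (p (A 0) - p i) (p (A t) - p i) (p (A (t + 1)) - p i) (p q - p i)
  rw [hu] at h5
  have := mul_pos (hpos' 0 h.pos) (hdet t (by omega))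
  have := mul_nonneg (hpos' (t + 1) (by omega)).le h3
  have := mul_nonneg (hpos' t (by omega)).le (neg_nonneg.2 h4)
  linarith

lemma exists_eq_succ (h : IsMarch n p i m A) (hp : Sites n p) (hs : Spatial n p) {q : ℕ}
    (hq : Adj n p i q) : ∃ t < m, A (t + 1) = q := by
  obtain ⟨t, ht, he⟩ := h.exists_eq hp hs hq
  rcases Nat.eq_zero_or_pos t with rfl | h0
  · exact ⟨m - 1, by omega, by rw [show m - 1 + 1 = m by omega, h.ret, he]⟩
  · exact ⟨t - 1, by omega, by rw [show t - 1 + 1 = t by omega, he]⟩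

end IsMarch

/-- The outer normal of the facet at `i` through `A t` and `A (t + 1)`. -/
def ray (p : ℕ → E3) (i : ℕ) (A : ℕ → ℕ) (t : ℕ) : E3 :=
  cross (p (A (t + 1)) - p i) (p (A t) - p i)

lemma neg_ray (p : ℕ → E3) (i : ℕ) (A : ℕ → ℕ) (t : ℕ) :
    - ray p i A t = cross (p (A t) - p i) (p (A (t + 1)) - p i) := (cross_swap _ _).symm

lemma dot_ray (p : ℕ → E3) (i : ℕ) (A : ℕ → ℕ) (t : ℕ) (x : E3) :
    dot (ray p i A t) x = - det (p (A t) - p i) (p (A (t + 1)) - p i) x := by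
  rw [det, ← neg_ray, dot_neg_left, neg_neg]

namespace IsMarch
variable {i m : ℕ} {A : ℕ → ℕ}

lemma mem_argmaxSet_ray (h : IsMarch n p i m A) {t : ℕ} (ht : t ≤ m) :
    i ∈ argmaxSet n p (ray p i A t) := by
  rw [mem_argmaxSet]
  refine ⟨h.lt, fun l hl => ?_⟩
  rw [dot_neg_left, dot_ray, neg_neg]
  exact ((h.next ht).2.2.2 l hl).1

/-- The normal cone of the site `i` is spanned by the facet normals: it is the union of the
simplicial cones that join the first normal to two consecutive other ones. -/
lemma exists_comb (h : IsMarch n p i m A) (hp : Sites n p) (hs : Spatial n p) {v : E3}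
    (hv : i ∈ argmaxSet n p v) : ∃ t, t + 1 < m ∧
      det (ray p i A 0) (ray p i A t) (ray p i A (t + 1)) ≠ 0 ∧
      ∃ a b c : ℝ, 0 ≤ a ∧ 0 ≤ b ∧ 0 ≤ c ∧
        v = a • ray p i A 0 + b • ray p i A t + c • ray p i A (t + 1) := by
  have hm := h.three_le hp hs
  obtain ⟨-, hv⟩ := mem_argmaxSet.1 hv
  have hrr : ∀ t, cross (ray p i A t) (ray p i A (t + 1)) =
      det (p (A t) - p i) (p (A (t + 1)) - p i) (p (A (t + 2)) - p i) • (p (A (t + 1)) - p i) := by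
    intro t
    rw [← cross_cross]
    apply ext3 <;>
      simp only [ray, cross_zero, cross_one, cross_two, PiLp.sub_apply] <;> ring
  have hcons : ∀ t < m, 0 ≤ det (ray p i A t) (ray p i A (t + 1)) (-v) := by
    intro t ht
    rw [det, hrr, dot_smul_left, dot_comm]
    exact mul_nonneg (h.corner_pos hp hs ht).le (hv _ (h.adj hp (by omega)).1)
  have hlast : ray p i A m = ray p i A 0 := by rw [ray, ray, h.ret, h.ret_succ]
  obtain ⟨t, h1, h2, h3, h4⟩ := exists_sign_change
    (fun t => det (ray p i A 0) (ray p i A t) (-v)) (M := m - 3) (hcons 0 h.pos) (by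
      have := hcons (m - 1) (by omega)
      rw [show m - 1 + 1 = m by omega, hlast, det_swap] at this
      rw [show m - 3 + 2 = m - 1 by omega]
      linarith)
  have h5 := hcons t (by omega)
  have hD : det (ray p i A 0) (ray p i A t) (ray p i A (t + 1)) < 0 := by
    rw [det_rotate, det, hrr, dot_smul_left, dot_comm, dot_ray]
    refine mul_neg_of_pos_of_neg (h.corner_pos hp hs (by omega)) (neg_neg_of_pos ?_)
    refine (h.step 0 h.pos).det_pos hp h.lt h.start.1 h.start.2.1 (h.adj hp (by omega)) ?_ ?_
    · exact (h.ne hp (by omega) (by omega)).symm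
    · exact (h.ne hp (by omega) (by omega)).symm
  refine ⟨t, by omega, hD.ne, ?_⟩
  have hc := cramer (ray p i A 0) (ray p i A t) (ray p i A (t + 1)) (-v)
  set D := det (ray p i A 0) (ray p i A t) (ray p i A (t + 1)) with hDdef
  refine ⟨(-D)⁻¹ * det (-v) (ray p i A t) (ray p i A (t + 1)),
    (-D)⁻¹ * det (ray p i A 0) (-v) (ray p i A (t + 1)),
    (-D)⁻¹ * det (ray p i A 0) (ray p i A t) (-v), ?_, ?_, ?_, ?_⟩
  · have : 0 < (-D)⁻¹ := inv_pos.2 (neg_pos.2 hD)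
    rw [det_rotate]; positivity
  · have : 0 < (-D)⁻¹ := inv_pos.2 (neg_pos.2 hD)
    refine mul_nonneg this.le ?_
    rw [det_swap, det_rotate]
    exact neg_nonneg.2 h4
  · have : 0 < (-D)⁻¹ := inv_pos.2 (neg_pos.2 hD)
    exact mul_nonneg this.le h3
  · simp only [mul_smul, ← smul_add]
    rw [← hc, smul_smul, inv_neg, neg_mul, inv_mul_cancel₀ hD.ne, neg_smul, one_smul, neg_neg]

lemma mem_argmaxSet_ray_iff (h : IsMarch n p i m A) {t k : ℕ} (ht : t ≤ m) :
    k ∈ argmaxSet n p (ray p i A t) ↔ k < n ∧ dot (ray p i A t) (p k - p i) = 0 :=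
  mem_argmaxSet_iff (h.mem_argmaxSet_ray ht)

lemma left_mem_argmaxSet_ray (h : IsMarch n p i m A) (hp : Sites n p) {t : ℕ} (ht : t ≤ m) :
    A t ∈ argmaxSet n p (ray p i A t) :=
  (h.mem_argmaxSet_ray_iff ht).2
    ⟨(h.adj hp (by omega)).1, by rw [dot_ray, det_self_outer, neg_zero]⟩

lemma right_mem_argmaxSet_ray (h : IsMarch n p i m A) (hp : Sites n p) {t : ℕ} (ht : t ≤ m) :
    A (t + 1) ∈ argmaxSet n p (ray p i A t) :=
  (h.mem_argmaxSet_ray_iff ht).2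
    ⟨(h.adj hp (by omega)).1, by rw [dot_ray, det_self_right, neg_zero]⟩

lemma ray_apply_add_two (h : IsMarch n p i m A) (hp : Sites n p) (hs : Spatial n p) {t : ℕ}
    (ht : t < m) : A (t + 2) ∉ argmaxSet n p (ray p i A t) := by
  rw [h.mem_argmaxSet_ray_iff ht.le, dot_ray]
  rintro ⟨-, h0⟩
  have := h.corner_pos hp hs ht
  linarith

end IsMarch

/-- The cone of the site `i`, spanned by the normals of the facets at `i`. -/
def cellRecord (p : ℕ → E3) (i m : ℕ) (A : ℕ → ℕ) : FaceRecord :=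
  coneRecord [i] ((List.range m).map (ray p i A))

/-- The cone of the edge from `i` to `A (t + 1)`, spanned by the normals of its two facets. -/
def edgeRecord (p : ℕ → E3) (i : ℕ) (A : ℕ → ℕ) (t : ℕ) : FaceRecord :=
  coneRecord [i, A (t + 1)] [ray p i A t, ray p i A (t + 1)]

open Classical in
/-- The cone of a facet, spanned by its normal; its sites are those in the plane of the facet. -/
noncomputable def facetRecord (n : ℕ) (p : ℕ → E3) (i : ℕ) (A : ℕ → ℕ) (t : ℕ) : FaceRecord :=
  coneRecord ((List.range n).filter fun k => dot (ray p i A t) (p k - p i) = 0) [ray p i A t]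

open Classical in
/-- The faces with least site `i`, from the sequence `A` of the neighbours of `i`. An edge is listed
at its lesser end, and a facet if no site before `i` lies in its plane. -/
noncomputable def marchRecords (n : ℕ) (p : ℕ → E3) (i m : ℕ) (A : ℕ → ℕ) : List FaceRecord :=
  cellRecord p i m A ::
    ((List.range m).flatMap (fun t => if i < A (t + 1) then [edgeRecord p i A t] else []) ++
    (List.range m).flatMap (fun t => if ∀ k < i, dot (ray p i A t) (p k - p i) ≠ 0 then
      [facetRecord n p i A t] else []))

namespace IsMarch
variable {i m : ℕ} {A : ℕ → ℕ}

lemma cellRecord_isFace (h : IsMarch n p i m A) (hp : Sites n p) (hs : Spatial n p) :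
    IsFace n p (cellRecord p i m A) := by
  refine isFace_coneRecord (List.nodup_singleton i) ⟨p i, ?_⟩ ?_ ?_
  · rw [hp.argmaxSet_self h.lt]; ext; simp
  · intro r hr k hk
    obtain ⟨t, ht, rfl⟩ := List.mem_map.1 hr
    rw [List.mem_singleton.1 hk]
    exact h.mem_argmaxSet_ray (List.mem_range.1 ht).le
  · intro v hv
    obtain ⟨t, ht, -, a, b, c, ha, hb, hc, rfl⟩ := h.exists_comb hp hs (hv i (by simp))
    have hmem : ∀ t < m, ray p i A t ∈ (List.range m).map (ray p i A) := fun t ht =>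
      List.mem_map_of_mem (List.mem_range.2 ht)
    exact add_mem (add_mem (ray_mem_cone (hmem _ h.pos) ha)
      (ray_mem_cone (hmem _ (by omega)) hb)) (ray_mem_cone (hmem _ ht) hc)

lemma edgeRecord_isFace (h : IsMarch n p i m A) (hp : Sites n p) (hs : Spatial n p) {t : ℕ}
    (ht : t < m) : IsFace n p (edgeRecord p i A t) := by
  have hadj := h.adj hp (t := t + 1) (by omega)
  refine isFace_coneRecord ?_ ?_ ?_ ?_
  · simpa using hadj.2.1.symm
  · obtain ⟨hj, hji, u, hu, hpos⟩ := hadj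
    refine ⟨-u, ?_⟩
    rw [argmaxSet_of_adj h.lt hj hu hpos]; ext; simp
  · intro r hr k hk
    simp only [List.mem_cons, List.not_mem_nil, or_false] at hr hk
    rcases hr with rfl | rfl <;> rcases hk with rfl | rfl
    · exact h.mem_argmaxSet_ray ht.le
    · exact h.right_mem_argmaxSet_ray hp ht.le
    · exact h.mem_argmaxSet_ray ht
    · exact h.left_mem_argmaxSet_ray hp ht
  · intro v hv
    have hvi := hv i (by simp)
    have hv0 := ((mem_argmaxSet_iff hvi).1 (hv (A (t + 1)) (by simp))).2
    obtain ⟨-, hle⟩ := mem_argmaxSet.1 hvi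
    have hD := h.corner_pos hp hs ht
    have h1 := det_smul_eq (p (A t) - p i) (p (A (t + 1)) - p i) (p (A (t + 2)) - p i) (-v)
    rw [dot_neg_left v (p (A (t + 1)) - p i), hv0, neg_zero, zero_smul, add_zero] at h1
    have e1 := hle _ (h.adj hp (t := t) (by omega)).1
    have e2 := hle _ (h.adj hp (t := t + 2) (by omega)).1
    rw [← neg_ray p i A t, ← neg_ray p i A (t + 1)] at h1
    set D := det (p (A t) - p i) (p (A (t + 1)) - p i) (p (A (t + 2)) - p i)
    have h2 : v = (D⁻¹ * dot (-v) (p (A (t + 2)) - p i)) • ray p i A t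
        + (D⁻¹ * dot (-v) (p (A t) - p i)) • ray p i A (t + 1) := by
      have h3 := congrArg (fun z => (-D⁻¹) • z) h1
      simp only [smul_smul, neg_mul, inv_mul_cancel₀ hD.ne', smul_add, smul_neg, neg_smul, one_smul,
        neg_neg] at h3
      exact h3
    rw [h2]
    have hD' := inv_pos.2 hD
    exact add_mem (ray_mem_cone (by simp) (mul_nonneg hD'.le e2))
      (ray_mem_cone (by simp) (mul_nonneg hD'.le e1))

lemma facetRecord_sites (h : IsMarch n p i m A) {t : ℕ} (ht : t ≤ m) :
    {k | k ∈ (facetRecord n p i A t).sites} = argmaxSet n p (ray p i A t) := by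
  ext k
  rw [h.mem_argmaxSet_ray_iff ht]
  simp [facetRecord, coneRecord]

lemma facetRecord_isFace (h : IsMarch n p i m A) (hp : Sites n p) (hs : Spatial n p) {t : ℕ}
    (ht : t < m) : IsFace n p (facetRecord n p i A t) := by
  have hsites : ∀ k, k ∈ (facetRecord n p i A t).sites ↔ k ∈ argmaxSet n p (ray p i A t) :=
    fun k => by rw [← h.facetRecord_sites ht.le]; rfl
  refine isFace_coneRecord (List.nodup_range.filter _) ⟨_, h.facetRecord_sites ht.le⟩ ?_ ?_
  · intro r hr k hk
    rw [List.mem_singleton.1 hr]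
    exact (hsites k).1 hk
  · intro v hv
    have hv' : ∀ k ∈ argmaxSet n p (ray p i A t), k ∈ argmaxSet n p v :=
      fun k hk => hv k ((hsites k).2 hk)
    have hvi := hv' i (h.mem_argmaxSet_ray ht.le)
    have h0 := ((mem_argmaxSet_iff hvi).1 (hv' _ (h.left_mem_argmaxSet_ray hp ht.le))).2
    have h1 := ((mem_argmaxSet_iff hvi).1 (hv' _ (h.right_mem_argmaxSet_ray hp ht.le))).2
    obtain ⟨-, hle⟩ := mem_argmaxSet.1 hvi
    have hD := h.corner_pos hp hs ht
    have h2 := det_smul_eq (p (A t) - p i) (p (A (t + 1)) - p i) (p (A (t + 2)) - p i) (-v)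
    rw [dot_neg_left v (p (A (t + 1)) - p i), dot_neg_left v (p (A t) - p i), h0, h1, neg_zero,
      zero_smul, add_zero, zero_smul, add_zero, ← neg_ray p i A t] at h2
    have e2 := hle _ (h.adj hp (t := t + 2) (by omega)).1
    set D := det (p (A t) - p i) (p (A (t + 1)) - p i) (p (A (t + 2)) - p i)
    have h3 : v = (D⁻¹ * dot (-v) (p (A (t + 2)) - p i)) • ray p i A t := by
      have h3 := congrArg (fun z => (-D⁻¹) • z) h2
      simp only [smul_smul, neg_mul, inv_mul_cancel₀ hD.ne', smul_neg, neg_smul, one_smul,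
        neg_neg] at h3
      exact h3
    rw [h3]
    exact ray_mem_cone (by simp) (mul_nonneg (inv_pos.2 hD).le e2)

/-- A vector at which `i` and two more sites are maximal is a multiple of a facet normal. -/
lemma argmaxSet_eq_of_two (h : IsMarch n p i m A) (hp : Sites n p) (hs : Spatial n p) {v : E3}
    {j k : ℕ} (hv : i ∈ argmaxSet n p v) (hj : j ∈ argmaxSet n p v) (hk : k ∈ argmaxSet n p v)
    (hji : j ≠ i) (hki : k ≠ i) (hjk : j ≠ k) (hv0 : v ≠ 0) :
    ∃ t < m, argmaxSet n p v = argmaxSet n p (ray p i A t) := by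
  obtain ⟨t, ht, hD, a, b, c, ha, hb, hc, hvc⟩ := h.exists_comb hp hs hv
  have hcr := hp.cross_ne_zero h.lt hj.1 hk.1 hji hki hjk
  have hle : ∀ t < m, ∀ l < n, dot (ray p i A t) (p l - p i) ≤ 0 := fun t ht l hl => by
    have := (mem_argmaxSet.1 (h.mem_argmaxSet_ray ht.le)).2 l hl
    rw [dot_neg_left] at this; linarith
  have hterm : ∀ l ∈ argmaxSet n p v, a * dot (ray p i A 0) (p l - p i) = 0 ∧
      b * dot (ray p i A t) (p l - p i) = 0 ∧ c * dot (ray p i A (t + 1)) (p l - p i) = 0 := by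
    intro l hl
    have h0 := ((mem_argmaxSet_iff hv).1 hl).2
    rw [hvc, dot_add_left, dot_add_left, dot_smul_left, dot_smul_left, dot_smul_left] at h0
    have h1 := mul_nonpos_of_nonneg_of_nonpos ha (hle 0 h.pos l hl.1)
    have h2 := mul_nonpos_of_nonneg_of_nonpos hb (hle t (by omega) l hl.1)
    have h3 := mul_nonpos_of_nonneg_of_nonpos hc (hle (t + 1) ht l hl.1)
    exact ⟨by linarith, by linarith, by linarith⟩
  have hpar : ∀ x y : E3, dot x (p j - p i) = 0 → dot x (p k - p i) = 0 → dot y (p j - p i) = 0 →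
      dot y (p k - p i) = 0 → cross x y = 0 := fun x y h1 h2 h3 h4 =>
    cross_eq_zero_of_orthogonal hcr h1 h2 h3 h4
  obtain ⟨j1, j2, j3⟩ := hterm j hj
  obtain ⟨k1, k2, k3⟩ := hterm k hk
  have hone : ∀ s < m, ∀ x : ℝ, 0 < x → v = x • ray p i A s →
      argmaxSet n p v = argmaxSet n p (ray p i A s) := by
    intro s hs x hx hvx
    ext l
    rw [mem_argmaxSet_iff hv, h.mem_argmaxSet_ray_iff hs.le, hvx, dot_smul_left]
    simp [hx.ne']
  have hpos : ∀ {x : ℝ}, 0 ≤ x → x ≠ 0 → 0 < x := fun h1 h2 => lt_of_le_of_ne h1 h2.symm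
  by_cases ha0 : a = 0
  · by_cases hb0 : b = 0
    · by_cases hc0 : c = 0
      · exact absurd (by rw [hvc, ha0, hb0, hc0]; simp) hv0
      · exact ⟨t + 1, ht, hone _ ht c (hpos hc hc0) (by rw [hvc, ha0, hb0]; simp)⟩
    · by_cases hc0 : c = 0
      · exact ⟨t, by omega, hone _ (by omega) b (hpos hb hb0) (by rw [hvc, ha0, hc0]; simp)⟩
      · exfalso
        apply hD
        rw [det_rotate, det, hpar _ _ ((mul_eq_zero.1 j2).resolve_left hb0)
          ((mul_eq_zero.1 k2).resolve_left hb0) ((mul_eq_zero.1 j3).resolve_left hc0)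
          ((mul_eq_zero.1 k3).resolve_left hc0), dot_zero_left]
  · by_cases hb0 : b = 0
    · by_cases hc0 : c = 0
      · exact ⟨0, h.pos, hone _ h.pos a (hpos ha ha0) (by rw [hvc, hb0, hc0]; simp)⟩
      · exfalso
        apply hD
        rw [det_rotate, det_rotate, det, hpar _ _ ((mul_eq_zero.1 j3).resolve_left hc0)
          ((mul_eq_zero.1 k3).resolve_left hc0) ((mul_eq_zero.1 j1).resolve_left ha0)
          ((mul_eq_zero.1 k1).resolve_left ha0), dot_zero_left]
    · exfalso
      apply hD
      rw [det, hpar _ _ ((mul_eq_zero.1 j1).resolve_left ha0)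
          ((mul_eq_zero.1 k1).resolve_left ha0) ((mul_eq_zero.1 j2).resolve_left hb0)
          ((mul_eq_zero.1 k2).resolve_left hb0), dot_zero_left]

/-- The facets between different pairs of consecutive neighbours are different. -/
lemma facet_inj (h : IsMarch n p i m A) (hp : Sites n p) (hs : Spatial n p) {s t : ℕ} (hsm : s < m)
    (htm : t < m) (he : argmaxSet n p (ray p i A s) = argmaxSet n p (ray p i A t)) : s = t := by
  have key : ∀ q, Adj n p i q → q ∈ argmaxSet n p (ray p i A t) → q = A t ∨ q = A (t + 1) := by
    intro q hq hqm
    by_contra hcon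
    push Not at hcon
    have h1 := h.adj hp (t := t) (by omega)
    have h2 := (h.step t htm).det_pos hp h.lt h1.1 h1.2.1 hq hcon.1 hcon.2
    have h3 := ((h.mem_argmaxSet_ray_iff htm.le).1 hqm).2
    rw [dot_ray] at h3
    linarith
  have a1 := h.adj hp (t := s) (by omega)
  have a2 := h.adj hp (t := s + 1) (by omega)
  have b := h.step s hsm
  have c := h.step t htm
  rcases key _ a1 (he ▸ h.left_mem_argmaxSet_ray hp hsm.le) with h1 | h1
  · exact h.inj hp hsm htm h1
  rcases key _ a2 (he ▸ h.right_mem_argmaxSet_ray hp hsm.le) with h2 | h2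
  · rw [h1, h2] at b
    have h1 := h.adj hp (t := t) (by omega)
    exact (Next.not_symm hp hs h.lt h1.1 h1.2.1 c b).elim
  · exact absurd (h2.trans h1.symm) b.2.2.1

lemma three_le_card (h : IsMarch n p i m A) (hp : Sites n p) {t : ℕ} (ht : t < m) :
    3 ≤ (facetRecord n p i A t).sites.toFinset.card := by
  have hsites : ∀ k, k ∈ argmaxSet n p (ray p i A t) → k ∈ (facetRecord n p i A t).sites :=
    fun k hk => by rw [← h.facetRecord_sites ht.le] at hk; exact hk
  have h1 := h.adj hp (t := t) (by omega)
  have h2 := h.adj hp (t := t + 1) (by omega)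
  have : ({i, A t, A (t + 1)} : Finset ℕ).card = 3 :=
    Finset.card_eq_three.2 ⟨_, _, _, h1.2.1.symm, h2.2.1.symm, (h.step t ht).2.2.1.symm, rfl⟩
  rw [← this]
  refine Finset.card_le_card fun k hk => ?_
  rw [List.mem_toFinset]
  apply hsites
  simp only [Finset.mem_insert, Finset.mem_singleton] at hk
  rcases hk with rfl | rfl | rfl
  · exact h.mem_argmaxSet_ray ht.le
  · exact h.left_mem_argmaxSet_ray hp ht.le
  · exact h.right_mem_argmaxSet_ray hp ht.le

lemma card_edge (h : IsMarch n p i m A) (hp : Sites n p) {t : ℕ} (ht : t < m) :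
    (edgeRecord p i A t).sites.toFinset.card = 2 := by
  have h2 := h.adj hp (t := t + 1) (by omega)
  simp [edgeRecord, coneRecord, Finset.card_pair h2.2.1.symm]

/-- The normal cones of `i`, of the edges at `i` and of the facets at `i` are all faces of the fan
with site `i`, other than that of all sites: two further maximal sites determine a facet, and a
single one spans an edge. -/
lemma isLocal (h : IsMarch n p i m A) (hp : Sites n p) (hs : Spatial n p) :
    IsLocal n p i (marchRecords n p i m A) := by
  classical
  have hcase : ∀ f ∈ marchRecords n p i m A, f = cellRecord p i m A ∨
      (∃ t < m, i < A (t + 1) ∧ f = edgeRecord p i A t) ∨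
      (∃ t < m, (∀ k < i, dot (ray p i A t) (p k - p i) ≠ 0) ∧ f = facetRecord n p i A t) := by
    intro f hf
    simp only [marchRecords, List.mem_cons, List.mem_append, List.mem_flatMap, List.mem_range] at hf
    rcases hf with hf | ⟨t, ht, hf⟩ | ⟨t, ht, hf⟩
    · exact Or.inl hf
    · split_ifs at hf with hc
      · exact Or.inr (Or.inl ⟨t, ht, hc, List.mem_singleton.1 hf⟩)
      · simp at hf
    · split_ifs at hf with hc
      · exact Or.inr (Or.inr ⟨t, ht, hc, List.mem_singleton.1 hf⟩)
      · simp at hf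
  have hsites : ∀ t < m, ∀ k,
      k ∈ (facetRecord n p i A t).sites ↔ k ∈ argmaxSet n p (ray p i A t) :=
    fun t ht k => by rw [← h.facetRecord_sites ht.le]; rfl
  have hcell : cellRecord p i m A ∈ marchRecords n p i m A := List.mem_cons_self
  have hedge : ∀ t < m, i < A (t + 1) → edgeRecord p i A t ∈ marchRecords n p i m A := by
    intro t ht hc
    refine List.mem_cons_of_mem _ (List.mem_append_left _ (List.mem_flatMap.2
      ⟨t, List.mem_range.2 ht, ?_⟩))
    rw [if_pos hc]; simp
  have hfacet : ∀ t < m, (∀ k < i, dot (ray p i A t) (p k - p i) ≠ 0) →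
      facetRecord n p i A t ∈ marchRecords n p i m A := by
    intro t ht hc
    refine List.mem_cons_of_mem _ (List.mem_append_right _ (List.mem_flatMap.2
      ⟨t, List.mem_range.2 ht, ?_⟩))
    rw [if_pos hc]; simp
  refine ⟨?_, ?_, ?_, ?_, ?_, ?_⟩
  · intro f hf
    rcases hcase f hf with rfl | ⟨t, ht, -, rfl⟩ | ⟨t, ht, -, rfl⟩
    · exact h.cellRecord_isFace hp hs
    · exact h.edgeRecord_isFace hp hs ht
    · exact h.facetRecord_isFace hp hs ht
  · intro f hf
    rcases hcase f hf with rfl | ⟨t, ht, -, rfl⟩ | ⟨t, ht, -, rfl⟩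
    · simp [cellRecord, coneRecord]
    · simp [edgeRecord, coneRecord]
    · exact (hsites t ht i).2 (h.mem_argmaxSet_ray ht.le)
  · intro f hf k hk
    rcases hcase f hf with rfl | ⟨t, ht, hc, rfl⟩ | ⟨t, ht, hc, rfl⟩
    · simp [cellRecord, coneRecord] at hk; omega
    · simp [edgeRecord, coneRecord] at hk; omega
    · by_contra hcon
      exact hc k (not_le.1 hcon)
        ((h.mem_argmaxSet_ray_iff ht.le).1 ((hsites t ht k).1 hk)).2
  · intro f hf
    have ha0 := h.adj hp (t := 0) (by omega)
    rcases hcase f hf with rfl | ⟨t, ht, -, rfl⟩ | ⟨t, ht, -, rfl⟩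
    · exact ⟨A 0, ha0.1, by simpa [cellRecord, coneRecord] using ha0.2.1⟩
    · have h1 := h.adj hp (t := t) (by omega)
      refine ⟨A t, h1.1, ?_⟩
      have := (h.step t ht).2.2.1
      simp only [edgeRecord, coneRecord, List.mem_cons, List.not_mem_nil, or_false, not_or]
      exact ⟨h1.2.1, this.symm⟩
    · exact ⟨A (t + 2), (h.adj hp (by omega)).1, fun hk =>
        h.ray_apply_add_two hp hs ht ((hsites t ht _).1 hk)⟩
  · simp only [marchRecords, List.map_cons, List.map_append, List.map_flatMap]
    rw [List.nodup_cons, List.nodup_append']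
    have e1 : ∀ t < m, ∀ x ∈ List.map (fun f : FaceRecord => f.sites.toFinset)
        (if i < A (t + 1) then [edgeRecord p i A t] else []),
        x = (edgeRecord p i A t).sites.toFinset := by
      intro t ht x hx
      split_ifs at hx
      · exact List.mem_singleton.1 hx
      · simp at hx
    have e2 : ∀ t < m, ∀ x ∈ List.map (fun f : FaceRecord => f.sites.toFinset)
        (if ∀ k < i, dot (ray p i A t) (p k - p i) ≠ 0 then [facetRecord n p i A t] else []),
        x = (facetRecord n p i A t).sites.toFinset := by
      intro t ht x hx
      split_ifs at hx
      · exact List.mem_singleton.1 hx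
      · simp at hx
    refine ⟨?_, ?_, ?_, ?_⟩
    · intro hmem
      have hc : (cellRecord p i m A).sites.toFinset.card = 1 := by simp [cellRecord, coneRecord]
      rcases List.mem_append.1 hmem with hmem | hmem
      · obtain ⟨t, ht, hx⟩ := List.mem_flatMap.1 hmem
        have h2 := h.card_edge hp (List.mem_range.1 ht)
        rw [← e1 t (List.mem_range.1 ht) _ hx] at h2
        omega
      · obtain ⟨t, ht, hx⟩ := List.mem_flatMap.1 hmem
        have h2 := h.three_le_card hp (List.mem_range.1 ht)
        rw [← e2 t (List.mem_range.1 ht) _ hx] at h2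
        omega
    · rw [List.nodup_flatMap]
      refine ⟨fun t _ => by split_ifs <;> simp, ?_⟩
      refine List.Pairwise.imp_of_mem ?_ (List.nodup_range (n := m))
      intro s t hsm htm hst x hx hy
      have h1 := List.mem_range.1 hsm
      have h2 := List.mem_range.1 htm
      have h3 := (e1 s h1 x hx).symm.trans (e1 t h2 x hy)
      have h4 : A (s + 1) ∈ (edgeRecord p i A t).sites.toFinset := by
        rw [← h3]; simp [edgeRecord, coneRecord]
      simp only [edgeRecord, coneRecord, List.mem_toFinset, List.mem_cons, List.not_mem_nil,
        or_false] at h4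
      rcases h4 with h4 | h4
      · exact (h.adj hp (t := s + 1) (by omega)).2.1 h4
      · exact hst (h.inj_succ hp h1 h2 h4)
    · rw [List.nodup_flatMap]
      refine ⟨fun t _ => by split_ifs <;> simp, ?_⟩
      refine List.Pairwise.imp_of_mem ?_ (List.nodup_range (n := m))
      intro s t hsm htm hst x hx hy
      have h1 := List.mem_range.1 hsm
      have h2 := List.mem_range.1 htm
      have h3 := (e2 s h1 x hx).symm.trans (e2 t h2 x hy)
      refine hst (h.facet_inj hp hs h1 h2 ?_)
      ext k
      rw [← hsites s h1, ← hsites t h2, ← List.mem_toFinset, h3, List.mem_toFinset]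
    · intro x hx hy
      obtain ⟨s, hsm, hx⟩ := List.mem_flatMap.1 hx
      obtain ⟨t, htm, hy⟩ := List.mem_flatMap.1 hy
      have h1 := h.card_edge hp (List.mem_range.1 hsm)
      have h2 := h.three_le_card hp (List.mem_range.1 htm)
      rw [← e1 s (List.mem_range.1 hsm) _ hx] at h1
      rw [← e2 t (List.mem_range.1 htm) _ hy] at h2
      omega
  · rintro v hv hmin ⟨q, hq, hqv⟩
    have hv0 : v ≠ 0 := by
      rintro rfl
      exact hqv ⟨hq, by simp⟩
    by_cases c1 : ∃ j ∈ argmaxSet n p v, j ≠ i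
    · obtain ⟨j, hj, hji⟩ := c1
      by_cases c2 : ∃ k ∈ argmaxSet n p v, k ≠ i ∧ k ≠ j
      · obtain ⟨k, hk, hki, hkj⟩ := c2
        obtain ⟨t, ht, he⟩ := h.argmaxSet_eq_of_two hp hs hv hj hk hji hki hkj.symm hv0
        refine ⟨facetRecord n p i A t, hfacet t ht fun k hk h0 => ?_, ?_⟩
        · have : k ∈ argmaxSet n p v := by
            rw [he, h.mem_argmaxSet_ray_iff ht.le]
            exact ⟨hk.trans h.lt, h0⟩
          have := hmin k this
          omega
        · rw [h.facetRecord_sites ht.le, he]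
      · push Not at c2
        have hadj : Adj n p i j := by
          refine ⟨hj.1, hji, -v, ?_, fun k hk hki hkj => ?_⟩
          · rw [dot_neg_left, ((mem_argmaxSet_iff hv).1 hj).2, neg_zero]
          · refine lt_of_le_of_ne ((mem_argmaxSet.1 hv).2 k hk) fun h0 => ?_
            refine hkj (c2 k ((mem_argmaxSet_iff hv).2 ⟨hk, ?_⟩) hki)
            rw [dot_neg_left] at h0; linarith
        obtain ⟨t, ht, he⟩ := h.exists_eq_succ hp hs hadj
        refine ⟨edgeRecord p i A t, hedge t ht ?_, ?_⟩
        · have := hmin j hj; omega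
        · ext k
          simp only [edgeRecord, coneRecord, List.mem_cons, List.not_mem_nil, or_false,
            Set.mem_ofPred_eq, he]
          constructor
          · rintro (rfl | rfl)
            · exact hv
            · exact hj
          · intro hk
            by_contra hcon
            push Not at hcon
            exact hcon.2 (c2 k hk hcon.1)
    · push Not at c1
      refine ⟨cellRecord p i m A, hcell, ?_⟩
      ext k
      simp only [cellRecord, coneRecord, List.mem_singleton, Set.mem_ofPred_eq]
      exact ⟨fun hk => hk ▸ hv, c1 k⟩

end IsMarch

/-- The face of all sites consists of the vectors orthogonal to their affine hull. -/
lemma allRecord_isFace {rays : List E3}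
    (hrays : ∀ r ∈ rays, ∀ k < n, k ∈ argmaxSet n p r)
    (hshape : ∀ v, (∀ k < n, k ∈ argmaxSet n p v) → v ∈ Submodule.span NNReal {x | x ∈ rays}) :
    IsFace n p (coneRecord (List.range n) rays) := by
  refine isFace_coneRecord List.nodup_range ⟨0, ?_⟩ ?_ ?_
  · ext k
    simp [argmaxSet]
  · intro r hr k hk
    exact hrays r hr k (List.mem_range.1 hk)
  · intro v hv
    exact hshape v fun k hk => hv k (List.mem_range.2 hk)

lemma allRecord_isFace_of_spatial (hn : 1 ≤ n) (hs : Spatial n p) :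
    IsFace n p (coneRecord (List.range n) []) := by
  refine allRecord_isFace (by simp) fun v hv => ?_
  have : v = 0 := hs 0 hn v fun k hk => ((mem_argmaxSet_iff (hv 0 hn)).1 (hv k hk)).2
  rw [this]
  exact zero_mem _
end BlochFan

/-! ### Sites in a plane -/
namespace BlochFan
variable {n : ℕ} {p : ℕ → E3}

lemma line_mem_cone {l : List E3} {x : E3} (h1 : x ∈ l) (h2 : -x ∈ l) (c : ℝ) :
    c • x ∈ Submodule.span NNReal {x | x ∈ l} := by
  rcases le_total 0 c with hc | hc
  · exact ray_mem_cone h1 hc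
  · have := ray_mem_cone h2 (neg_nonneg.2 hc)
    rwa [neg_smul_neg] at this

/-- All sites lie in a plane with normal `w`. -/
def Planar (n : ℕ) (p : ℕ → E3) (w : E3) : Prop :=
  w ≠ 0 ∧ ∀ i < n, ∀ k < n, dot w (p k - p i) = 0

/-- In the polygon of the sites of a plane with normal `w`, the neighbours of the vertex `i` are
`j` and `l`: all sites lie in the angle from `j` to `l`. -/
structure IsTurn (n : ℕ) (p : ℕ → E3) (w : E3) (i j l : ℕ) : Prop where
  lt : i < n
  left_lt : j < n
  right_lt : l < n
  left_ne : j ≠ i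
  right_ne : l ≠ i
  left : ∀ k < n, 0 ≤ det w (p j - p i) (p k - p i)
  right : ∀ k < n, 0 ≤ det w (p k - p i) (p l - p i)

/-- Vector products of differences of sites are multiples of the normal of their plane. -/
lemma Planar.cross_eq {w : E3} (h : Planar n p w) {i j k : ℕ} (hi : i < n) (hj : j < n)
    (hk : k < n) :
    dot w w • cross (p j - p i) (p k - p i) = det w (p j - p i) (p k - p i) • w := by
  have h1 := h.2 i hi j hj
  have h2 := h.2 i hi k hk
  generalize p j - p i = a at *
  generalize p k - p i = b at *
  have : dot w w • cross a b = det w a b • w + dot w a • cross w b - dot w b • cross w a := by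
    apply ext3 <;> (simp only [det, dot, cross_zero, cross_one, cross_two, PiLp.add_apply,
      PiLp.sub_apply, PiLp.smul_apply, smul_eq_mul]; ring)
  rw [this, h1, h2]; simp

lemma Planar.det_ne_zero {w : E3} (h : Planar n p w) (hp : Sites n p) {i j k : ℕ} (hi : i < n)
    (hj : j < n) (hk : k < n) (hji : j ≠ i) (hki : k ≠ i) (hjk : j ≠ k) :
    det w (p j - p i) (p k - p i) ≠ 0 := by
  intro h0
  have := h.cross_eq hi hj hk
  rw [h0, zero_smul] at this
  exact hp.cross_ne_zero hi hj hk hji hki hjk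
    ((smul_eq_zero.1 this).resolve_left (dot_self_pos h.1).ne')

/-- The cone of the vertex `i`. -/
def turnCell (p : ℕ → E3) (w : E3) (i j l : ℕ) : FaceRecord :=
  coneRecord [i] [w, -w, cross (p j - p i) w, cross w (p l - p i)]

/-- The cone of the edge to the following vertex. -/
def turnLeft (p : ℕ → E3) (w : E3) (i j : ℕ) : FaceRecord :=
  coneRecord [i, j] [w, -w, cross (p j - p i) w]

/-- The cone of the edge to the preceding vertex. -/
def turnRight (p : ℕ → E3) (w : E3) (i l : ℕ) : FaceRecord :=
  coneRecord [i, l] [w, -w, cross w (p l - p i)]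

/-- The faces with least site `i`, for sites in a plane. -/
def turnRecords (p : ℕ → E3) (w : E3) (i j l : ℕ) : List FaceRecord :=
  turnCell p w i j l :: ((if i < j then [turnLeft p w i j] else []) ++
    (if i < l then [turnRight p w i l] else []))

namespace IsTurn
variable {w : E3} {i j l : ℕ}

lemma ne (h : IsTurn n p w i j l) (hw : Planar n p w) (hp : Sites n p) (hn : 3 ≤ n) : j ≠ l := by
  rintro rfl
  obtain ⟨k, hk⟩ : ∃ k, k ∈ Finset.range n \ {i, j} := by
    apply Finset.Nonempty.exists_mem
    rw [← Finset.card_pos]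
    have h1 := Finset.le_card_sdiff {i, j} (Finset.range n)
    have h2 : ({i, j} : Finset ℕ).card ≤ 2 := Finset.card_le_two
    rw [Finset.card_range] at h1
    omega
  simp only [Finset.mem_sdiff, Finset.mem_range, Finset.mem_insert, Finset.mem_singleton,
    not_or] at hk
  have h1 := h.left k hk.1
  have h2 := h.right k hk.1
  have h3 := hw.det_ne_zero hp h.lt h.left_lt hk.1 h.left_ne hk.2.1 (Ne.symm hk.2.2)
  have h4 : det w (p j - p i) (p k - p i) = - det w (p k - p i) (p j - p i) := by
    simp only [det, dot, cross_zero, cross_one, cross_two]; ring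
  exact h3 (by linarith)

lemma dot_left (x : E3) : dot (cross (p j - p i) w) x = - det w (p j - p i) x := by
  rw [cross_swap, dot_neg_left, det]

lemma dot_right (x : E3) : dot (cross w (p l - p i)) x = - det w x (p l - p i) := by
  simp only [det, dot, cross_zero, cross_one, cross_two]; ring

lemma argmaxSet_left (h : IsTurn n p w i j l) (hw : Planar n p w) (hp : Sites n p) :
    argmaxSet n p (cross (p j - p i) w) = {i, j} := by
  have := argmaxSet_of_adj (p := p) h.lt h.left_lt (u := -cross (p j - p i) w)
    (by rw [dot_neg_left, dot_left]; simp) (fun k hk hki hkj => by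
      rw [dot_neg_left, dot_left, neg_neg]
      exact lt_of_le_of_ne (h.left k hk)
        (hw.det_ne_zero hp h.lt h.left_lt hk h.left_ne hki hkj.symm).symm)
  rwa [neg_neg] at this

lemma argmaxSet_right (h : IsTurn n p w i j l) (hw : Planar n p w) (hp : Sites n p) :
    argmaxSet n p (cross w (p l - p i)) = {i, l} := by
  have := argmaxSet_of_adj (p := p) h.lt h.right_lt (u := -cross w (p l - p i))
    (by rw [dot_neg_left, dot_right]; simp) (fun k hk hki hkl => by
      rw [dot_neg_left, dot_right, neg_neg]
      exact lt_of_le_of_ne (h.right k hk)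
        (hw.det_ne_zero hp h.lt hk h.right_lt hki h.right_ne hkl).symm)
  rwa [neg_neg] at this

/-- The normal cone of a vertex of the polygon: it contains the line of the normal `w`, and modulo
this line it is spanned by the normals of the two edges at the vertex. -/
lemma exists_comb (h : IsTurn n p w i j l) (hw : Planar n p w) (hp : Sites n p) (hn : 3 ≤ n)
    {v : E3} (hv : i ∈ argmaxSet n p v) : ∃ a b c : ℝ, 0 ≤ a ∧ 0 ≤ b ∧
      (a = 0 ↔ l ∈ argmaxSet n p v) ∧ (b = 0 ↔ j ∈ argmaxSet n p v) ∧
      v = c • w + a • cross (p j - p i) w + b • cross w (p l - p i) := by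
  have hD : 0 < det w (p j - p i) (p l - p i) := lt_of_le_of_ne (h.left l h.right_lt)
    (hw.det_ne_zero hp h.lt h.left_lt h.right_lt h.left_ne h.right_ne (h.ne hw hp hn)).symm
  have h1 := det_smul_eq w (p j - p i) (p l - p i) v
  have h2 := hw.cross_eq h.lt h.left_lt h.right_lt
  have hww := dot_self_pos hw.1
  have hle := (mem_argmaxSet.1 hv).2
  have hj := hle j h.left_lt
  have hl := hle l h.right_lt
  rw [dot_neg_left] at hj hl
  set D := det w (p j - p i) (p l - p i) with hDdef
  have h3 : cross (p j - p i) (p l - p i) = ((dot w w)⁻¹ * D) • w := by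
    have := congrArg (fun z => (dot w w)⁻¹ • z) h2
    simpa only [smul_smul, inv_mul_cancel₀ hww.ne', one_smul] using this
  refine ⟨D⁻¹ * - dot v (p l - p i), D⁻¹ * - dot v (p j - p i), D⁻¹ * (dot v w * ((dot w w)⁻¹ * D)),
    mul_nonneg (inv_pos.2 hD).le hl, mul_nonneg (inv_pos.2 hD).le hj, ?_, ?_, ?_⟩
  · rw [mem_argmaxSet_iff hv]; simp [hD.ne', h.right_lt, -dot_sub_right]
  · rw [mem_argmaxSet_iff hv]; simp [hD.ne', h.left_lt, -dot_sub_right]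
  · have h4 := congrArg (fun z => D⁻¹ • z) h1
    simp only [smul_smul, inv_mul_cancel₀ hD.ne', one_smul] at h4
    rw [h3, cross_swap (p j - p i) w, cross_swap w (p l - p i)] at h4
    refine h4.trans ?_
    module

/-- For at least three sites in a plane, the faces at a vertex are those of the
polygon: its cone and those of its two edges, all containing the line of the normal `w`. -/
lemma isLocal (h : IsTurn n p w i j l) (hw : Planar n p w) (hp : Sites n p) (hn : 3 ≤ n) :
    IsLocal n p i (turnRecords p w i j l) := by
  have hjl := h.ne hw hp hn
  have hcase : ∀ f ∈ turnRecords p w i j l, f = turnCell p w i j l ∨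
      (i < j ∧ f = turnLeft p w i j) ∨ (i < l ∧ f = turnRight p w i l) := by
    intro f hf
    simp only [turnRecords, List.mem_cons, List.mem_append] at hf
    rcases hf with hf | hf | hf
    · exact Or.inl hf
    · split_ifs at hf with hc
      · exact Or.inr (Or.inl ⟨hc, List.mem_singleton.1 hf⟩)
      · simp at hf
    · split_ifs at hf with hc
      · exact Or.inr (Or.inr ⟨hc, List.mem_singleton.1 hf⟩)
      · simp at hf
  have hwmem : ∀ k < n, k ∈ argmaxSet n p w := fun k hk =>
    mem_argmaxSet.2 ⟨hk, fun l hl => by rw [dot_neg_left, hw.2 k hk l hl, neg_zero]⟩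
  have hwmem' : ∀ k < n, k ∈ argmaxSet n p (-w) := fun k hk =>
    mem_argmaxSet.2 ⟨hk, fun l hl => by rw [neg_neg, hw.2 k hk l hl]⟩
  have hl := h.argmaxSet_left hw hp
  have hr := h.argmaxSet_right hw hp
  refine ⟨?_, ?_, ?_, ?_, ?_, ?_⟩
  · intro f hf
    rcases hcase f hf with rfl | ⟨-, rfl⟩ | ⟨-, rfl⟩
    · refine isFace_coneRecord (List.nodup_singleton i) ⟨p i, ?_⟩ ?_ ?_
      · rw [hp.argmaxSet_self h.lt]; ext; simp
      · intro r hr' k hk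
        rw [List.mem_singleton.1 hk]
        simp only [List.mem_cons, List.not_mem_nil, or_false] at hr'
        rcases hr' with rfl | rfl | rfl | rfl
        · exact hwmem i h.lt
        · exact hwmem' i h.lt
        · rw [hl]; simp
        · rw [hr]; simp
      · intro v hv
        obtain ⟨a, b, c, ha, hb, -, -, rfl⟩ := h.exists_comb hw hp hn (hv i (by simp))
        exact add_mem (add_mem (line_mem_cone (by simp) (by simp) c)
          (ray_mem_cone (by simp) ha)) (ray_mem_cone (by simp) hb)
    · refine isFace_coneRecord (by simpa using h.left_ne.symm)
        ⟨_, by rw [hl]; ext; simp⟩ ?_ ?_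
      · intro r hr' k hk
        have hk' : k = i ∨ k = j := by simpa using hk
        have hkn : k < n := by rcases hk' with rfl | rfl; exacts [h.lt, h.left_lt]
        simp only [List.mem_cons, List.not_mem_nil, or_false] at hr'
        rcases hr' with rfl | rfl | rfl
        · exact hwmem k hkn
        · exact hwmem' k hkn
        · rw [hl]; exact hk'
      · intro v hv
        obtain ⟨a, b, c, ha, hb, -, hb0, hvc⟩ := h.exists_comb hw hp hn (hv i (by simp))
        rw [hvc, hb0.2 (hv j (by simp)), zero_smul, add_zero]
        exact add_mem (line_mem_cone (by simp) (by simp) c) (ray_mem_cone (by simp) ha)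
    · refine isFace_coneRecord (by simpa using h.right_ne.symm)
        ⟨_, by rw [hr]; ext; simp⟩ ?_ ?_
      · intro r hr' k hk
        have hk' : k = i ∨ k = l := by simpa using hk
        have hkn : k < n := by rcases hk' with rfl | rfl; exacts [h.lt, h.right_lt]
        simp only [List.mem_cons, List.not_mem_nil, or_false] at hr'
        rcases hr' with rfl | rfl | rfl
        · exact hwmem k hkn
        · exact hwmem' k hkn
        · rw [hr]; exact hk'
      · intro v hv
        obtain ⟨a, b, c, ha, hb, ha0, -, hvc⟩ := h.exists_comb hw hp hn (hv i (by simp))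
        rw [hvc, ha0.2 (hv l (by simp)), zero_smul, add_zero]
        exact add_mem (line_mem_cone (by simp) (by simp) c) (ray_mem_cone (by simp) hb)
  · intro f hf
    rcases hcase f hf with rfl | ⟨-, rfl⟩ | ⟨-, rfl⟩ <;>
      simp [turnCell, turnLeft, turnRight, coneRecord]
  · intro f hf k hk
    rcases hcase f hf with rfl | ⟨hc, rfl⟩ | ⟨hc, rfl⟩ <;>
      simp [turnCell, turnLeft, turnRight, coneRecord] at hk <;> omega
  · intro f hf
    rcases hcase f hf with rfl | ⟨-, rfl⟩ | ⟨-, rfl⟩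
    · exact ⟨j, h.left_lt, by simpa [turnCell, coneRecord] using h.left_ne⟩
    · exact ⟨l, h.right_lt, by simpa [turnLeft, coneRecord] using ⟨h.right_ne, hjl.symm⟩⟩
    · exact ⟨j, h.left_lt, by simpa [turnRight, coneRecord] using ⟨h.left_ne, hjl⟩⟩
  · have c1 : (turnCell p w i j l).sites.toFinset.card = 1 := by simp [turnCell, coneRecord]
    have c2 : (turnLeft p w i j).sites.toFinset.card = 2 := by
      simp [turnLeft, coneRecord, Finset.card_pair h.left_ne.symm]
    have c3 : (turnRight p w i l).sites.toFinset.card = 2 := by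
      simp [turnRight, coneRecord, Finset.card_pair h.right_ne.symm]
    have d1 : (turnCell p w i j l).sites.toFinset ≠ (turnLeft p w i j).sites.toFinset :=
      fun he => by rw [he] at c1; omega
    have d2 : (turnCell p w i j l).sites.toFinset ≠ (turnRight p w i l).sites.toFinset :=
      fun he => by rw [he] at c1; omega
    have d3 : (turnLeft p w i j).sites.toFinset ≠ (turnRight p w i l).sites.toFinset := by
      intro he
      have : j ∈ (turnRight p w i l).sites.toFinset := by
        rw [← he]; simp [turnLeft, coneRecord]
      simp [turnRight, coneRecord, h.left_ne, hjl] at this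
    unfold turnRecords
    split_ifs <;> simp [d1, d2, d3]
  · rintro v hv hmin ⟨q, hq, hqv⟩
    obtain ⟨a, b, c, ha, hb, ha0, hb0, hvc⟩ := h.exists_comb hw hp hn hv
    have hval : ∀ k < n, dot v (p k - p i) = - (a * det w (p j - p i) (p k - p i)) -
        b * det w (p k - p i) (p l - p i) := by
      intro k hk
      rw [hvc, dot_add_left, dot_add_left, dot_smul_left, dot_smul_left, dot_smul_left,
        hw.2 i h.lt k hk, dot_left, dot_right]
      ring
    have hmem : ∀ k, k ∈ argmaxSet n p v ↔ k < n ∧ a * det w (p j - p i) (p k - p i) = 0 ∧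
        b * det w (p k - p i) (p l - p i) = 0 := by
      intro k
      rw [mem_argmaxSet_iff hv]
      refine and_congr_right fun hk => ?_
      rw [hval k hk]
      have h1 := mul_nonneg ha (h.left k hk)
      have h2 := mul_nonneg hb (h.right k hk)
      exact ⟨fun h0 => ⟨by linarith, by linarith⟩, fun h0 => by rw [h0.1, h0.2]; simp⟩
    have hkl : ∀ k ∈ argmaxSet n p v, a ≠ 0 → k = i ∨ k = j := by
      intro k hk ha'
      by_contra hcon
      push Not at hcon
      have := ((hmem k).1 hk).2.1
      exact hw.det_ne_zero hp h.lt h.left_lt hk.1 h.left_ne hcon.1 hcon.2.symm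
        ((mul_eq_zero.1 this).resolve_left ha')
    have hkr : ∀ k ∈ argmaxSet n p v, b ≠ 0 → k = i ∨ k = l := by
      intro k hk hb'
      by_contra hcon
      push Not at hcon
      have := ((hmem k).1 hk).2.2
      exact hw.det_ne_zero hp h.lt hk.1 h.right_lt hcon.1 h.right_ne hcon.2
        ((mul_eq_zero.1 this).resolve_left hb')
    by_cases ha' : a = 0
    · by_cases hb' : b = 0
      · exact absurd ((hmem q).2 ⟨hq, by rw [ha', zero_mul], by rw [hb', zero_mul]⟩) hqv
      · have hlv := ha0.1 ha'
        have hil : i < l := lt_of_le_of_ne (hmin l hlv) h.right_ne.symm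
        refine ⟨turnRight p w i l, by simp [turnRecords, hil], ?_⟩
        ext k
        simp only [turnRight, coneRecord, List.mem_cons, List.not_mem_nil, or_false,
          Set.mem_ofPred_eq]
        exact ⟨by rintro (rfl | rfl) <;> assumption, fun hk => hkr k hk hb'⟩
    · by_cases hb' : b = 0
      · have hjv := hb0.1 hb'
        have hij : i < j := lt_of_le_of_ne (hmin j hjv) h.left_ne.symm
        refine ⟨turnLeft p w i j, by simp [turnRecords, hij], ?_⟩
        ext k
        simp only [turnLeft, coneRecord, List.mem_cons, List.not_mem_nil, or_false,
          Set.mem_ofPred_eq]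
        exact ⟨by rintro (rfl | rfl) <;> assumption, fun hk => hkl k hk ha'⟩
      · refine ⟨turnCell p w i j l, by simp [turnRecords], ?_⟩
        ext k
        simp only [turnCell, coneRecord, List.mem_singleton, Set.mem_ofPred_eq]
        refine ⟨by rintro rfl; exact hv, fun hk => ?_⟩
        rcases hkl k hk ha' with h1 | h1
        · exact h1
        rcases hkr k hk hb' with h2 | h2
        · exact h2
        · exact absurd (h1.symm.trans h2) hjl

end IsTurn

/-! ### One or two sites -/

/-- The unit vectors of the coordinate axes. -/
def axis (k : Fin 3) : E3 :=
  !₂[if k = 0 then 1 else 0, if k = 1 then 1 else 0, if k = 2 then 1 else 0]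

/-- The three given vectors and their opposites. -/
def plusMinus (a b c : E3) : List E3 := [a, -a, b, -b, c, -c]

lemma comb_mem_plusMinus {a b c : E3} {l : List E3} (h : ∀ x ∈ plusMinus a b c, x ∈ l)
    (r s t : ℝ) : r • a + s • b + t • c ∈ Submodule.span NNReal {x | x ∈ l} :=
  add_mem (add_mem (line_mem_cone (h _ (by simp [plusMinus])) (h _ (by simp [plusMinus])) r)
    (line_mem_cone (h _ (by simp [plusMinus])) (h _ (by simp [plusMinus])) s))
    (line_mem_cone (h _ (by simp [plusMinus])) (h _ (by simp [plusMinus])) t)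

lemma allRecord_isFace_one :
    IsFace 1 p (coneRecord (List.range 1) (plusMinus (axis 0) (axis 1) (axis 2))) := by
  refine allRecord_isFace ?_ ?_
  · intro r _ k hk
    refine ⟨hk, fun l hl => ?_⟩
    rw [Nat.lt_one_iff.1 hk, Nat.lt_one_iff.1 hl]
  · intro v _
    have : v = v 0 • axis 0 + v 1 • axis 1 + v 2 • axis 2 := by
      apply ext3 <;> simp [axis]
    rw [this]
    exact comb_mem_plusMinus (fun x hx => hx) _ _ _

lemma isLocal_one : IsLocal 1 p 0 [] := by
  refine ⟨by simp, by simp, by simp, by simp, by simp, ?_⟩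
  rintro v hv - ⟨k, hk, hkv⟩
  rw [Nat.lt_one_iff.1 hk] at hkv
  exact absurd hv hkv

/-- Six rays which span the plane orthogonal to `d`. -/
def planeRays (d : E3) : List E3 :=
  plusMinus (cross (axis 0) d) (cross (axis 1) d) (cross (axis 2) d)

lemma dot_planeRays {d x : E3} (hx : x ∈ planeRays d) : dot x d = 0 := by
  have h : ∀ a : E3, dot (cross a d) d = 0 := fun a => det_self_right a d
  simp only [planeRays, plusMinus, List.mem_cons, List.not_mem_nil, or_false] at hx
  rcases hx with rfl | rfl | rfl | rfl | rfl | rfl <;> simp [h]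

/-- The orthogonal projection of a vector to the plane orthogonal to `d` lies in the span of the six
rays. -/
lemma comb_planeRays {d : E3} (hd : d ≠ 0) {l : List E3} (h : ∀ x ∈ planeRays d, x ∈ l) (v : E3) :
    v - (dot v d / dot d d) • d ∈ Submodule.span NNReal {x | x ∈ l} := by
  have hd' := dot_self_pos hd
  have : v - (dot v d / dot d d) • d = (cross d v 0 / dot d d) • cross (axis 0) d +
      (cross d v 1 / dot d d) • cross (axis 1) d + (cross d v 2 / dot d d) • cross (axis 2) d := by
    have h1 : dot d d • v - dot v d • d = cross d v 0 • cross (axis 0) d +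
        cross d v 1 • cross (axis 1) d + cross d v 2 • cross (axis 2) d := by
      apply ext3 <;> simp [axis, dot] <;> ring
    have h2 := congrArg (fun z => (dot d d)⁻¹ • z) h1
    simp only [smul_sub, smul_add, smul_smul, inv_mul_cancel₀ hd'.ne', one_smul] at h2
    simp only [div_eq_inv_mul]
    exact h2
  rw [this]
  exact comb_mem_plusMinus h _ _ _

/-- The cone of the site `i` of two sites, a half-space; `d` is the difference of the other site and
the site `i`. -/
def pairCell (i : ℕ) (d : E3) : FaceRecord := coneRecord [i] (planeRays d ++ [-d])

lemma isLocal_pair (hp : Sites 2 p) {i j : ℕ} (hi : i < 2) (hj : j < 2) (hij : j ≠ i) :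
    IsLocal 2 p i [pairCell i (p j - p i)] := by
  have hd := hp.diff_ne_zero hi hj hij
  have hd' := dot_self_pos hd
  have hcases : ∀ k < 2, k = i ∨ k = j := fun k hk => by omega
  have hmem : ∀ v, i ∈ argmaxSet 2 p v ↔ dot v (p j - p i) ≤ 0 := by
    intro v
    rw [mem_argmaxSet]
    constructor
    · rintro ⟨-, h⟩
      have := h j hj
      rw [dot_neg_left] at this; linarith
    · intro h
      refine ⟨hi, fun l hl => ?_⟩
      rcases hcases l hl with rfl | rfl
      · simp
      · rw [dot_neg_left]; linarith
  refine ⟨?_, ?_, ?_, ?_, by simp, ?_⟩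
  · intro f hf
    rw [List.mem_singleton.1 hf]
    refine isFace_coneRecord (List.nodup_singleton i) ⟨p i, ?_⟩ ?_ ?_
    · rw [hp.argmaxSet_self hi]; ext; simp
    · intro r hr k hk
      rw [List.mem_singleton.1 hk, hmem]
      rcases List.mem_append.1 hr with hr | hr
      · rw [dot_planeRays hr]
      · rw [List.mem_singleton.1 hr, dot_neg_left]; linarith
    · intro v hv
      have h0 := (hmem v).1 (hv i (by simp))
      have h1 := comb_planeRays hd (l := planeRays (p j - p i) ++ [-(p j - p i)])
        (fun x hx => List.mem_append_left _ hx) v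
      have h2 : (-(dot v (p j - p i) / dot (p j - p i) (p j - p i))) • (-(p j - p i)) ∈
          Submodule.span NNReal {x | x ∈ planeRays (p j - p i) ++ [-(p j - p i)]} := by
        refine ray_mem_cone (List.mem_append_right _ (by simp)) ?_
        rw [← neg_div]
        exact div_nonneg (neg_nonneg.2 h0) hd'.le
      have h3 := add_mem h1 h2
      rwa [neg_smul_neg, sub_add_cancel] at h3
  · intro f hf
    rw [List.mem_singleton.1 hf]; simp [pairCell, coneRecord]
  · intro f hf k hk
    rw [List.mem_singleton.1 hf] at hk
    simp [pairCell, coneRecord] at hk; omega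
  · intro f hf
    rw [List.mem_singleton.1 hf]
    exact ⟨j, hj, by simpa [pairCell, coneRecord] using hij⟩
  · rintro v hv - ⟨k, hk, hkv⟩
    refine ⟨_, List.mem_singleton_self _, ?_⟩
    have hk' : k = j := (hcases k hk).resolve_left (by rintro rfl; exact hkv hv)
    ext q
    simp only [pairCell, coneRecord, List.mem_singleton, Set.mem_ofPred_eq]
    refine ⟨by rintro rfl; exact hv, fun hq => (hcases q hq.1).resolve_right ?_⟩
    rintro rfl
    exact hkv (hk' ▸ hq)

lemma allRecord_isFace_two (hp : Sites 2 p) :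
    IsFace 2 p (coneRecord (List.range 2) (planeRays (p 1 - p 0))) := by
  have hd := hp.diff_ne_zero (i := 0) (k := 1) (by omega) (by omega) (by omega)
  refine allRecord_isFace ?_ ?_
  · intro r hr k hk
    have h0 := dot_planeRays hr
    rw [dot_sub_right] at h0
    refine ⟨hk, fun l hl => ?_⟩
    have : dot r (p 1) = dot r (p 0) := by linarith
    interval_cases k <;> interval_cases l <;> simp [this]
  · intro v hv
    have h0 := ((mem_argmaxSet_iff (hv 0 (by omega))).1 (hv 1 (by omega))).2
    have h1 := comb_planeRays hd (l := planeRays (p 1 - p 0)) (fun x hx => hx) v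
    rwa [h0, zero_div, zero_smul, sub_zero] at h1

end BlochFan

/-! ### Programs and their effect on an abstract memory -/
namespace BlochFan
open RealRAM

/-- The part of the memory which the algorithm uses, in abstract form: five counters, an auxiliary
index, an array of indices, the faces already written, and the sites and rays of the face that is
being written. -/
structure Abs where
  /-- the current site -/
  i : ℕ
  /-- a position in the array `A` -/
  t : ℕ
  /-- the site that a scan looks at -/
  k : ℕ
  /-- the candidate kept by a scan -/
  cur : ℕ
  /-- the number of neighbours of the current site -/
  m : ℕ
  /-- the following vertex of a polygon -/
  aux : ℕ
  /-- the neighbours of the current site -/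
  A : ℕ → ℕ
  /-- the finished faces -/
  L : List FaceRecord
  /-- the sites of the face being written -/
  ps : List ℕ
  /-- the rays of the face being written -/
  pr : List E3

/-- The ray at position `t` of the output arrays. -/
noncomputable def rayAt (s : Mem) (t : ℕ) : E3 := !₂[s.rArr 6 t, s.rArr 7 t, s.rArr 8 t]

/-- The memory holds the finished faces `L`, and the sites `ps` and rays `pr` of the next face. The
index variables `2` and `3` point to the first free entries of the site and ray arrays. -/
structure Out (L : List FaceRecord) (ps : List ℕ) (pr : List E3) (s : Mem) : Prop where
  len : s.iVar 1 = L.length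
  faces : (List.range L.length).map (faceAt s) = L
  site_le : ∀ q ≤ L.length, s.iArr 0 q ≤ s.iVar 2
  ray_le : ∀ q ≤ L.length, s.iArr 3 q ≤ s.iVar 3
  point : ∀ q ≤ L.length, s.iArr 2 q = q
  points_zero : ∀ k, s.rArr 3 k = 0 ∧ s.rArr 4 k = 0 ∧ s.rArr 5 k = 0
  sites : slice (s.iArr 1) (s.iArr 0 L.length) (s.iVar 2) = ps
  rays : slice (rayAt s) (s.iArr 3 L.length) (s.iVar 3) = pr

/-- The memory `s` realizes the abstract memory `a`, for the sites `p 0, …, p (n - 1)`. -/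
structure Rel (n : ℕ) (p : ℕ → E3) (a : Abs) (s : Mem) : Prop where
  n_eq : s.iVar 0 = n
  i_eq : s.iVar 4 = a.i
  t_eq : s.iVar 5 = a.t
  k_eq : s.iVar 6 = a.k
  cur_eq : s.iVar 7 = a.cur
  m_eq : s.iVar 8 = a.m
  aux_eq : s.iVar 9 = a.aux
  arr_eq : s.iArr 4 = a.A
  site_eq : ∀ k, (!₂[s.rArr 0 k, s.rArr 1 k, s.rArr 2 k] : E3) = p k
  out : Out a.L a.ps a.pr s

lemma slice_congr {β : Type} {A B : ℕ → β} {lo hi : ℕ} (h : ∀ t, t < hi → A t = B t) :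
    slice A lo hi = slice B lo hi :=
  List.map_congr_left fun t ht => h t (List.Ico.mem.1 ht).2

lemma slice_succ {β : Type} (A : ℕ → β) {lo hi : ℕ} (h : lo ≤ hi) :
    slice A lo (hi + 1) = slice A lo hi ++ [A hi] := by
  simp [slice, List.Ico.succ_top h]

lemma slice_self {β : Type} (A : ℕ → β) (lo : ℕ) : slice A lo lo = [] := by
  simp [slice]

lemma slice_one {β : Type} (A : ℕ → β) (lo : ℕ) : slice A lo (lo + 1) = [A lo] := by
  rw [slice_succ A le_rfl, slice_self]; rfl

/-- The output in memory depends only on the entries below the two pointers. -/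
lemma Out.congr {L : List FaceRecord} {ps : List ℕ} {pr : List E3} {s s' : Mem}
    (h : Out L ps pr s) (h1 : s'.iVar 1 = s.iVar 1) (h2 : s'.iVar 2 = s.iVar 2)
    (h3 : s'.iVar 3 = s.iVar 3) (a0 : s'.iArr 0 = s.iArr 0) (a2 : s'.iArr 2 = s.iArr 2)
    (a3 : s'.iArr 3 = s.iArr 3) (a1 : ∀ t < s.iVar 2, s'.iArr 1 t = s.iArr 1 t)
    (b : ∀ k, s'.rArr 3 k = 0 ∧ s'.rArr 4 k = 0 ∧ s'.rArr 5 k = 0)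
    (c : ∀ t < s.iVar 3, rayAt s' t = rayAt s t) : Out L ps pr s' := by
  refine ⟨h1 ▸ h.len, ?_, ?_, ?_, ?_, b, ?_, ?_⟩
  · rw [← h.faces]
    rw [List.length_map, List.length_range]
    refine List.map_congr_left fun q hq => ?_
    have hq' := List.mem_range.1 hq
    have e1 : slice (s'.iArr 1) (s.iArr 0 q) (s.iArr 0 (q + 1)) =
        slice (s.iArr 1) (s.iArr 0 q) (s.iArr 0 (q + 1)) :=
      slice_congr fun t ht => a1 t (lt_of_lt_of_le ht (h.site_le _ hq'))
    have e2 : slice (rayAt s') (s.iArr 3 q) (s.iArr 3 (q + 1)) =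
        slice (rayAt s) (s.iArr 3 q) (s.iArr 3 (q + 1)) :=
      slice_congr fun t ht => c t (lt_of_lt_of_le ht (h.ray_le _ hq'))
    have e3 : ∀ t, (!₂[s'.rArr 3 t, s'.rArr 4 t, s'.rArr 5 t] : E3) =
        !₂[s.rArr 3 t, s.rArr 4 t, s.rArr 5 t] := fun t => by
      rw [(b t).1, (b t).2.1, (b t).2.2, (h.points_zero t).1, (h.points_zero t).2.1,
        (h.points_zero t).2.2]
    simp only [faceAt, a0, a2, a3, FaceRecord.mk.injEq, e3]
    exact ⟨e1, trivial, e2⟩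
  · intro q hq; rw [a0, h2]; exact h.site_le q hq
  · intro q hq; rw [a3, h3]; exact h.ray_le q hq
  · intro q hq; rw [a2]; exact h.point q hq
  · rw [a0, h2, ← h.sites]; exact slice_congr a1
  · rw [a3, h3, ← h.rays]; exact slice_congr c

/-- The program `P` takes the abstract memory `a`, in time at most `T`, to one with the
property `Q`. -/
def Does (n : ℕ) (p : ℕ → E3) (P : Prog) (a : Abs) (T : ℕ) (Q : Abs → Prop) : Prop :=
  ∀ s, Rel n p a s → ∃ t s' a', Exec P s t s' ∧ t ≤ T ∧ Rel n p a' s' ∧ Q a'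

/-- In every memory which realizes `a`, the test `b` decides `β`. -/
def Decides (n : ℕ) (p : ℕ → E3) (a : Abs) (b : Test) (β : Prop) : Prop :=
  ∀ s, Rel n p a s → (b.Holds s ↔ β)

/-- In every memory which realizes `a`, the expression `e` has the value `x`. -/
def Evals (n : ℕ) (p : ℕ → E3) (a : Abs) (e : IExpr) (x : ℕ) : Prop :=
  ∀ s, Rel n p a s → e.val s = x

variable {n : ℕ} {p : ℕ → E3}

lemma Does.mono {P : Prog} {a : Abs} {T T' : ℕ} {Q Q' : Abs → Prop} (h : Does n p P a T Q)
    (hT : T ≤ T') (hQ : ∀ a', Q a' → Q' a') : Does n p P a T' Q' := by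
  intro s hs
  obtain ⟨t, s', a', h1, h2, h3, h4⟩ := h s hs
  exact ⟨t, s', a', h1, h2.trans hT, h3, hQ a' h4⟩

lemma Does.seq {P P' : Prog} {a : Abs} {T T' : ℕ} {Q Q' : Abs → Prop} (h : Does n p P a T Q)
    (h' : ∀ a', Q a' → Does n p P' a' T' Q') : Does n p (.seq P P') a (T + T') Q' := by
  intro s hs
  obtain ⟨t, s', a', h1, h2, h3, h4⟩ := h s hs
  obtain ⟨t', s'', a'', h5, h6, h7, h8⟩ := h' a' h4 s' h3
  exact ⟨t + t', s'', a'', .seq h1 h5, add_le_add h2 h6, h7, h8⟩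

lemma Does.seq_eq {P P' : Prog} {a a' : Abs} {T T' : ℕ} {Q' : Abs → Prop}
    (h : Does n p P a T (· = a')) (h' : Does n p P' a' T' Q') :
    Does n p (.seq P P') a (T + T') Q' :=
  h.seq fun _ h => h ▸ h'

lemma does_skip (a : Abs) : Does n p .skip a 1 (· = a) := fun s hs =>
  ⟨1, s, a, .skip s, le_rfl, hs, rfl⟩

lemma does_cond {b : Test} {β : Prop} {P P' : Prog} {a : Abs} {T : ℕ} {Q : Abs → Prop}
    (hb : Decides n p a b β) (h : β → Does n p P a T Q) (h' : ¬ β → Does n p P' a T Q) :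
    Does n p (.cond b P P') a (b.cost + T) Q := by
  intro s hs
  by_cases hβ : β
  · obtain ⟨t, s', a', h1, h2, h3, h4⟩ := h hβ s hs
    exact ⟨b.cost + t, s', a', .condTrue ((hb s hs).2 hβ) h1, by omega, h3, h4⟩
  · obtain ⟨t, s', a', h1, h2, h3, h4⟩ := h' hβ s hs
    exact ⟨b.cost + t, s', a', .condFalse (fun h => hβ ((hb s hs).1 h)) h1, by omega, h3, h4⟩

/-- A loop whose `q`-th round takes time at most `B q`, and which ends within `N` rounds. -/
lemma does_loop (I : ℕ → Abs → Prop) (N : ℕ) (β : ℕ → Abs → Prop) (B : ℕ → ℕ) {b : Test} {P : Prog}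
    (hI : ∀ q a, I q a → Decides n p a b (β q a) ∧
      (β q a → q < N ∧ Does n p P a (B q) (I (q + 1)))) {q : ℕ} {a : Abs} (h : I q a) :
    Does n p (.loop b P) a (∑ x ∈ Finset.Ico q N, (B x + b.cost) + b.cost)
      (fun a' => ∃ q, I q a' ∧ ¬ β q a') := by
  induction hd : N - q generalizing q a with
  | zero =>
    intro s hs
    obtain ⟨h1, h2⟩ := hI q a h
    have h3 : ¬ β q a := fun h3 => by have := (h2 h3).1; omega
    exact ⟨b.cost, s, a, .loopDone fun h4 => h3 ((h1 s hs).1 h4), by omega, hs, q, h, h3⟩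
  | succ d ih =>
    intro s hs
    obtain ⟨h1, h2⟩ := hI q a h
    by_cases h3 : β q a
    · obtain ⟨h4, h5⟩ := h2 h3
      obtain ⟨t, s', a', e1, e2, e3, e4⟩ := h5 s hs
      obtain ⟨t', s'', a'', f1, f2, f3, f4⟩ := ih e4 (by omega) s' e3
      refine ⟨b.cost + t + t', s'', a'', .loopStep ((h1 s hs).2 h3) e1 f1, ?_, f3, f4⟩
      rw [Finset.sum_eq_sum_Ico_succ_bot h4]
      omega
    · exact ⟨b.cost, s, a, .loopDone fun h4 => h3 ((h1 s hs).1 h4), by omega, hs, q, h, h3⟩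

/-- A loop which makes exactly `N` rounds. -/
lemma does_for (I : ℕ → Abs → Prop) (N : ℕ) (B : ℕ → ℕ) {b : Test} {P : Prog}
    (hb : ∀ q a, I q a → Decides n p a b (q < N))
    (hI : ∀ q a, I q a → q < N → Does n p P a (B q) (I (q + 1))) {a : Abs} (h : I 0 a) :
    Does n p (.loop b P) a (∑ x ∈ Finset.range N, (B x + b.cost) + b.cost) (I N) := by
  have h1 := does_loop (n := n) (p := p) (b := b) (P := P) (fun q a => I q a ∧ q ≤ N) N
    (fun q _ => q < N) B (fun q a h => ⟨hb q a h.1, fun hq => ⟨hq,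
      (hI q a h.1 hq).mono le_rfl fun a' h' => ⟨h', hq⟩⟩⟩) (q := 0) ⟨h, Nat.zero_le _⟩
  rw [Finset.range_eq_Ico]
  refine h1.mono le_rfl ?_
  rintro a' ⟨q, ⟨h2, h3⟩, h4⟩
  obtain rfl : q = N := by omega
  exact h2

/-- A loop with `N` rounds of bounded cost. -/
lemma does_for_const (I : ℕ → Abs → Prop) (N : ℕ) (B : ℕ) {b : Test} {P : Prog}
    (hb : ∀ q a, I q a → Decides n p a b (q < N))
    (hI : ∀ q a, I q a → q < N → Does n p P a B (I (q + 1))) {a : Abs} (h : I 0 a) :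
    Does n p (.loop b P) a ((B + b.cost) * (N + 1)) (I N) := by
  refine (does_for I N (fun _ => B) hb hI h).mono ?_ fun _ h => h
  rw [Finset.sum_const, Finset.card_range, smul_eq_mul]
  nlinarith

/-! ### Assignments -/

lemma does_setIVar {v : ℕ} {e : IExpr} {a a' : Abs}
    (h : ∀ s, Rel n p a s →
      Rel n p a' { s with iVar := Function.update s.iVar v (e.val s) }) :
    Does n p (.setIVar v e) a (e.cost + 1) (· = a') := fun s hs =>
  ⟨_, _, a', .setIVar s v e, le_rfl, h s hs, rfl⟩

/-- The index variables from `4` on do not belong to the output. -/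
lemma Rel.setIVar {a : Abs} {s : Mem} (h : Rel n p a s) {v : ℕ} (hv : 4 ≤ v) (x : ℕ) :
    Out a.L a.ps a.pr { s with iVar := Function.update s.iVar v x } := by
  refine h.out.congr ?_ ?_ ?_ rfl rfl rfl (fun _ _ => rfl) h.out.points_zero (fun _ _ => rfl) <;>
  · show Function.update s.iVar v x _ = _
    rw [Function.update_of_ne (by omega)]

lemma does_i {e : IExpr} {a : Abs} {x : ℕ} (he : Evals n p a e x) :
    Does n p (.setIVar 4 e) a (e.cost + 1) (· = { a with i := x }) :=
  does_setIVar fun s h => by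
    rw [he s h]
    exact ⟨h.n_eq, rfl, h.t_eq, h.k_eq, h.cur_eq, h.m_eq, h.aux_eq, h.arr_eq, h.site_eq,
      h.setIVar (by norm_num) x⟩

lemma does_t {e : IExpr} {a : Abs} {x : ℕ} (he : Evals n p a e x) :
    Does n p (.setIVar 5 e) a (e.cost + 1) (· = { a with t := x }) :=
  does_setIVar fun s h => by
    rw [he s h]
    exact ⟨h.n_eq, h.i_eq, rfl, h.k_eq, h.cur_eq, h.m_eq, h.aux_eq, h.arr_eq, h.site_eq,
      h.setIVar (by norm_num) x⟩

lemma does_k {e : IExpr} {a : Abs} {x : ℕ} (he : Evals n p a e x) :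
    Does n p (.setIVar 6 e) a (e.cost + 1) (· = { a with k := x }) :=
  does_setIVar fun s h => by
    rw [he s h]
    exact ⟨h.n_eq, h.i_eq, h.t_eq, rfl, h.cur_eq, h.m_eq, h.aux_eq, h.arr_eq, h.site_eq,
      h.setIVar (by norm_num) x⟩

lemma does_cur {e : IExpr} {a : Abs} {x : ℕ} (he : Evals n p a e x) :
    Does n p (.setIVar 7 e) a (e.cost + 1) (· = { a with cur := x }) :=
  does_setIVar fun s h => by
    rw [he s h]
    exact ⟨h.n_eq, h.i_eq, h.t_eq, h.k_eq, rfl, h.m_eq, h.aux_eq, h.arr_eq, h.site_eq,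
      h.setIVar (by norm_num) x⟩

lemma does_m {e : IExpr} {a : Abs} {x : ℕ} (he : Evals n p a e x) :
    Does n p (.setIVar 8 e) a (e.cost + 1) (· = { a with m := x }) :=
  does_setIVar fun s h => by
    rw [he s h]
    exact ⟨h.n_eq, h.i_eq, h.t_eq, h.k_eq, h.cur_eq, rfl, h.aux_eq, h.arr_eq, h.site_eq,
      h.setIVar (by norm_num) x⟩

lemma does_aux {e : IExpr} {a : Abs} {x : ℕ} (he : Evals n p a e x) :
    Does n p (.setIVar 9 e) a (e.cost + 1) (· = { a with aux := x }) :=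
  does_setIVar fun s h => by
    rw [he s h]
    exact ⟨h.n_eq, h.i_eq, h.t_eq, h.k_eq, h.cur_eq, h.m_eq, rfl, h.arr_eq, h.site_eq,
      h.setIVar (by norm_num) x⟩

lemma does_arr {d e : IExpr} {a : Abs} {q x : ℕ} (hd : Evals n p a d q) (he : Evals n p a e x) :
    Does n p (.setIArr 4 d e) a (d.cost + e.cost + 1)
      (· = { a with A := Function.update a.A q x }) := fun s h => by
  refine ⟨_, _, { a with A := Function.update a.A q x }, .setIArr s 4 d e, le_rfl, ?_, rfl⟩
  rw [hd s h, he s h]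
  refine ⟨h.n_eq, h.i_eq, h.t_eq, h.k_eq, h.cur_eq, h.m_eq, h.aux_eq, ?_, h.site_eq, ?_⟩
  · show write s.iArr 4 q x 4 = _
    rw [write, Function.update_self, h.arr_eq]
  · exact h.out.congr rfl rfl rfl rfl rfl rfl (fun _ _ => rfl) h.out.points_zero (fun _ _ => rfl)

/-! ### Vector expressions -/

/-- Three real expressions, read as a vector. -/
structure VExpr where
  x : RExpr
  y : RExpr
  z : RExpr

/-- The value of a vector expression. -/
noncomputable def VExpr.val (s : Mem) (v : VExpr) : E3 := !₂[v.x.val s, v.y.val s, v.z.val s]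

/-- In every memory which realizes `a`, the vector expression `v` has the value `x`. -/
def VEvals (n : ℕ) (p : ℕ → E3) (a : Abs) (v : VExpr) (x : E3) : Prop :=
  ∀ s, Rel n p a s → v.val s = x

/-- The Bloch vector of a site. -/
def siteE (e : IExpr) : VExpr := ⟨.get 0 e, .get 1 e, .get 2 e⟩

/-- The difference of two vectors. -/
def subE (v w : VExpr) : VExpr := ⟨.sub v.x w.x, .sub v.y w.y, .sub v.z w.z⟩

/-- The vector product. -/
def crossE (v w : VExpr) : VExpr :=
  ⟨.sub (.mul v.y w.z) (.mul v.z w.y), .sub (.mul v.z w.x) (.mul v.x w.z),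
    .sub (.mul v.x w.y) (.mul v.y w.x)⟩

/-- The inner product. -/
def dotE (v w : VExpr) : RExpr :=
  .add (.add (.mul v.x w.x) (.mul v.y w.y)) (.mul v.z w.z)

/-- A vector with integer coordinates. -/
def constE (a b c : ℤ) : VExpr := ⟨.const a, .const b, .const c⟩

lemma siteE_val {a : Abs} {e : IExpr} {s : Mem} (h : Rel n p a s) :
    (siteE e).val s = p (e.val s) := h.site_eq _

lemma subE_val (v w : VExpr) (s : Mem) : (subE v w).val s = v.val s - w.val s := by
  apply ext3 <;> simp [VExpr.val, subE, RExpr.val]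

lemma crossE_val (v w : VExpr) (s : Mem) : (crossE v w).val s = cross (v.val s) (w.val s) := by
  apply ext3 <;> simp [VExpr.val, crossE, RExpr.val]

lemma dotE_val (v w : VExpr) (s : Mem) : (dotE v w).val s = dot (v.val s) (w.val s) := by
  simp [VExpr.val, dotE, RExpr.val, dot]

lemma constE_val (a b c : ℤ) (s : Mem) : (constE a b c).val s = !₂[(a : ℝ), (b : ℝ), (c : ℝ)] := rfl

/-! ### Output -/

/-- Appends a site to the site list of the current face. -/
def emitSite (e : IExpr) : Prog :=
  .seq (.setIArr 1 (.var 2) e) (.setIVar 2 (.add (.var 2) (.const 1)))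

/-- Appends a ray to the ray list of the current face. -/
def emitRay (v : VExpr) : Prog :=
  .seq (.setRArr 6 (.var 3) v.x) (.seq (.setRArr 7 (.var 3) v.y) (.seq (.setRArr 8 (.var 3) v.z)
    (.setIVar 3 (.add (.var 3) (.const 1)))))

/-- Finishes the current face; its point list consists of a single origin. -/
def closeFace : Prog :=
  .seq (.setIVar 1 (.add (.var 1) (.const 1))) (.seq (.setIArr 0 (.var 1) (.var 2))
    (.seq (.setIArr 2 (.var 1) (.var 1)) (.setIArr 3 (.var 1) (.var 3))))

lemma does_emitSite {e : IExpr} {a : Abs} {x : ℕ} (he : Evals n p a e x) :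
    Does n p (emitSite e) a (e.cost + 6) (· = { a with ps := a.ps ++ [x] }) := fun s h => by
  refine ⟨_, _, { a with ps := a.ps ++ [x] }, .seq (.setIArr s 1 (.var 2) e) (.setIVar _ _ _),
    ?_, ?_, rfl⟩
  · simp only [IExpr.cost]; omega
  rw [he s h]
  refine ⟨h.n_eq, h.i_eq, h.t_eq, h.k_eq, h.cur_eq, h.m_eq, h.aux_eq, h.arr_eq, h.site_eq, ?_⟩
  have h1 : Out a.L a.ps a.pr { s with iArr := write s.iArr 1 (s.iVar 2) x } := by
    refine h.out.congr rfl rfl rfl rfl rfl rfl (fun t ht => ?_) h.out.points_zero (fun _ _ => rfl)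
    show write s.iArr 1 (s.iVar 2) x 1 t = _
    rw [write, Function.update_self, Function.update_of_ne ht.ne]
  refine ⟨h1.len, h1.faces, fun q hq => (h1.site_le q hq).trans (Nat.le_succ _), h1.ray_le,
    h1.point, h1.points_zero, ?_, h1.rays⟩
  refine Eq.trans (slice_succ (write s.iArr 1 (s.iVar 2) x 1) (h1.site_le _ le_rfl)) ?_
  congr 1
  · exact h1.sites
  · exact congrArg (fun y => [y]) (by simp [write, IExpr.val])

lemma write_ne {β : Type} (A : ℕ → ℕ → β) {b c : ℕ} (k : ℕ) (v : β) (h : c ≠ b) :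
    write A b k v c = A c := by rw [write, Function.update_of_ne h]

lemma write_eq {β : Type} (A : ℕ → ℕ → β) (b k : ℕ) (v : β) : write A b k v b k = v := by
  rw [write, Function.update_self, Function.update_self]

lemma write_eq_of_ne {β : Type} (A : ℕ → ℕ → β) (b : ℕ) {k t : ℕ} (v : β) (h : t ≠ k) :
    write A b k v b t = A b t := by
  rw [write, Function.update_self, Function.update_of_ne h]

/-- The entry after the last ray is free, so that writing there changes nothing in the output. -/
lemma Rel.setRArr {a : Abs} {s : Mem} (h : Rel n p a s) {b : ℕ} (hb : b = 6 ∨ b = 7 ∨ b = 8)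
    (r : ℝ) : Rel n p a { s with rArr := write s.rArr b (s.iVar 3) r } := by
  have hw : ∀ c < 6, write s.rArr b (s.iVar 3) r c = s.rArr c := fun c hc =>
    write_ne _ _ _ (by omega)
  refine ⟨h.n_eq, h.i_eq, h.t_eq, h.k_eq, h.cur_eq, h.m_eq, h.aux_eq, h.arr_eq, fun k => ?_, ?_⟩
  · show (!₂[write s.rArr b _ r 0 k, write s.rArr b _ r 1 k, write s.rArr b _ r 2 k] : E3) = _
    rw [hw 0 (by omega), hw 1 (by omega), hw 2 (by omega)]
    exact h.site_eq k
  · refine h.out.congr rfl rfl rfl rfl rfl rfl (fun _ _ => rfl) (fun k => ?_) (fun t ht => ?_)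
    · show write s.rArr b _ r 3 k = 0 ∧ write s.rArr b _ r 4 k = 0 ∧ write s.rArr b _ r 5 k = 0
      rw [hw 3 (by omega), hw 4 (by omega), hw 5 (by omega)]
      exact h.out.points_zero k
    · have : ∀ c, write s.rArr b (s.iVar 3) r c t = s.rArr c t := by
        intro c
        by_cases hc : c = b
        · subst hc; exact write_eq_of_ne _ _ _ ht.ne
        · rw [write_ne _ _ _ hc]
      show (!₂[write s.rArr b _ r 6 t, write s.rArr b _ r 7 t, write s.rArr b _ r 8 t] : E3) = _
      rw [this, this, this]
      rfl

lemma does_emitRay {v : VExpr} {a : Abs} {x : E3} (hv : VEvals n p a v x) :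
    Does n p (emitRay v) a (v.x.cost + v.y.cost + v.z.cost + 10)
      (· = { a with pr := a.pr ++ [x] }) := fun s h => by
  let s1 : Mem := { s with rArr := write s.rArr 6 (s.iVar 3) (v.x.val s) }
  let s2 : Mem := { s1 with rArr := write s1.rArr 7 (s1.iVar 3) (v.y.val s1) }
  let s3 : Mem := { s2 with rArr := write s2.rArr 8 (s2.iVar 3) (v.z.val s2) }
  let s4 : Mem := { s3 with iVar := Function.update s3.iVar 3 (s3.iVar 3 + 1) }
  refine ⟨_, s4, { a with pr := a.pr ++ [x] }, .seq (.setRArr s 6 (.var 3) v.x)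
    (.seq (.setRArr s1 7 (.var 3) v.y) (.seq (.setRArr s2 8 (.var 3) v.z)
      (.setIVar s3 3 (.add (.var 3) (.const 1))))), ?_, ?_, rfl⟩
  · simp only [IExpr.cost]; omega
  have h1 : Rel n p a s1 := h.setRArr (b := 6) (by omega) (v.x.val s)
  have h2 : Rel n p a s2 := h1.setRArr (b := 7) (by omega) (v.y.val s1)
  have h3 : Rel n p a s3 := h2.setRArr (b := 8) (by omega) (v.z.val s2)
  have e1 : v.x.val s = x 0 := congrArg (fun z : E3 => z 0) (hv s h)
  have e2 : v.y.val s1 = x 1 := congrArg (fun z : E3 => z 1) (hv s1 h1)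
  have e3 : v.z.val s2 = x 2 := congrArg (fun z : E3 => z 2) (hv s2 h2)
  refine ⟨h3.n_eq, h3.i_eq, h3.t_eq, h3.k_eq, h3.cur_eq, h3.m_eq, h3.aux_eq, h3.arr_eq,
    h3.site_eq, ?_⟩
  have h4 := h3.out
  refine ⟨h4.len, h4.faces, h4.site_le, fun q hq => (h4.ray_le q hq).trans (Nat.le_succ _),
    h4.point, h4.points_zero, h4.sites, ?_⟩
  refine Eq.trans (slice_succ (rayAt s3) (h4.ray_le _ le_rfl)) ?_
  congr 1
  · exact h4.rays
  · congr 1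
    apply ext3
    · rw [← e1]
      show write s2.rArr 8 (s.iVar 3) (v.z.val s2) 6 (s.iVar 3) = _
      rw [write_ne _ _ _ (by norm_num)]
      show write s1.rArr 7 (s.iVar 3) (v.y.val s1) 6 (s.iVar 3) = _
      rw [write_ne _ _ _ (by norm_num)]
      exact write_eq s.rArr 6 (s.iVar 3) (v.x.val s)
    · rw [← e2]
      show write s2.rArr 8 (s.iVar 3) (v.z.val s2) 7 (s.iVar 3) = _
      rw [write_ne _ _ _ (by norm_num)]
      exact write_eq s1.rArr 7 (s.iVar 3) (v.y.val s1)
    · rw [← e3]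
      exact write_eq s2.rArr 8 (s.iVar 3) (v.z.val s2)

lemma does_closeFace (a : Abs) : Does n p closeFace a 20
    (· = { a with L := a.L ++ [coneRecord a.ps a.pr], ps := [], pr := [] }) := fun s h => by
  refine ⟨_, _, { a with L := a.L ++ [coneRecord a.ps a.pr], ps := [], pr := [] },
    .seq (.setIVar s 1 _) (.seq (.setIArr _ 0 _ _) (.seq (.setIArr _ 2 _ _) (.setIArr _ 3 _ _))),
    ?_, ?_, rfl⟩
  · simp only [IExpr.cost]; omega
  have h0 := h.out
  have hF : s.iVar 1 = a.L.length := h0.len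
  simp only [IExpr.val, Function.update_self, Function.update_of_ne (show (2 : ℕ) ≠ 1 by norm_num),
    Function.update_of_ne (show (3 : ℕ) ≠ 1 by norm_num), hF]
  refine ⟨h.n_eq, h.i_eq, h.t_eq, h.k_eq, h.cur_eq, h.m_eq, h.aux_eq, h.arr_eq, h.site_eq, ?_⟩
  set s' : Mem := { s with
    iVar := Function.update s.iVar 1 (a.L.length + 1)
    iArr := write (write (write s.iArr 0 (a.L.length + 1) (s.iVar 2)) 2 (a.L.length + 1)
      (a.L.length + 1)) 3 (a.L.length + 1) (s.iVar 3) } with hs'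
  have a0 : s'.iArr 0 = Function.update (s.iArr 0) (a.L.length + 1) (s.iVar 2) := rfl
  have a1 : s'.iArr 1 = s.iArr 1 := rfl
  have a2 : s'.iArr 2 = Function.update (s.iArr 2) (a.L.length + 1) (a.L.length + 1) := rfl
  have a3 : s'.iArr 3 = Function.update (s.iArr 3) (a.L.length + 1) (s.iVar 3) := rfl
  have b0 : ∀ q ≤ a.L.length, s'.iArr 0 q = s.iArr 0 q := fun q hq => by
    rw [a0, Function.update_of_ne (by omega)]
  have b2 : ∀ q ≤ a.L.length, s'.iArr 2 q = s.iArr 2 q := fun q hq => by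
    rw [a2, Function.update_of_ne (by omega)]
  have b3 : ∀ q ≤ a.L.length, s'.iArr 3 q = s.iArr 3 q := fun q hq => by
    rw [a3, Function.update_of_ne (by omega)]
  have hlen : (a.L ++ [coneRecord a.ps a.pr]).length = a.L.length + 1 := by simp
  have hpts : ∀ t, (!₂[s'.rArr 3 t, s'.rArr 4 t, s'.rArr 5 t] : E3) = 0 := fun t => by
    have := h0.points_zero t
    apply ext3
    · exact this.1
    · exact this.2.1
    · exact this.2.2
  refine ⟨by rw [hlen]; rfl, ?_, ?_, ?_, ?_, h0.points_zero, ?_, ?_⟩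
  · rw [hlen, List.range_succ, List.map_append]
    congr 1
    · refine Eq.trans ?_ h0.faces
      refine List.map_congr_left fun q hq => ?_
      have hq' := List.mem_range.1 hq
      show faceAt s' q = faceAt s q
      simp only [faceAt]
      rw [b0 q hq'.le, b0 (q + 1) hq', b2 q hq'.le, b2 (q + 1) hq', b3 q hq'.le, b3 (q + 1) hq']
      rfl
    · show [faceAt s' a.L.length] = _
      congr 1
      simp only [faceAt]
      rw [b0 _ le_rfl, b2 _ le_rfl, b3 _ le_rfl, a0, a1, a2, a3, Function.update_self,
        Function.update_self, Function.update_self, h0.point _ le_rfl, slice_one, hpts]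
      show FaceRecord.mk _ _ _ = FaceRecord.mk _ _ _
      congr 1
      · exact h0.sites
      · exact h0.rays
  · rw [hlen]
    intro q hq
    rcases hq.lt_or_eq with h1 | rfl
    · exact (b0 q (by omega)).trans_le (h0.site_le q (by omega))
    · rw [show s'.iArr 0 (a.L.length + 1) = s.iVar 2 from by rw [a0, Function.update_self]]; rfl
  · rw [hlen]
    intro q hq
    rcases hq.lt_or_eq with h1 | rfl
    · exact (b3 q (by omega)).trans_le (h0.ray_le q (by omega))
    · rw [show s'.iArr 3 (a.L.length + 1) = s.iVar 3 from by rw [a3, Function.update_self]]; rfl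
  · rw [hlen]
    intro q hq
    rcases hq.lt_or_eq with h1 | rfl
    · exact (b2 q (by omega)).trans (h0.point q (by omega))
    · rw [a2, Function.update_self]
  · rw [hlen, a0, Function.update_self]; exact slice_self _ _
  · rw [hlen, a3, Function.update_self]; exact slice_self _ _

end BlochFan

/-! ### Scans and the output of faces -/
namespace BlochFan
open RealRAM

/-- Goes through all indices `k` and keeps in the variable `7` the last one that passed the test. -/
def scanLoop (b : Test) : Prog :=
  .seq (.setIVar 6 (.const 0)) (.loop (.ilt (.var 6) (.var 0))
    (.seq (.cond b (.setIVar 7 (.var 6)) .skip) (.setIVar 6 (.add (.var 6) (.const 1)))))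

variable {n : ℕ} {p : ℕ → E3}

/-- The rule for scans: `I k c` is an invariant of the number `k` of sites seen and the candidate
`c`. -/
lemma does_scanLoop {b : Test} {a : Abs} {B : ℕ → ℕ → Prop}
    (hb : ∀ c k, Decides n p { a with cur := c, k := k } b (B c k)) (I : ℕ → ℕ → Prop)
    (h0 : I 0 a.cur)
    (hI : ∀ k < n, ∀ c, I k c → (B c k → I (k + 1) k) ∧ (¬ B c k → I (k + 1) c)) :
    Does n p (scanLoop b) a ((b.cost + 20) * (n + 1))
      (fun a' => ∃ c, I n c ∧ a' = { a with cur := c, k := n }) := by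
  refine ((does_k (x := 0) fun s h => rfl).seq_eq (does_for_const
    (fun q a' => ∃ c, I q c ∧ a' = { a with cur := c, k := q }) n (b.cost + 6) ?_ ?_
    ⟨a.cur, h0, rfl⟩)).mono ?_ fun _ h => h
  · rintro q _ ⟨c, -, rfl⟩ s h
    simp only [Test.Holds, IExpr.val, h.k_eq, h.n_eq]
  · rintro q _ ⟨c, hc, rfl⟩ hq
    have h1 : Does n p (.cond b (.setIVar 7 (.var 6)) .skip) { a with cur := c, k := q }
        (b.cost + 2) (fun a' => ∃ c', I (q + 1) c' ∧ a' = { a with cur := c', k := q }) := by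
      refine does_cond (hb c q) (fun hB => ?_) (fun hB => ?_)
      · exact (does_cur (x := q) fun s h => by exact h.k_eq).mono le_rfl
          fun _ h => ⟨q, (hI q hq c hc).1 hB, h⟩
      · exact (does_skip _).mono (by norm_num) fun _ h => ⟨c, (hI q hq c hc).2 hB, h⟩
    refine (h1.seq fun _ h2 => ?_ : Does n p _ _ ((b.cost + 2) + 4) _)
    obtain ⟨c', hc', rfl⟩ := h2
    exact (does_k (x := q + 1) fun s h => by simp only [IExpr.val, h.k_eq]).mono le_rfl
      fun _ h => ⟨c', hc', h⟩
  · simp only [IExpr.cost, Test.cost]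
    nlinarith

/-- If the test compares keys, then the scan finds an index with the least key. -/
lemma does_scanLoop_key {b : Test} {a : Abs} {B : ℕ → ℕ → Prop} {α : Type*} [LinearOrder α]
    (hb : ∀ c k, Decides n p { a with cur := c, k := k } b (B c k)) (X : ℕ → Prop) (key : ℕ → α)
    (h0 : X a.cur) (hX : ∀ c k, X c → X k → (B c k ↔ key k < key c))
    (hX' : ∀ c, X c → ∀ k < n, ¬ X k → ¬ B c k) :
    Does n p (scanLoop b) a ((b.cost + 20) * (n + 1))
      (fun a' => ∃ c, (X c ∧ ∀ k < n, ¬ B c k) ∧ a' = { a with cur := c, k := n }) := by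
  refine does_scanLoop hb (fun q c => X c ∧ ∀ k < q, ¬ B c k) ⟨h0, by simp⟩ ?_
  rintro q hq c ⟨hc, hlt⟩
  constructor
  · intro hB
    have hXq : X q := by
      by_contra hXq
      exact hX' c hc q hq hXq hB
    refine ⟨hXq, fun k hk hB' => ?_⟩
    have hXk : X k := by
      by_contra hXk
      exact hX' q hXq k (by omega) hXk hB'
    have h1 := (hX c q hc hXq).1 hB
    have h2 := (hX q k hXq hXk).1 hB'
    rcases (Nat.lt_succ_iff_lt_or_eq.1 hk) with h3 | rfl
    · exact hlt k h3 ((hX c k hc hXk).2 (h2.trans h1))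
    · exact lt_irrefl _ h2
  · intro hB
    refine ⟨hc, fun k hk => ?_⟩
    rcases (Nat.lt_succ_iff_lt_or_eq.1 hk) with h3 | rfl
    · exact hlt k h3
    · exact hB

/-- Appends several sites. -/
def emitSites : List IExpr → Prog
  | [] => .skip
  | e :: es => .seq (emitSite e) (emitSites es)

/-- Appends several rays. -/
def emitRays : List VExpr → Prog
  | [] => .skip
  | v :: vs => .seq (emitRay v) (emitRays vs)

/-- Writes a face. -/
def emitFace (es : List IExpr) (vs : List VExpr) : Prog :=
  .seq (emitSites es) (.seq (emitRays vs) closeFace)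

/-- The time to append several sites. -/
def sitesCost (es : List IExpr) : ℕ := (es.map fun e => e.cost + 6).sum + 1

/-- The time to append several rays. -/
def raysCost (vs : List VExpr) : ℕ :=
  (vs.map fun v => v.x.cost + v.y.cost + v.z.cost + 10).sum + 1

lemma does_emitSites {es : List IExpr} {xs : List ℕ} {a : Abs}
    (h : ∀ ps, List.Forall₂ (Evals n p { a with ps := ps }) es xs) :
    Does n p (emitSites es) a (sitesCost es) (· = { a with ps := a.ps ++ xs }) := by
  induction es generalizing xs a with
  | nil =>
    have h1 := h a.ps
    rw [List.forall₂_nil_left_iff] at h1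
    subst h1
    exact (does_skip a).mono (by simp [sitesCost]) fun _ h => by rw [h]; simp
  | cons e es ih =>
    obtain ⟨x, xs', h1, h2, rfl⟩ := List.forall₂_cons_left_iff.1 (h a.ps)
    refine ((does_emitSite h1).seq_eq (ih (xs := xs') fun ps => ?_)).mono ?_ ?_
    · exact (List.forall₂_cons.1 (h ps)).2
    · simp only [sitesCost, List.map_cons, List.sum_cons]; omega
    · rintro _ rfl; simp

lemma does_emitRays {vs : List VExpr} {xs : List E3} {a : Abs}
    (h : ∀ pr, List.Forall₂ (VEvals n p { a with pr := pr }) vs xs) :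
    Does n p (emitRays vs) a (raysCost vs) (· = { a with pr := a.pr ++ xs }) := by
  induction vs generalizing xs a with
  | nil =>
    have h1 := h a.pr
    rw [List.forall₂_nil_left_iff] at h1
    subst h1
    exact (does_skip a).mono (by simp [raysCost]) fun _ h => by rw [h]; simp
  | cons e es ih =>
    obtain ⟨x, xs', h1, h2, rfl⟩ := List.forall₂_cons_left_iff.1 (h a.pr)
    refine ((does_emitRay h1).seq_eq (ih (xs := xs') fun ps => ?_)).mono ?_ ?_
    · exact (List.forall₂_cons.1 (h ps)).2
    · simp only [raysCost, List.map_cons, List.sum_cons]; omega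
    · rintro _ rfl; simp

lemma does_emitFace {es : List IExpr} {vs : List VExpr} {xs : List ℕ} {ys : List E3} {a : Abs}
    (hps : a.ps = []) (hpr : a.pr = [])
    (h : ∀ ps pr, List.Forall₂ (Evals n p { a with ps := ps, pr := pr }) es xs)
    (h' : ∀ ps pr, List.Forall₂ (VEvals n p { a with ps := ps, pr := pr }) vs ys) :
    Does n p (emitFace es vs) a (sitesCost es + (raysCost vs + 20))
      (· = { a with L := a.L ++ [coneRecord xs ys] }) := by
  obtain ⟨i, t, k, cur, m, aux, A, L, ps, pr⟩ := a
  obtain rfl : ps = [] := hps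
  obtain rfl : pr = [] := hpr
  refine (does_emitSites (xs := xs) fun ps => h ps []).seq_eq
    ((does_emitRays (xs := ys) fun pr => ?_).seq_eq
    ((does_closeFace _).mono le_rfl ?_))
  · exact h' _ pr
  · rintro _ rfl; rfl

/-- Appends, in the order of their indices, the sites that pass a test. -/
def emitLoop (b : Test) : Prog :=
  .seq (.setIVar 6 (.const 0)) (.loop (.ilt (.var 6) (.var 0))
    (.seq (.cond b (emitSite (.var 6)) .skip) (.setIVar 6 (.add (.var 6) (.const 1)))))

open Classical in
lemma does_emitLoop {b : Test} {a : Abs} {B : ℕ → Prop}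
    (hb : ∀ k ps, Decides n p { a with k := k, ps := ps } b (B k)) (hps : a.ps = []) :
    Does n p (emitLoop b) a ((b.cost + 30) * (n + 1))
      (· = { a with k := n, ps := (List.range n).filter B }) := by
  obtain ⟨i, t, k, cur, m, aux, A, L, ps, pr⟩ := a
  obtain rfl : ps = [] := hps
  refine ((does_k (x := 0) fun s h => rfl).seq_eq (does_for_const
    (fun q a' => a' = ⟨i, t, q, cur, m, aux, A, L, (List.range q).filter B, pr⟩) n (b.cost + 11)
    ?_ ?_ ?_)).mono ?_ fun _ h => h
  · rintro q _ rfl s h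
    simp only [Test.Holds, IExpr.val, h.k_eq, h.n_eq]
  · rintro q _ rfl hq
    have h1 : Does n p (.cond b (emitSite (.var 6)) .skip)
        ⟨i, t, q, cur, m, aux, A, L, (List.range q).filter B, pr⟩ (b.cost + 7)
        (· = ⟨i, t, q, cur, m, aux, A, L, (List.range (q + 1)).filter B, pr⟩) := by
      refine does_cond (hb q _) (fun hB => ?_) (fun hB => ?_)
      · refine (does_emitSite (x := q) fun s h => by exact h.k_eq).mono le_rfl ?_
        rintro _ rfl
        simp [List.range_succ, hB]
      · refine (does_skip _).mono (by norm_num) ?_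
        rintro _ rfl
        simp [List.range_succ, hB]
    refine (h1.seq_eq ?_ : Does n p _ _ ((b.cost + 7) + 4) _)
    exact (does_k (x := q + 1) fun s h => by simp only [IExpr.val, h.k_eq])
  · rfl
  · simp only [IExpr.cost, Test.cost]
    nlinarith

/-- Writes the face of all sites. -/
def emitAll (vs : List VExpr) : Prog :=
  .seq (emitLoop (.ieq (.const 0) (.const 0))) (.seq (emitRays vs) closeFace)

lemma does_emitAll {vs : List VExpr} {ys : List E3} {a : Abs} (hps : a.ps = []) (hpr : a.pr = [])
    (h : ∀ k ps pr, List.Forall₂ (VEvals n p { a with k := k, ps := ps, pr := pr }) vs ys) :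
    Does n p (emitAll vs) a ((raysCost vs + 60) * (n + 1))
      (fun a' => a'.L = a.L ++ [coneRecord (List.range n) ys]) := by
  classical
  obtain ⟨i, t, k, cur, m, aux, A, L, ps, pr⟩ := a
  obtain rfl : ps = [] := hps
  obtain rfl : pr = [] := hpr
  have h1 := does_emitLoop (n := n) (p := p) (b := .ieq (.const 0) (.const 0))
    (a := ⟨i, t, k, cur, m, aux, A, L, [], []⟩) (B := fun _ => True)
    (fun k ps s h => by simp [Test.Holds]) rfl
  have h2 : Does n p (emitLoop (.ieq (.const 0) (.const 0))) ⟨i, t, k, cur, m, aux, A, L, [], []⟩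
      _ (· = ⟨i, t, n, cur, m, aux, A, L, List.range n, []⟩) :=
    h1.mono le_rfl fun _ h => h.trans (by simp)
  refine (h2.seq_eq ((does_emitRays (xs := ys) (a := ⟨i, t, n, cur, m, aux, A, L, List.range n, []⟩)
    fun pr => h _ _ pr).seq_eq ((does_closeFace _).mono le_rfl ?_))).mono ?_ fun _ h => h
  · rintro _ rfl; rfl
  · simp only [IExpr.cost, Test.cost]
    nlinarith

/-! ### Gift wrapping -/

/-- The vector from the current site to another one. -/
def diffE (e : IExpr) : VExpr := subE (siteE e) (siteE (.var 4))

/-- The test whether the site `k` comes before the current candidate in the order around an axis. -/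
def betterT (c : VExpr) : Test :=
  .neg (.both (.neg (.rlt (dotE (crossE c (diffE (.var 7))) (diffE (.var 6))) (.const 0)))
    (.neg (.both (.req (dotE (crossE c (diffE (.var 7))) (diffE (.var 6))) (.const 0))
      (.rlt (.const 0) (dotE (crossE c (diffE (.var 7)))
        (crossE (diffE (.var 7)) (diffE (.var 6))))))))

lemma decides_betterT {a : Abs} {v : VExpr} {c : E3} (hv : VEvals n p a v c) :
    Decides n p a (betterT v) (det c (p a.cur - p a.i) (p a.k - p a.i) < 0 ∨
      (det c (p a.cur - p a.i) (p a.k - p a.i) = 0 ∧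
        0 < dot (cross c (p a.cur - p a.i)) (cross (p a.cur - p a.i) (p a.k - p a.i)))) := by
  intro s h
  simp only [betterT, Test.Holds, RExpr.val, dotE_val, crossE_val, diffE, subE_val, siteE_val h,
    IExpr.val, h.cur_eq, h.k_eq, h.i_eq, hv s h, det, Int.cast_zero]
  tauto

/-- A site other than the current one. -/
def otherE : Prog :=
  .cond (.ieq (.var 4) (.const 0)) (.setIVar 7 (.const 1)) (.setIVar 7 (.const 0))

lemma does_otherE (hn : 2 ≤ n) {a : Abs} :
    Does n p otherE a 5 (fun a' => ∃ c < n, c ≠ a.i ∧ a' = { a with cur := c }) := by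
  refine (does_cond (β := a.i = 0) (T := 2) (fun s h => by
    simp only [Test.Holds, IExpr.val, h.i_eq]) (fun h => ?_) (fun h => ?_)).mono
    (by simp [Test.cost, IExpr.cost]) fun _ h => h
  · exact (does_cur (x := 1) fun s h => rfl).mono le_rfl
      fun _ h' => ⟨1, by omega, by omega, h'⟩
  · exact (does_cur (x := 0) fun s h => rfl).mono le_rfl
      fun _ h' => ⟨0, by omega, by omega, h'⟩

/-- A site other than the current one and the site `A t`. -/
def thirdE : Prog :=
  .cond (.both (.neg (.ieq (.const 0) (.var 4))) (.neg (.ieq (.const 0) (.get 4 (.var 5)))))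
    (.setIVar 7 (.const 0))
    (.cond (.both (.neg (.ieq (.const 1) (.var 4))) (.neg (.ieq (.const 1) (.get 4 (.var 5)))))
      (.setIVar 7 (.const 1)) (.setIVar 7 (.const 2)))

lemma does_thirdE (hn : 3 ≤ n) {a : Abs} :
    Does n p thirdE a 30
      (fun a' => ∃ c < n, c ≠ a.i ∧ c ≠ a.A a.t ∧ a' = { a with cur := c }) := by
  refine (does_cond (β := ¬ 0 = a.i ∧ ¬ 0 = a.A a.t) (T := 16) (fun s h => by
    simp only [Test.Holds, IExpr.val, h.i_eq, h.t_eq, h.arr_eq]) (fun h => ?_) (fun h => ?_)).mono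
    (by simp [Test.cost, IExpr.cost]) fun _ h => h
  · exact (does_cur (x := 0) fun s h => rfl).mono (by simp [IExpr.cost])
      fun _ h' => ⟨0, by omega, by omega, by omega, h'⟩
  refine (does_cond (β := ¬ 1 = a.i ∧ ¬ 1 = a.A a.t) (T := 2) (fun s h => by
    simp only [Test.Holds, IExpr.val, h.i_eq, h.t_eq, h.arr_eq]) (fun h => ?_) (fun h => ?_)).mono
    (by simp [Test.cost, IExpr.cost]) fun _ h => h
  · exact (does_cur (x := 1) fun s h => rfl).mono (by simp [IExpr.cost])
      fun _ h' => ⟨1, by omega, by omega, by omega, h'⟩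
  · exact (does_cur (x := 2) fun s h => rfl).mono (by simp [IExpr.cost])
      fun _ h' => ⟨2, by omega, by omega, by omega, h'⟩

/-- The test whether the site `k` is nearer to the current site than the candidate. -/
def nearT : Test :=
  .both (.neg (.ieq (.var 6) (.var 4)))
    (.rlt (dotE (siteE (.var 4)) (siteE (.var 7))) (dotE (siteE (.var 4)) (siteE (.var 6))))

/-- Finds the nearest site and starts the sequence `A` with it. -/
def startProg : Prog :=
  .seq otherE (.seq (scanLoop nearT)
    (.seq (.setIArr 4 (.const 0) (.var 7)) (.setIVar 5 (.const 0))))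

lemma does_startProg (hp : Sites n p) (hn : 2 ≤ n) {a : Abs} (hi : a.i < n) :
    Does n p startProg a ((nearT.cost + 40) * (n + 1))
      (fun a' => Adj n p a.i (a'.A 0) ∧
        ∃ c A, a' = { a with cur := c, k := n, A := A, t := 0 }) := by
  refine ((does_otherE hn).seq (T' := (nearT.cost + 20) * (n + 1) + (3 + 2)) fun a1 h1 => ?_).mono
    (by nlinarith) fun _ h => h
  obtain ⟨c, hc, hci, rfl⟩ := h1
  have h2 := does_scanLoop_key (n := n) (p := p) (b := nearT) (a := { a with cur := c })
    (B := fun c k => ¬ k = a.i ∧ dot (p a.i) (p c) < dot (p a.i) (p k))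
    (fun c k s h => by
      simp only [nearT, Test.Holds, dotE_val, siteE_val h, IExpr.val, h.i_eq, h.k_eq, h.cur_eq])
    (X := fun k => k < n ∧ k ≠ a.i) (key := fun k => - dot (p a.i) (p k)) ⟨hc, hci⟩
    (fun c k hc hk => by simp [hk.2])
    (fun c _ k hk hX hB => hX ⟨hk, hB.1⟩)
  refine h2.seq fun a2 h3 => ?_
  obtain ⟨c', ⟨hc', hmin⟩, rfl⟩ := h3
  refine (does_arr (q := 0) (x := c') (fun s h => rfl) (fun s h => by exact h.cur_eq)).seq_eq
    ((does_t (x := 0) (fun s h => rfl)).mono le_rfl ?_)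
  rintro _ rfl
  refine ⟨?_, c', _, rfl⟩
  show Adj n p a.i (Function.update a.A 0 c' 0)
  rw [Function.update_self]
  refine hp.adj_of_nearest hi hc'.1 hc'.2 fun k hk hki => ?_
  by_contra hcon
  exact hmin k hk ⟨hki, not_le.1 hcon⟩

/-- One step of gift wrapping: finds `A (t + 1)` and increases `t`. -/
def stepProg : Prog :=
  .seq thirdE (.seq (scanLoop (betterT (diffE (.get 4 (.var 5)))))
    (.seq (.setIArr 4 (.add (.var 5) (.const 1)) (.var 7))
      (.setIVar 5 (.add (.var 5) (.const 1)))))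

lemma does_stepProg (hp : Sites n p) (hn : 3 ≤ n) {a : Abs} (hi : a.i < n)
    (hadj : Adj n p a.i (a.A a.t)) :
    Does n p stepProg a (((betterT (diffE (.get 4 (.var 5)))).cost + 70) * (n + 1))
      (fun a' => ∃ c, Next n p a.i (a.A a.t) c ∧ ∃ q q', a' =
        { a with cur := q, k := q', A := Function.update a.A (a.t + 1) c, t := a.t + 1 }) := by
  refine ((does_thirdE hn).seq
    (T' := ((betterT (diffE (.get 4 (.var 5)))).cost + 20) * (n + 1) + (5 + 4))
    fun a1 h1 => ?_).mono (by nlinarith) fun _ h => h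
  obtain ⟨c, hc, hci, hcj, rfl⟩ := h1
  obtain ⟨key, hkey⟩ := hp.exists_key hi hadj
  have h2 := does_scanLoop_key (n := n) (p := p) (b := betterT (diffE (.get 4 (.var 5))))
    (a := { a with cur := c })
    (B := fun c k => det (p (a.A a.t) - p a.i) (p c - p a.i) (p k - p a.i) < 0 ∨
      (det (p (a.A a.t) - p a.i) (p c - p a.i) (p k - p a.i) = 0 ∧
        0 < dot (cross (p (a.A a.t) - p a.i) (p c - p a.i)) (cross (p c - p a.i) (p k - p a.i))))
    (fun c k => decides_betterT (fun s h => by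
      simp only [diffE, subE_val, siteE_val h, IExpr.val, h.i_eq, h.t_eq, h.arr_eq]))
    (X := fun k => k < n ∧ k ≠ a.i ∧ k ≠ a.A a.t) (key := key) ⟨hc, hci, hcj⟩ hkey
    (fun c _ k hk hX => by
      apply not_better_of_eq
      by_cases hki : k = a.i
      · exact Or.inl (by rw [hki, sub_self])
      · by_cases hkj : k = a.A a.t
        · exact Or.inr (by rw [hkj])
        · exact absurd ⟨hk, hki, hkj⟩ hX)
  refine h2.seq fun a2 h3 => ?_
  obtain ⟨c', ⟨hc', hmin⟩, rfl⟩ := h3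
  refine (does_arr (q := a.t + 1) (x := c') (fun s h => by simp only [IExpr.val, h.t_eq])
    (fun s h => by exact h.cur_eq)).seq_eq
    ((does_t (x := a.t + 1) (fun s h => by simp only [IExpr.val, h.t_eq])).mono le_rfl ?_)
  rintro _ rfl
  exact ⟨c', hp.next_of_scan hi hadj hc'.1 hc'.2.1 hc'.2.2 hmin, c', n, rfl⟩

/-- Runs once around the current site and stores its neighbours in `A`. -/
def marchProg : Prog :=
  .seq startProg (.seq stepProg (.seq
    (.loop (.neg (.ieq (.get 4 (.var 5)) (.get 4 (.const 0)))) stepProg)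
    (.seq (.setIVar 8 (.var 5))
      (.setIArr 4 (.add (.var 8) (.const 1)) (.get 4 (.const 1))))))

/-- The march ends within as many steps as the site has neighbours, since before its first return it
does not repeat a neighbour. -/
lemma does_marchProg (hp : Sites n p) (hn : 3 ≤ n) {a : Abs} (hi : a.i < n) :
    Does n p marchProg a
      (((betterT (diffE (.get 4 (.var 5)))).cost + nearT.cost + 300) * (n + 1) *
        (degree n p a.i + 1))
      (fun a' => IsMarch n p a.i a'.m a'.A ∧
        a'.i = a.i ∧ a'.L = a.L ∧ a'.ps = a.ps ∧ a'.pr = a.pr) := by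
  set C := (betterT (diffE (.get 4 (.var 5)))).cost with hC
  refine ((does_startProg hp (by omega) hi).seq
    (T' := ((C + 70) * (n + 1)) + (((C + 70) * (n + 1) + 6) * degree n p a.i + 6 + (2 + 6)))
    fun a1 h1 => ?_).mono ?_ fun _ h => h
  swap
  · have : 0 ≤ n * degree n p a.i := Nat.zero_le _
    generalize degree n p a.i = D at *
    have : 0 ≤ C * n * D := Nat.zero_le _
    have : 0 ≤ nearT.cost * n * D := Nat.zero_le _
    have : 0 ≤ C * D := Nat.zero_le _
    have : 0 ≤ nearT.cost * D := Nat.zero_le _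
    nlinarith
  obtain ⟨hadj, c, A, rfl⟩ := h1
  -- after `q` steps, the march has not yet returned before the step `q`
  let I : ℕ → Abs → Prop := fun q a' => 1 ≤ q ∧ a'.t = q ∧ a'.i = a.i ∧ a'.L = a.L ∧ a'.ps = a.ps ∧
    a'.pr = a.pr ∧ Adj n p a.i (a'.A 0) ∧ (∀ s < q, Next n p a.i (a'.A s) (a'.A (s + 1))) ∧
    ∀ s, 0 < s → s < q → a'.A s ≠ a'.A 0
  have hstep : Does n p stepProg { a with cur := c, k := n, A := A, t := 0 } ((C + 70) * (n + 1))
      (I 1) := by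
    refine (does_stepProg hp hn (a := { a with cur := c, k := n, A := A, t := 0 }) hi hadj).mono
      le_rfl ?_
    rintro _ ⟨c', hnext, q, q', rfl⟩
    refine ⟨le_rfl, rfl, rfl, rfl, rfl, rfl, ?_, ?_, ?_⟩
    · show Adj n p a.i (Function.update A (0 + 1) c' 0)
      rw [Function.update_of_ne (by omega)]; exact hadj
    · intro s hs
      obtain rfl : s = 0 := by omega
      show Next n p a.i (Function.update A (0 + 1) c' 0) (Function.update A (0 + 1) c' (0 + 1))
      rw [Function.update_of_ne (by omega), Function.update_self]
      exact hnext
    · intro s h1 h2; omega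
  refine hstep.seq fun a2 h2 => ?_
  have hloop := does_loop (n := n) (p := p)
    (b := .neg (.ieq (.get 4 (.var 5)) (.get 4 (.const 0)))) (P := stepProg) I
    (degree n p a.i) (fun q a' => a'.A q ≠ a'.A 0) (fun _ => (C + 70) * (n + 1)) (by
      rintro q a' ⟨h1, h2, h3, h4, h5, h6, h7, h8, h9⟩
      refine ⟨fun s h => by
        simp only [Test.Holds, IExpr.val, h.t_eq, h.arr_eq, h2, ne_eq], fun hβ => ?_⟩
      have hfirst : ∀ s, 0 < s → s ≤ q → a'.A s ≠ a'.A 0 := fun s hs hsq => by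
        rcases hsq.lt_or_eq with h | rfl
        · exact h9 s hs h
        · exact hβ
      have hq := adj_of_steps hp hi h7 h8 q le_rfl
      refine ⟨steps_le_degree hp hi h7 h8 hfirst, ?_⟩
      refine (does_stepProg hp hn (a := a') (h3.symm ▸ hi) (by rw [h3, h2]; exact hq)).mono
        le_rfl ?_
      rintro _ ⟨c', hnext, q1, q2, rfl⟩
      rw [h3, h2] at hnext
      have hupd : ∀ s ≤ q, Function.update a'.A (q + 1) c' s = a'.A s := fun s hs =>
        Function.update_of_ne (by omega) _ _
      refine ⟨by omega, by rw [← h2], h3, h4, h5, h6, ?_, ?_, ?_⟩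
      · show Adj n p a.i (Function.update a'.A (a'.t + 1) c' 0)
        rw [h2, hupd 0 (by omega)]; exact h7
      · intro s hs
        show Next n p a.i (Function.update a'.A (a'.t + 1) c' s)
          (Function.update a'.A (a'.t + 1) c' (s + 1))
        rw [h2, hupd s (by omega)]
        rcases Nat.lt_succ_iff_lt_or_eq.1 hs with h | rfl
        · rw [hupd (s + 1) (by omega)]; exact h8 s h
        · rw [Function.update_self]; exact hnext
      · intro s hs hsq
        show Function.update a'.A (a'.t + 1) c' s ≠ Function.update a'.A (a'.t + 1) c' 0
        rw [h2, hupd s (by omega), hupd 0 (by omega)]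
        exact hfirst s hs (by omega)) (q := 1) h2
  refine (hloop.mono (T' := ((C + 70) * (n + 1) + 6) * degree n p a.i + 6) ?_ fun _ h => h).seq
    fun a3 h3 => ?_
  · rw [Finset.sum_const, Nat.card_Ico, smul_eq_mul]
    simp only [Test.cost, IExpr.cost]
    have h3 := Nat.mul_le_mul_right ((C + 70) * (n + 1) + 6) (Nat.sub_le (degree n p a.i) 1)
    rw [mul_comm (degree n p a.i)] at h3
    exact Nat.add_le_add_right h3 6
  obtain ⟨q, ⟨h1, h2, h3, h4, h5, h6, h7, h8, h9⟩, h10⟩ := h3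
  push Not at h10
  refine (does_m (x := q) (fun s h => by simp only [IExpr.val, h.t_eq, h2])).seq_eq
    ((does_arr (q := q + 1) (x := a3.A 1) (fun s h => by simp only [IExpr.val, h.m_eq])
      (fun s h => by simp only [IExpr.val, h.arr_eq])).mono le_rfl ?_)
  rintro _ rfl
  have hupd : ∀ s ≤ q, Function.update a3.A (q + 1) (a3.A 1) s = a3.A s := fun s hs =>
    Function.update_of_ne (by omega) _ _
  refine ⟨?_, h3, h4, h5, h6⟩
  show IsMarch n p a.i q (Function.update a3.A (q + 1) (a3.A 1))
  refine ⟨hi, by rw [hupd 0 (by omega)]; exact h7, h1, ?_, ?_, ?_, ?_⟩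
  · intro s hs
    rw [hupd s (by omega), hupd (s + 1) (by omega)]; exact h8 s hs
  · rw [hupd q le_rfl, hupd 0 (by omega), h10]
  · rw [Function.update_self, hupd 1 h1]
  · intro s hs hsq
    rw [hupd s (by omega), hupd 0 (by omega)]; exact h9 s hs hsq

end BlochFan

/-! ### The program for sites not in a plane -/
namespace BlochFan
open RealRAM

variable {n : ℕ} {p : ℕ → E3}

/-- Runs the program `P` for `t = 0, …, m - 1`. -/
def forT (P : Prog) : Prog :=
  .seq (.setIVar 5 (.const 0)) (.loop (.ilt (.var 5) (.var 8))
    (.seq P (.setIVar 5 (.add (.var 5) (.const 1)))))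

/-- The rule for `forT`: the program may change everything but `t` and `m`. -/
lemma does_forT {P : Prog} {a : Abs} (J : ℕ → Abs → Prop) (B : ℕ)
    (hJ : ∀ q a', J q a' → a'.t = q ∧ a'.m = a.m)
    (hP : ∀ q a', J q a' → q < a.m →
      Does n p P a' B (fun a'' => a''.t = q ∧ J (q + 1) { a'' with t := q + 1 }))
    (h0 : J 0 { a with t := 0 }) :
    Does n p (forT P) a ((B + 10) * (a.m + 1)) (J a.m) := by
  refine ((does_t (x := 0) fun s h => rfl).seq_eq (does_for_const J a.m (B + 4) ?_ ?_ h0)).mono ?_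
    fun _ h => h
  · intro q a' h' s h
    obtain ⟨h1, h2⟩ := hJ q a' h'
    simp only [Test.Holds, IExpr.val, h.t_eq, h.m_eq, h1, h2]
  · intro q a' h' hq
    refine ((hP q a' h' hq).seq fun a'' h2 => ?_ : Does n p _ _ (B + 4) _)
    exact (does_t (x := q + 1) fun s h => by simp only [IExpr.val, h.t_eq, h2.1]).mono le_rfl
      fun _ h => h ▸ h2.2
  · simp only [IExpr.cost, Test.cost]
    nlinarith

/-- The normal of the facet through `A t`, the current site and `A (t + 1)`. -/
def rayE : VExpr :=
  crossE (diffE (.get 4 (.add (.var 5) (.const 1)))) (diffE (.get 4 (.var 5)))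

/-- The normal of the facet after that of `rayE`. -/
def rayE' : VExpr :=
  crossE (diffE (.get 4 (.add (.var 5) (.const 2)))) (diffE (.get 4 (.add (.var 5) (.const 1))))

lemma vevals_diffE {a : Abs} {e : IExpr} {x : ℕ} (he : Evals n p a e x) :
    VEvals n p a (diffE e) (p x - p a.i) := fun s h => by
  simp only [diffE, subE_val, siteE_val h, he s h, IExpr.val, h.i_eq]

lemma vevals_crossE {a : Abs} {v w : VExpr} {x y : E3} (hv : VEvals n p a v x)
    (hw : VEvals n p a w y) : VEvals n p a (crossE v w) (cross x y) := fun s h => by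
  rw [crossE_val, hv s h, hw s h]

lemma vevals_rayE (a : Abs) : VEvals n p a rayE (ray p a.i a.A a.t) :=
  vevals_crossE (vevals_diffE fun s h => by simp only [IExpr.val, h.arr_eq, h.t_eq])
    (vevals_diffE fun s h => by simp only [IExpr.val, h.arr_eq, h.t_eq])

lemma vevals_rayE' (a : Abs) : VEvals n p a rayE' (ray p a.i a.A (a.t + 1)) :=
  vevals_crossE (vevals_diffE fun s h => by simp only [IExpr.val, h.arr_eq, h.t_eq])
    (vevals_diffE fun s h => by simp only [IExpr.val, h.arr_eq, h.t_eq])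

/-- Writes the cell of the current site. -/
def emitCell : Prog := .seq (emitSite (.var 4)) (.seq (forT (emitRay rayE)) closeFace)

/-- The time to compute and write a normal of a facet. -/
def rayCost : ℕ := rayE.x.cost + rayE.y.cost + rayE.z.cost + 10

lemma does_emitCell {a : Abs} (hps : a.ps = []) (hpr : a.pr = []) :
    Does n p emitCell a ((rayCost + 50) * (a.m + 1))
      (· = { a with t := a.m, L := a.L ++ [cellRecord p a.i a.m a.A] }) := by
  obtain ⟨i, t, k, cur, m, aux, A, L, ps, pr⟩ := a
  obtain rfl : ps = [] := hps
  obtain rfl : pr = [] := hpr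
  have h1 : Does n p (forT (emitRay rayE)) ⟨i, t, k, cur, m, aux, A, L, [i], []⟩ _
      (· = ⟨i, m, k, cur, m, aux, A, L, [i], (List.range m).map (ray p i A)⟩) :=
    does_forT
      (fun q a' => a' = ⟨i, q, k, cur, m, aux, A, L, [i], (List.range q).map (ray p i A)⟩) rayCost
      (by rintro q _ rfl; exact ⟨rfl, rfl⟩) (by
        rintro q _ rfl -
        refine (does_emitRay (vevals_rayE _)).mono le_rfl ?_
        rintro _ rfl
        simp [List.range_succ]) rfl
  refine ((does_emitSite (x := i) fun s h => by exact h.i_eq).seq_eq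
    (h1.seq_eq ((does_closeFace _).mono le_rfl ?_))).mono ?_ fun _ h => h
  · rintro _ rfl; rfl
  · simp only [IExpr.cost]
    nlinarith

/-- Writes the edge to `A (t + 1)`, if this is the later site. -/
def emitEdge : Prog :=
  .cond (.ilt (.var 4) (.get 4 (.add (.var 5) (.const 1))))
    (emitFace [.var 4, .get 4 (.add (.var 5) (.const 1))] [rayE, rayE']) .skip

/-- The time to write an edge. -/
def edgeCost : ℕ :=
  6 + (sitesCost [.var 4, .get 4 (.add (.var 5) (.const 1))] + (raysCost [rayE, rayE'] + 20))

lemma does_emitEdges {a : Abs} (hps : a.ps = []) (hpr : a.pr = []) :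
    Does n p (forT emitEdge) a ((edgeCost + 10) * (a.m + 1))
      (· = ⟨a.i, a.m, a.k, a.cur, a.m, a.aux, a.A, a.L ++ (List.range a.m).flatMap
        fun t => if a.i < a.A (t + 1) then [edgeRecord p a.i a.A t] else [], a.ps, a.pr⟩) := by
  obtain ⟨i, t, k, cur, m, aux, A, L, ps, pr⟩ := a
  obtain rfl : ps = [] := hps
  obtain rfl : pr = [] := hpr
  refine does_forT (fun q a' => a' = ⟨i, q, k, cur, m, aux, A, L ++ (List.range q).flatMap
    fun t => if i < A (t + 1) then [edgeRecord p i A t] else [], [], []⟩) edgeCost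
    (by rintro q _ rfl; exact ⟨rfl, rfl⟩) ?_ (by simp)
  rintro q _ rfl -
  have hc : edgeCost = (Test.ilt (.var 4) (.get 4 (.add (.var 5) (.const 1)))).cost +
      (sitesCost [.var 4, .get 4 (.add (.var 5) (.const 1))] + (raysCost [rayE, rayE'] + 20)) := rfl
  rw [hc]
  refine does_cond (β := i < A (q + 1)) (fun s h => by
    simp only [Test.Holds, IExpr.val, h.i_eq, h.t_eq, h.arr_eq]) (fun h => ?_) (fun h => ?_)
  · refine (does_emitFace (xs := [i, A (q + 1)]) (ys := [ray p i A q, ray p i A (q + 1)])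
      rfl rfl (fun ps pr => ?_) (fun ps pr => ?_)).mono le_rfl ?_
    · refine .cons (fun s h => by exact h.i_eq) (.cons (fun s h => ?_) .nil)
      simp only [IExpr.val, h.arr_eq, h.t_eq]
    · exact .cons (vevals_rayE _) (.cons (vevals_rayE' _) .nil)
    · rintro _ rfl
      simp [List.range_succ, h, edgeRecord]
  · refine (does_skip _).mono (by omega) ?_
    rintro _ rfl
    simp [List.range_succ, h]

/-- The test whether the site `k` lies in the plane of the facet. -/
def inFacetT : Test := .req (dotE rayE (diffE (.var 6))) (.const 0)

lemma decides_inFacetT (a : Abs) :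
    Decides n p a inFacetT (dot (ray p a.i a.A a.t) (p a.k - p a.i) = 0) := fun s h => by
  simp only [inFacetT, Test.Holds, RExpr.val, dotE_val, vevals_rayE a s h, diffE, subE_val,
    siteE_val h, IExpr.val, h.k_eq, h.i_eq, Int.cast_zero]

/-- Writes the facet through `A t` and `A (t + 1)`, unless it has a site before the current one. -/
def emitFacet : Prog :=
  .seq (.setIVar 7 (.var 0)) (.seq (scanLoop (.both (.ilt (.var 6) (.var 4)) inFacetT))
    (.cond (.ieq (.var 7) (.var 0)) (.seq (emitLoop inFacetT) (.seq (emitRay rayE) closeFace))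
      .skip))

/-- A bound for the time to write a facet, per site. -/
def facetCost : ℕ := 2 * inFacetT.cost + rayCost + 100

open Classical in
lemma does_emitFacet {a : Abs} (hi : a.i < n) (hps : a.ps = []) (hpr : a.pr = []) :
    Does n p emitFacet a (facetCost * (n + 1)) (fun a' => ∃ k c, a' =
      ⟨a.i, a.t, k, c, a.m, a.aux, a.A,
        a.L ++ (if ∀ k < a.i, dot (ray p a.i a.A a.t) (p k - p a.i) ≠ 0 then
          [facetRecord n p a.i a.A a.t] else []), [], []⟩) := by
  obtain ⟨i, q, k, cur, m, aux, A, L, ps, pr⟩ := a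
  obtain rfl : ps = [] := hps
  obtain rfl : pr = [] := hpr
  -- the candidate is still `n` after the scan if no site before `i` lies in the plane
  have hscan := does_scanLoop (n := n) (p := p)
    (b := .both (.ilt (.var 6) (.var 4)) inFacetT) (a := ⟨i, q, k, n, m, aux, A, L, [], []⟩)
    (B := fun _ k => k < i ∧ dot (ray p i A q) (p k - p i) = 0)
    (fun c k s h => by
      have h1 := decides_inFacetT _ s h
      simp only [Test.Holds, IExpr.val, h.k_eq, h.i_eq, h1])
    (fun q' c => c = n ↔ ∀ k < q', ¬ (k < i ∧ dot (ray p i A q) (p k - p i) = 0))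
    (by simp) (fun k hk c hc => ⟨fun hB => ⟨fun h => absurd h hk.ne,
      fun h => absurd hB (h k (Nat.lt_succ_self k))⟩, fun hB => hc.trans
        ⟨fun h l hl => (Nat.lt_succ_iff_lt_or_eq.1 hl).elim (h l) fun e => e ▸ hB,
          fun h l hl => h l (hl.trans (Nat.lt_succ_self k))⟩⟩)
  refine ((does_cur (x := n) fun s h => by exact h.n_eq).seq_eq (hscan.seq
    (T' := 3 + ((inFacetT.cost + 30) * (n + 1) + (rayCost + 20))) fun a1 h1 => ?_)).mono ?_
    fun _ h => h
  swap
  · simp only [facetCost, IExpr.cost, Test.cost]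
    nlinarith
  obtain ⟨c, hc, rfl⟩ := h1
  refine does_cond (b := .ieq (.var 7) (.var 0))
    (β := ∀ k < i, dot (ray p i A q) (p k - p i) ≠ 0) (fun s h => ?_) (fun h => ?_) (fun h => ?_)
  · simp only [Test.Holds, IExpr.val, h.cur_eq, h.n_eq, hc]
    exact ⟨fun h k hk h0 => h k (hk.trans hi) ⟨hk, h0⟩, fun h k _ h1 => h k h1.1 h1.2⟩
  · have h1 : Does n p (emitLoop inFacetT) ⟨i, q, n, c, m, aux, A, L, [], []⟩
        ((inFacetT.cost + 30) * (n + 1)) (· = ⟨i, q, n, c, m, aux, A, L,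
          (List.range n).filter (fun k => dot (ray p i A q) (p k - p i) = 0), []⟩) :=
      does_emitLoop (B := fun k => dot (ray p i A q) (p k - p i) = 0)
        (fun k ps => decides_inFacetT _) rfl
    have h2 : Does n p (emitRay rayE) ⟨i, q, n, c, m, aux, A, L,
          (List.range n).filter (fun k => dot (ray p i A q) (p k - p i) = 0), []⟩ rayCost
        (· = ⟨i, q, n, c, m, aux, A, L, (List.range n).filter
          (fun k => dot (ray p i A q) (p k - p i) = 0), [ray p i A q]⟩) :=
      does_emitRay (vevals_rayE _)
    refine h1.seq_eq (h2.seq_eq ((does_closeFace _).mono le_rfl ?_))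
    rintro _ rfl
    refine ⟨n, c, ?_⟩
    simp only [if_pos h]
    rfl
  · refine (does_skip _).mono (by nlinarith) ?_
    rintro _ rfl
    refine ⟨n, c, ?_⟩
    simp only [if_neg h, List.append_nil]

open Classical in
lemma does_emitFacets {a : Abs} (hi : a.i < n) (hps : a.ps = []) (hpr : a.pr = []) :
    Does n p (forT emitFacet) a ((facetCost * (n + 1) + 10) * (a.m + 1))
      (fun a' => a'.i = a.i ∧ a'.ps = [] ∧ a'.pr = [] ∧ a'.L = a.L ++ (List.range a.m).flatMap
        fun t => if ∀ k < a.i, dot (ray p a.i a.A t) (p k - p a.i) ≠ 0 then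
          [facetRecord n p a.i a.A t] else []) := by
  obtain ⟨i, t, k, cur, m, aux, A, L, ps, pr⟩ := a
  obtain rfl : ps = [] := hps
  obtain rfl : pr = [] := hpr
  refine (does_forT (fun q a' => ∃ k c, a' = ⟨i, q, k, c, m, aux, A, L ++ (List.range q).flatMap
    fun t => if ∀ k < i, dot (ray p i A t) (p k - p i) ≠ 0 then [facetRecord n p i A t] else [],
      [], []⟩) (facetCost * (n + 1))
    (by rintro q _ ⟨k, c, rfl⟩; exact ⟨rfl, rfl⟩) ?_ ⟨k, cur, by simp⟩).mono le_rfl ?_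
  · rintro q _ ⟨k, c, rfl⟩ -
    refine (does_emitFacet (a := ⟨i, q, k, c, m, aux, A, _, [], []⟩) hi rfl rfl).mono le_rfl ?_
    rintro _ ⟨k, c, rfl⟩
    refine ⟨rfl, k, c, ?_⟩
    simp only [List.range_succ, List.flatMap_append, List.flatMap_singleton, List.append_assoc]
  · rintro _ ⟨k, c, rfl⟩; exact ⟨rfl, rfl, rfl, rfl⟩

/-- Writes the faces whose least site is the current one, for sites not in a plane. -/
def marchLocal : Prog :=
  .seq marchProg (.seq emitCell (.seq (forT emitEdge) (forT emitFacet)))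

/-- A bound for the time to treat a site, per site and neighbour. -/
def marchCost : ℕ :=
  ((betterT (diffE (.get 4 (.var 5)))).cost + nearT.cost + 300) + (rayCost + 50) + (edgeCost + 10)
    + (facetCost + 10)

lemma IsMarch.le_degree {i m : ℕ} {A : ℕ → ℕ} (h : IsMarch n p i m A) (hp : Sites n p) :
    m ≤ degree n p i := by
  have := h.pos
  have := steps_le_degree hp (m := m - 1) h.lt h.start (fun t ht => h.step t (by omega))
    fun t h1 h2 => h.first t h1 (by omega)
  omega

/-- Summary of the costs of the four parts of `marchLocal`, for a site with `d` neighbours. -/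
lemma marchCost_bound {d : ℕ} (h : d + 1 ≤ (n + 1) * (d + 1)) :
    ((betterT (diffE (.get 4 (.var 5)))).cost + nearT.cost + 300) * (n + 1) * (d + 1) +
      ((rayCost + 50) * (d + 1) + ((edgeCost + 10) * (d + 1) +
        (facetCost * (n + 1) + 10) * (d + 1))) ≤ marchCost * ((n + 1) * (d + 1)) := by
  unfold marchCost
  generalize (betterT (diffE (.get 4 (.var 5)))).cost = c0
  generalize nearT.cost = c1
  generalize rayCost = c2
  generalize edgeCost = c3
  generalize facetCost = c4
  nlinarith [Nat.mul_le_mul_left c2 h, Nat.mul_le_mul_left c3 h]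

lemma does_marchLocal (hp : Sites n p) (hn : 3 ≤ n) (hs : Spatial n p) {a : Abs} (hi : a.i < n)
    (hps : a.ps = []) (hpr : a.pr = []) :
    Does n p marchLocal a (marchCost * ((n + 1) * (degree n p a.i + 1))) (fun a' =>
      ∃ M, IsLocal n p a.i M ∧ a'.i = a.i ∧ a'.L = a.L ++ M ∧ a'.ps = [] ∧ a'.pr = []) := by
  set d := degree n p a.i with hd
  refine ((does_marchProg hp hn hi).seq (T' := (rayCost + 50) * (d + 1) +
    ((edgeCost + 10) * (d + 1) + (facetCost * (n + 1) + 10) * (d + 1))) fun a1 h1 => ?_).mono ?_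
    fun _ h => h
  swap
  · have : d + 1 ≤ (n + 1) * (d + 1) := Nat.le_mul_of_pos_left _ (by omega)
    exact marchCost_bound this
  obtain ⟨hm, h2, h3, h4, h5⟩ := h1
  rw [← h2] at hm hi
  have hmd : a1.m + 1 ≤ d + 1 := by
    have := hm.le_degree hp
    rw [h2] at this
    omega
  obtain ⟨i, t, k, cur, m, aux, A, L, ps, pr⟩ := a1
  obtain rfl : ps = [] := h4.trans hps
  obtain rfl : pr = [] := h5.trans hpr
  refine ((does_emitCell rfl rfl).mono (by gcongr) fun _ h => h).seq_eq
    (((does_emitEdges (a := ⟨i, m, k, cur, m, aux, A, _, [], []⟩) rfl rfl).mono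
      (by gcongr) fun _ h => h).seq_eq
        ((does_emitFacets (a := ⟨i, m, k, cur, m, aux, A, _, [], []⟩) hi rfl rfl).mono
          (by gcongr) ?_))
  obtain rfl : i = a.i := h2
  obtain rfl : L = a.L := h3
  rintro a' ⟨h6, h7, h8, h9⟩
  refine ⟨_, hm.isLocal hp hs, h6, ?_, h7, h8⟩
  rw [h9]
  simp only [marchRecords, List.append_assoc, List.cons_append, List.nil_append]

/-- Runs the program `P` for all sites. -/
def allSites (P : Prog) : Prog :=
  .seq (.setIVar 4 (.const 0)) (.loop (.ilt (.var 4) (.var 0))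
    (.seq P (.setIVar 4 (.add (.var 4) (.const 1)))))

/-- If `P` appends the faces whose least site is the current one, then `allSites P` appends all
faces but that of all sites. -/
lemma does_allSites {P : Prog} (B : ℕ → ℕ) (hP : ∀ a : Abs, a.i < n → a.ps = [] → a.pr = [] →
      Does n p P a (B a.i) (fun a' =>
        ∃ M, IsLocal n p a.i M ∧ a'.i = a.i ∧ a'.L = a.L ++ M ∧ a'.ps = [] ∧ a'.pr = []))
    {a : Abs} (hL : a.L = []) (hps : a.ps = []) (hpr : a.pr = []) :
    Does n p (allSites P) a (∑ i ∈ Finset.range n, B i + 10 * (n + 1)) (fun a' =>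
      ∃ Ls : ℕ → List FaceRecord, (∀ i < n, IsLocal n p i (Ls i)) ∧
        a'.L = (List.range n).flatMap Ls ∧ a'.ps = [] ∧ a'.pr = []) := by
  refine ((does_i (x := 0) fun s h => rfl).seq_eq (does_for (fun q a' => a'.i = q ∧
    ∃ Ls : ℕ → List FaceRecord, (∀ i < q, IsLocal n p i (Ls i)) ∧
      a'.L = (List.range q).flatMap Ls ∧ a'.ps = [] ∧ a'.pr = []) n (fun i => B i + 4) ?_ ?_
      ⟨rfl, fun _ => [], by simp, by simpa using hL, hps, hpr⟩)).mono ?_ fun _ h => h.2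
  · intro q a' h' s h
    simp only [Test.Holds, IExpr.val, h.i_eq, h.n_eq, h'.1]
  · rintro q a' ⟨rfl, Ls, h1, h2, h3, h4⟩ hq
    refine ((hP a' hq h3 h4).seq fun a'' h5 => ?_ : Does n p _ _ (B a'.i + 4) _)
    obtain ⟨M, hM, h6, h7, h8, h9⟩ := h5
    refine (does_i (x := a'.i + 1) fun s h => by simp only [IExpr.val, h.i_eq, h6]).mono le_rfl ?_
    rintro _ rfl
    refine ⟨rfl, Function.update Ls a'.i M, fun i hi => ?_, ?_, h8, h9⟩
    · rcases Nat.lt_succ_iff_lt_or_eq.1 hi with h | rfl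
      · rw [Function.update_of_ne h.ne]; exact h1 i h
      · rw [Function.update_self]; exact hM
    · show a''.L = _
      rw [h7, h2, List.range_succ, List.flatMap_append, List.flatMap_singleton,
        Function.update_self]
      congr 1
      refine List.flatMap_congr fun i hi => ?_
      rw [Function.update_of_ne (List.mem_range.1 hi).ne]
  · simp only [Finset.sum_add_distrib, Finset.sum_const, Finset.card_range, smul_eq_mul,
      IExpr.cost, Test.cost]
    omega

end BlochFan

/-! ### The program for sites in a plane -/
namespace BlochFan
open RealRAM

variable {n : ℕ} {p : ℕ → E3}

/-- An expression for `normal`. -/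
def normalE : VExpr :=
  crossE (subE (siteE (.const 1)) (siteE (.const 0))) (subE (siteE (.const 2)) (siteE (.const 0)))

/-- The opposite of `normalE`. -/
def normalE' : VExpr :=
  crossE (subE (siteE (.const 2)) (siteE (.const 0))) (subE (siteE (.const 1)) (siteE (.const 0)))

/-- The normal of the plane through the first three sites. -/
def normal (p : ℕ → E3) : E3 := cross (p 1 - p 0) (p 2 - p 0)

lemma vevals_subE {a : Abs} {e f : IExpr} {x y : ℕ} (he : Evals n p a e x)
    (hf : Evals n p a f y) : VEvals n p a (subE (siteE e) (siteE f)) (p x - p y) := fun s h => by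
  rw [subE_val, siteE_val h, siteE_val h, he s h, hf s h]

lemma vevals_normalE (a : Abs) : VEvals n p a normalE (normal p) :=
  vevals_crossE (vevals_subE (fun _ _ => rfl) fun _ _ => rfl)
    (vevals_subE (fun _ _ => rfl) fun _ _ => rfl)

lemma vevals_normalE' (a : Abs) : VEvals n p a normalE' (- normal p) := by
  rw [normal, ← cross_swap]
  exact vevals_crossE (vevals_subE (fun _ _ => rfl) fun _ _ => rfl)
    (vevals_subE (fun _ _ => rfl) fun _ _ => rfl)

/-- Around the normal of the plane of all sites, the other sites span less than a half turn, as seen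
from one of them; so they are linearly ordered. -/
lemma Planar.exists_key {w c : E3} (hw : Planar n p w) (hp : Sites n p) (hc : c = w ∨ c = -w)
    {i : ℕ} (hi : i < n) : ∃ key : ℕ → ℝ ×ₗ ℝ, ∀ k l, (k < n ∧ k ≠ i) → (l < n ∧ l ≠ i) →
      ((det c (p k - p i) (p l - p i) < 0 ∨ (det c (p k - p i) (p l - p i) = 0 ∧
        0 < dot (cross c (p k - p i)) (cross (p k - p i) (p l - p i)))) ↔ key l < key k) := by
  have hww := dot_self_pos hw.1
  -- the inner direction at the vertex `p i`, within the plane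
  refine exists_scan_key (c := c) (u := - p i + (dot w (p i) / dot w w) • w) (e := c)
    (x := fun k => p k - p i) (X := fun k => k < n ∧ k ≠ i) ?_ ?_ ?_
  · have : dot (- p i + (dot w (p i) / dot w w) • w) w = 0 := by
      rw [dot_add_left, dot_neg_left, dot_smul_left, div_mul_cancel₀ _ hww.ne', dot_comm]
      ring
    rcases hc with rfl | rfl
    · exact this
    · rw [dot_neg_right, this, neg_zero]
  · rintro k ⟨hk, hki⟩
    rw [dot_add_left, dot_neg_left, dot_smul_left, hw.2 i hi k hk, mul_zero, add_zero]
    have := hp.dot_diff_neg hi hk hki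
    linarith
  · rcases hc with rfl | rfl
    · exact hww
    · simpa using hww

/-- Finds the neighbour of the current vertex of a polygon to one side, given by the sense of the
normal. -/
def turnScan (v : VExpr) : Prog := .seq otherE (scanLoop (betterT v))

lemma does_turnScan {v : VExpr} {c w : E3} (hv : ∀ a, VEvals n p a v c) (hw : Planar n p w)
    (hp : Sites n p) (hn : 2 ≤ n) (hc : c = w ∨ c = -w) {a : Abs} (hi : a.i < n) :
    Does n p (turnScan v) a (((betterT v).cost + 25) * (n + 1)) (fun a' => ∃ l,
      l < n ∧ l ≠ a.i ∧ (∀ k < n, 0 ≤ det c (p l - p a.i) (p k - p a.i)) ∧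
        a' = { a with cur := l, k := n }) := by
  refine ((does_otherE hn).seq (T' := ((betterT v).cost + 20) * (n + 1)) fun a1 h1 => ?_).mono
    (by nlinarith) fun _ h => h
  obtain ⟨l, hl, hli, rfl⟩ := h1
  obtain ⟨key, hkey⟩ := hw.exists_key hp hc hi
  refine (does_scanLoop_key (a := { a with cur := l }) (B := fun l k =>
    det c (p l - p a.i) (p k - p a.i) < 0 ∨ (det c (p l - p a.i) (p k - p a.i) = 0 ∧
        0 < dot (cross c (p l - p a.i)) (cross (p l - p a.i) (p k - p a.i))))
    (fun l k => decides_betterT (hv _)) (X := fun k => k < n ∧ k ≠ a.i) (key := key) ⟨hl, hli⟩ hkey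
    (fun l _ k hk hX => by
      have hki : k = a.i := by
        by_contra hki
        exact hX ⟨hk, hki⟩
      exact not_better_of_eq (Or.inl (by rw [hki, sub_self])))).mono le_rfl ?_
  rintro _ ⟨l, ⟨⟨h1, h2⟩, h3⟩, rfl⟩
  refine ⟨l, h1, h2, fun k hk => ?_, rfl⟩
  by_contra hcon
  exact h3 k hk (Or.inl (not_le.1 hcon))

/-- The face of the current vertex of a polygon. -/
def emitTurnCell : Prog := emitFace [.var 4]
  [normalE, normalE', crossE (diffE (.var 9)) normalE, crossE normalE (diffE (.var 7))]

/-- The edge to the following vertex of the polygon. -/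
def emitTurnLeft : Prog := .cond (.ilt (.var 4) (.var 9))
  (emitFace [.var 4, .var 9] [normalE, normalE', crossE (diffE (.var 9)) normalE]) .skip

/-- The edge to the preceding vertex of the polygon. -/
def emitTurnRight : Prog := .cond (.ilt (.var 4) (.var 7))
  (emitFace [.var 4, .var 7] [normalE, normalE', crossE normalE (diffE (.var 7))]) .skip

/-- Writes the faces whose least site is the current one, for sites in a plane. -/
def turnLocal : Prog :=
  .seq (turnScan normalE) (.seq (.setIVar 9 (.var 7)) (.seq (turnScan normalE')
    (.seq emitTurnCell (.seq emitTurnLeft emitTurnRight))))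

lemma exists_does_turnLocal : ∃ C, ∀ (n : ℕ) (p : ℕ → E3), Sites n p → 3 ≤ n →
    Planar n p (normal p) → ∀ a : Abs, a.i < n → a.ps = [] → a.pr = [] →
    Does n p turnLocal a (C * (n + 1)) (fun a' =>
      ∃ M, IsLocal n p a.i M ∧ a'.i = a.i ∧ a'.L = a.L ++ M ∧ a'.ps = [] ∧ a'.pr = []) := by
  obtain ⟨c1, hc1⟩ : ∃ c, c = (betterT normalE).cost := ⟨_, rfl⟩
  obtain ⟨c2, hc2⟩ : ∃ c, c = (betterT normalE').cost := ⟨_, rfl⟩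
  obtain ⟨c3, hc3⟩ : ∃ c, c = sitesCost [.var 4] + (raysCost [normalE, normalE',
    crossE (diffE (.var 9)) normalE, crossE normalE (diffE (.var 7))] + 20) := ⟨_, rfl⟩
  obtain ⟨c4, hc4⟩ : ∃ c, c = sitesCost [.var 4, .var 9] +
    (raysCost [normalE, normalE', crossE (diffE (.var 9)) normalE] + 20) := ⟨_, rfl⟩
  obtain ⟨c5, hc5⟩ : ∃ c, c = sitesCost [.var 4, .var 7] +
    (raysCost [normalE, normalE', crossE normalE (diffE (.var 7))] + 20) := ⟨_, rfl⟩
  refine ⟨c1 + c2 + c3 + c4 + c5 + 100, ?_⟩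
  rintro n p hp hn hw ⟨i, t, k, cur, m, aux, A, L, ps, pr⟩ hi hps hpr
  obtain rfl : ps = [] := hps
  obtain rfl : pr = [] := hpr
  refine ((does_turnScan vevals_normalE hw hp (by omega) (Or.inl rfl) hi).seq
    (T' := 2 + ((c2 + 25) * (n + 1) + (c3 + ((3 + c4) + (3 + c5))))) fun a1 h1 => ?_).mono ?_
    fun _ h => h
  swap
  · rw [← hc1]
    nlinarith
  obtain ⟨j, hj, hji, hleft, rfl⟩ := h1
  refine (does_aux (x := j) fun s h => by exact h.cur_eq).seq_eq ?_
  rw [hc2]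
  refine (does_turnScan (a := ⟨i, t, n, j, m, j, A, L, [], []⟩) vevals_normalE' hw hp (by omega)
    (Or.inr rfl) hi).seq fun a1 h1 => ?_
  obtain ⟨l, hl, hli, hright, rfl⟩ := h1
  have hturn : IsTurn n p (normal p) i j l := by
    refine ⟨hi, hj, hl, hji, hli, hleft, fun k hk => ?_⟩
    have h1 := hright k hk
    have h2 : det (-normal p) (p l - p i) (p k - p i) = det (normal p) (p k - p i) (p l - p i) := by
      simp only [det, dot, cross_zero, cross_one, cross_two, PiLp.neg_apply]; ring
    rwa [h2] at h1
  have e1 : Does n p emitTurnCell ⟨i, t, n, l, m, j, A, L, [], []⟩ c3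
      (· = ⟨i, t, n, l, m, j, A, L ++ [turnCell p (normal p) i j l], [], []⟩) := by
    rw [hc3]
    refine does_emitFace (xs := [i]) (ys := [normal p, -normal p, cross (p j - p i) (normal p),
      cross (normal p) (p l - p i)]) rfl rfl (fun ps pr => ?_) (fun ps pr => ?_)
    · exact .cons (fun s h => by exact h.i_eq) .nil
    · exact .cons (vevals_normalE _) (.cons (vevals_normalE' _) (.cons (vevals_crossE
        (vevals_diffE fun s h => by exact h.aux_eq) (vevals_normalE _)) (.cons (vevals_crossE
        (vevals_normalE _) (vevals_diffE fun s h => by exact h.cur_eq)) .nil)))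
  have e2 : ∀ L, Does n p emitTurnLeft ⟨i, t, n, l, m, j, A, L, [], []⟩ (3 + c4)
      (· = ⟨i, t, n, l, m, j, A, L ++ (if i < j then [turnLeft p (normal p) i j] else []),
        [], []⟩) := by
    intro L
    rw [hc4]
    refine does_cond (b := .ilt (.var 4) (.var 9)) (β := i < j) (fun s h => by
      simp only [Test.Holds, IExpr.val, h.i_eq, h.aux_eq]) (fun h => ?_) (fun h => ?_)
    · rw [if_pos h]
      refine does_emitFace (xs := [i, j]) (ys := [normal p, -normal p,
        cross (p j - p i) (normal p)]) rfl rfl (fun ps pr => ?_) (fun ps pr => ?_)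
      · exact .cons (fun s h => by exact h.i_eq) (.cons (fun s h => by exact h.aux_eq) .nil)
      · exact .cons (vevals_normalE _) (.cons (vevals_normalE' _) (.cons (vevals_crossE
          (vevals_diffE fun s h => by exact h.aux_eq) (vevals_normalE _)) .nil))
    · rw [if_neg h, List.append_nil]
      exact (does_skip _).mono (by omega) fun _ h => h
  have e3 : ∀ L, Does n p emitTurnRight ⟨i, t, n, l, m, j, A, L, [], []⟩ (3 + c5)
      (· = ⟨i, t, n, l, m, j, A, L ++ (if i < l then [turnRight p (normal p) i l] else []),
        [], []⟩) := by
    intro L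
    rw [hc5]
    refine does_cond (b := .ilt (.var 4) (.var 7)) (β := i < l) (fun s h => by
      simp only [Test.Holds, IExpr.val, h.i_eq, h.cur_eq]) (fun h => ?_) (fun h => ?_)
    · rw [if_pos h]
      refine does_emitFace (xs := [i, l]) (ys := [normal p, -normal p,
        cross (normal p) (p l - p i)]) rfl rfl (fun ps pr => ?_) (fun ps pr => ?_)
      · exact .cons (fun s h => by exact h.i_eq) (.cons (fun s h => by exact h.cur_eq) .nil)
      · exact .cons (vevals_normalE _) (.cons (vevals_normalE' _) (.cons (vevals_crossE
          (vevals_normalE _) (vevals_diffE fun s h => by exact h.cur_eq)) .nil))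
    · rw [if_neg h, List.append_nil]
      exact (does_skip _).mono (by omega) fun _ h => h
  refine e1.seq_eq ((e2 _).seq_eq ((e3 _).mono le_rfl ?_))
  rintro _ rfl
  refine ⟨_, hturn.isLocal hw hp hn, rfl, ?_, rfl, rfl⟩
  simp only [turnRecords, List.append_assoc, List.cons_append, List.nil_append]

/-- Searches for a site outside the plane of the first three: the variable `7` remains `n` if there
is none. -/
def planeScan : Prog :=
  .seq (.setIVar 7 (.var 0)) (scanLoop (.neg (.req
    (dotE normalE (subE (siteE (.var 6)) (siteE (.const 0)))) (.const 0))))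

lemma exists_does_planeScan : ∃ C, ∀ (n : ℕ) (p : ℕ → E3) (a : Abs),
    Does n p planeScan a (C * (n + 1)) (fun a' => ∃ c,
      (c = n ↔ ∀ k < n, dot (normal p) (p k - p 0) = 0) ∧ a' = { a with cur := c, k := n }) := by
  obtain ⟨b, hb⟩ : ∃ b : Test, b = .neg (.req
    (dotE normalE (subE (siteE (.var 6)) (siteE (.const 0)))) (.const 0)) := ⟨_, rfl⟩
  refine ⟨b.cost + 30, fun n p a => ?_⟩
  rw [planeScan, ← hb]
  refine ((does_cur (x := n) fun s h => by exact h.n_eq).seq_eq (does_scanLoop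
    (a := { a with cur := n }) (B := fun _ k => dot (normal p) (p k - p 0) ≠ 0)
    (fun c k s h => ?_) (fun q c => c = n ↔ ∀ k < q, dot (normal p) (p k - p 0) = 0) (by simp)
    fun k hk c hc => ⟨fun hB => ⟨fun h => absurd h hk.ne,
      fun h => absurd (h k (Nat.lt_succ_self k)) hB⟩, fun hB => hc.trans
        ⟨fun h l hl => (Nat.lt_succ_iff_lt_or_eq.1 hl).elim (h l) fun e => e ▸ not_not.1 hB,
          fun h l hl => h l (hl.trans (Nat.lt_succ_self k))⟩⟩)).mono ?_ fun _ h => h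
  · simp only [hb, Test.Holds, RExpr.val, dotE_val, vevals_normalE _ s h, subE_val, siteE_val h,
      IExpr.val, h.k_eq, Int.cast_zero, ne_eq]
  · simp only [IExpr.cost]
    nlinarith

lemma Sites.normal_ne_zero (hp : Sites n p) (hn : 3 ≤ n) : normal p ≠ 0 :=
  hp.cross_ne_zero (by omega) (by omega) (by omega) (by omega) (by omega) (by omega)

lemma Sites.planar_of (hp : Sites n p) (hn : 3 ≤ n)
    (h : ∀ k < n, dot (normal p) (p k - p 0) = 0) : Planar n p (normal p) := by
  refine ⟨hp.normal_ne_zero hn, fun i hi k hk => ?_⟩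
  have h1 := h i hi
  have h2 := h k hk
  rw [dot_sub_right] at *
  linarith

lemma spatial_of {k : ℕ} (hn : 3 ≤ n) (hk : k < n) (h : dot (normal p) (p k - p 0) ≠ 0) :
    Spatial n p := by
  intro i hi u hu
  have hu' : ∀ l < n, dot u (p l - p 0) = 0 := fun l hl => by
    have h1 := hu l hl
    have h2 := hu 0 (by omega)
    rw [dot_sub_right] at *
    linarith
  exact eq_zero_of_orthogonal h (hu' 1 (by omega)) (hu' 2 (by omega)) (hu' k hk)

lemma allRecord_isFace_of_planar (hn : 3 ≤ n) (hw : Planar n p (normal p)) :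
    IsFace n p (coneRecord (List.range n) [normal p, -normal p]) := by
  refine allRecord_isFace ?_ ?_
  · intro r hr k hk
    simp only [List.mem_cons, List.not_mem_nil, or_false] at hr
    rcases hr with rfl | rfl
    · exact mem_argmaxSet.2 ⟨hk, fun l hl => by rw [dot_neg_left, hw.2 k hk l hl, neg_zero]⟩
    · exact mem_argmaxSet.2 ⟨hk, fun l hl => by rw [neg_neg, hw.2 k hk l hl]⟩
  · intro v hv
    have hww := dot_self_pos hw.1
    have hv' := fun k hk => ((mem_argmaxSet_iff (hv 0 (by omega))).1 (hv k hk)).2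
    have h0 : v - (dot v (normal p) / dot (normal p) (normal p)) • normal p = 0 := by
      refine eq_zero_of_orthogonal (a := p 1 - p 0) (b := p 2 - p 0) (c := normal p) hww.ne'
        ?_ ?_ ?_
      · rw [dot_sub_left, dot_smul_left, hv' 1 (by omega), hw.2 0 (by omega) 1 (by omega)]; simp
      · rw [dot_sub_left, dot_smul_left, hv' 2 (by omega), hw.2 0 (by omega) 2 (by omega)]; simp
      · rw [dot_sub_left, dot_smul_left, div_mul_cancel₀ _ hww.ne', sub_self]
    rw [sub_eq_zero.1 h0]
    exact line_mem_cone (by simp) (by simp) _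

/-- The program for at least three sites. -/
def manyProg : Prog :=
  .seq planeScan (.cond (.ieq (.var 7) (.var 0))
    (.seq (allSites turnLocal) (emitAll [normalE, normalE']))
    (.seq (allSites marchLocal) (emitAll [])))

/-- For sites not in a plane, the total time is of the order of `∑ i, n * (degree n p i + 1)`, which
is quadratic by `sum_degree_le`. -/
lemma exists_does_manyProg : ∃ C, ∀ (n : ℕ) (p : ℕ → E3), Sites n p → 3 ≤ n → ∀ a : Abs,
    a.L = [] → a.ps = [] → a.pr = [] →
    Does n p manyProg a (C * (n + 1) ^ 2) (fun a' => IsComplete n p a'.L) := by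
  obtain ⟨c1, hc1⟩ := exists_does_planeScan
  obtain ⟨c2, hc2⟩ := exists_does_turnLocal
  obtain ⟨c3, hc3⟩ : ∃ c, c = raysCost [normalE, normalE'] := ⟨_, rfl⟩
  obtain ⟨c4, hc4⟩ : ∃ c, c = marchCost := ⟨_, rfl⟩
  refine ⟨c1 + 3 + (c2 + c3 + 70) + (7 * c4 + 80), ?_⟩
  intro n p hp hn a hL hps hpr
  refine ((hc1 n p a).seq (T' := 3 + ((c2 + c3 + 70) * (n + 1) ^ 2 + (7 * c4 + 71) * (n + 1) ^ 2))
    fun a1 h1 => ?_).mono ?_ fun _ h => h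
  swap
  · nlinarith [Nat.zero_le (c1 * n), Nat.zero_le (c1 * n ^ 2)]
  obtain ⟨c, hc, rfl⟩ := h1
  refine does_cond (b := .ieq (.var 7) (.var 0)) (β := c = n) (fun s h => by
    simp only [Test.Holds, IExpr.val, h.cur_eq, h.n_eq]) (fun h => ?_) (fun h => ?_)
  · have hw := hp.planar_of hn (hc.1 h)
    refine ((does_allSites (fun _ => c2 * (n + 1)) (hc2 n p hp hn hw)
      (a := { a with cur := c, k := n }) hL hps hpr).seq
      (T' := (c3 + 60) * (n + 1)) fun a2 h2 => ?_).mono ?_ fun _ h => h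
    swap
    · rw [Finset.sum_const, Finset.card_range, smul_eq_mul]
      nlinarith [Nat.zero_le (c3 * n), Nat.zero_le (c3 * n ^ 2)]
    obtain ⟨Ls, h3, h4, h5, h6⟩ := h2
    rw [hc3]
    refine (does_emitAll (ys := [normal p, -normal p]) h5 h6 (fun k ps pr =>
      .cons (vevals_normalE _) (.cons (vevals_normalE' _) .nil))).mono le_rfl fun a3 h7 => ?_
    rw [h7, h4]
    exact isComplete_of_local (by omega) h3 (allRecord_isFace_of_planar hn hw) rfl
  · obtain ⟨k, hk, hk'⟩ : ∃ k < n, dot (normal p) (p k - p 0) ≠ 0 := by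
      by_contra hcon
      push Not at hcon
      exact h (hc.2 hcon)
    have hs := spatial_of hn hk hk'
    refine ((does_allSites (fun i => c4 * ((n + 1) * (degree n p i + 1)))
      (fun a hi hps hpr => hc4 ▸ does_marchLocal hp hn hs hi hps hpr)
      (a := { a with cur := c, k := n }) hL hps hpr).seq
      (T' := 61 * (n + 1)) fun a2 h2 => ?_).mono ?_ fun _ h => h
    swap
    · have h1 := sum_degree_le hn hp
      rw [← Finset.mul_sum, ← Finset.mul_sum, Finset.sum_add_distrib, Finset.sum_const,
        Finset.card_range, smul_eq_mul, mul_one]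
      generalize ∑ i ∈ Finset.range n, degree n p i = D at *
      have h2 : c4 * ((n + 1) * (D + n)) ≤ c4 * ((n + 1) * (7 * (n + 1))) := by
        gcongr
        omega
      nlinarith
    obtain ⟨Ls, h3, h4, h5, h6⟩ := h2
    refine (does_emitAll (vs := []) (ys := []) h5 h6 (fun k ps pr => .nil)).mono
      (by simp [raysCost]) fun a3 h7 => ?_
    rw [h7, h4]
    exact isComplete_of_local (by omega) h3 (allRecord_isFace_of_spatial (by omega) hs) rfl

end BlochFan

/-! ### One or two sites, and the whole program -/
namespace BlochFan
open RealRAM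

variable {n : ℕ} {p : ℕ → E3}

lemma vevals_axis (a : Abs) :
    VEvals n p a (constE 1 0 0) (axis 0) ∧ VEvals n p a (constE 0 1 0) (axis 1) ∧
      VEvals n p a (constE 0 0 1) (axis 2) ∧ VEvals n p a (constE (-1) 0 0) (- axis 0) ∧
      VEvals n p a (constE 0 (-1) 0) (- axis 1) ∧ VEvals n p a (constE 0 0 (-1)) (- axis 2) := by
  refine ⟨?_, ?_, ?_, ?_, ?_, ?_⟩ <;>
    (intro s _; rw [constE_val]; apply ext3 <;> simp [axis])

/-- The program for a single site. -/
def oneProg : Prog :=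
  emitAll [constE 1 0 0, constE (-1) 0 0, constE 0 1 0, constE 0 (-1) 0, constE 0 0 1,
    constE 0 0 (-1)]

lemma exists_does_oneProg : ∃ C, ∀ (p : ℕ → E3) (a : Abs), a.L = [] → a.ps = [] → a.pr = [] →
    Does 1 p oneProg a C (fun a' => IsComplete 1 p a'.L) := by
  refine ⟨_, fun p a hL hps hpr => (does_emitAll (ys := plusMinus (axis 0) (axis 1) (axis 2)) hps
    hpr fun k ps pr => ?_).mono le_rfl fun a' h => ?_⟩
  · obtain ⟨h1, h2, h3, h4, h5, h6⟩ := vevals_axis (n := 1) (p := p)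
      { a with k := k, ps := ps, pr := pr }
    exact .cons h1 (.cons h4 (.cons h2 (.cons h5 (.cons h3 (.cons h6 .nil)))))
  · rw [h, hL]
    refine isComplete_of_local (Ls := fun _ => []) le_rfl (fun i hi => ?_) allRecord_isFace_one rfl
    rw [Nat.lt_one_iff.1 hi]
    exact isLocal_one

/-- The rays of the plane orthogonal to a vector. -/
def planeE (v : VExpr) : List VExpr :=
  [crossE (constE 1 0 0) v, crossE v (constE 1 0 0), crossE (constE 0 1 0) v,
    crossE v (constE 0 1 0), crossE (constE 0 0 1) v, crossE v (constE 0 0 1)]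

lemma vevals_planeE {a : Abs} {v : VExpr} {d : E3} (hv : VEvals n p a v d) :
    List.Forall₂ (VEvals n p a) (planeE v) (planeRays d) := by
  obtain ⟨h1, h2, h3, -⟩ := vevals_axis (n := n) (p := p) a
  have h : ∀ {w x}, VEvals n p a w x → VEvals n p a (crossE v w) (- cross x d) := fun hw => by
    rw [← cross_swap]; exact vevals_crossE hv hw
  exact .cons (vevals_crossE h1 hv) (.cons (h h1) (.cons (vevals_crossE h2 hv)
    (.cons (h h2) (.cons (vevals_crossE h3 hv) (.cons (h h3) .nil)))))

/-- The vector between the two given sites. -/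
def spanE (i j : ℕ) : VExpr := subE (siteE (.const j)) (siteE (.const i))

lemma vevals_spanE (a : Abs) (i j : ℕ) : VEvals n p a (spanE i j) (p j - p i) :=
  vevals_subE (fun _ _ => rfl) fun _ _ => rfl

/-- Writes the cell of one of two sites. -/
def emitPair (i j : ℕ) : Prog := emitFace [.const i] (planeE (spanE i j) ++ [spanE j i])

lemma exists_does_emitPair (i j : ℕ) : ∃ C, ∀ (p : ℕ → E3) (a : Abs), a.ps = [] → a.pr = [] →
    Does 2 p (emitPair i j) a C (· = { a with L := a.L ++ [pairCell i (p j - p i)] }) := by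
  refine ⟨_, fun p a hps hpr => does_emitFace (xs := [i]) hps hpr
    (fun ps pr => .cons (fun _ _ => rfl) .nil) (fun ps pr => ?_)⟩
  refine List.rel_append (vevals_planeE (vevals_spanE _ i j)) (.cons ?_ .nil)
  rw [neg_sub]
  exact vevals_spanE _ j i

/-- The program for two sites. -/
def twoProg : Prog := .seq (emitPair 0 1) (.seq (emitPair 1 0) (emitAll (planeE (spanE 0 1))))

lemma exists_does_twoProg : ∃ C, ∀ (p : ℕ → E3), Sites 2 p → ∀ a : Abs, a.L = [] → a.ps = [] →
    a.pr = [] → Does 2 p twoProg a C (fun a' => IsComplete 2 p a'.L) := by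
  obtain ⟨c1, h1⟩ := exists_does_emitPair 0 1
  obtain ⟨c2, h2⟩ := exists_does_emitPair 1 0
  refine ⟨_, fun p hp a hL hps hpr => (h1 p a hps hpr).seq_eq ((h2 p
    { a with L := a.L ++ [pairCell 0 (p 1 - p 0)] } hps hpr).seq_eq
      ((does_emitAll (a := { a with
          L := (a.L ++ [pairCell 0 (p 1 - p 0)]) ++ [pairCell 1 (p 0 - p 1)] }) hps hpr
        (fun k ps pr => vevals_planeE (vevals_spanE _ 0 1))).mono le_rfl fun a' h => ?_))⟩
  rw [h, hL]
  refine isComplete_of_local (Ls := fun i => if i = 0 then [pairCell 0 (p 1 - p 0)] else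
    [pairCell 1 (p 0 - p 1)]) (by omega) (fun i hi => ?_) (allRecord_isFace_two hp) rfl
  obtain rfl | rfl : i = 0 ∨ i = 1 := by omega
  · exact isLocal_pair hp (by omega) (by omega) (by omega)
  · exact isLocal_pair hp (by omega) (by omega) (by omega)

/-- The whole program. -/
def mainProg : Prog :=
  .cond (.ieq (.var 0) (.const 1)) oneProg (.cond (.ieq (.var 0) (.const 2)) twoProg manyProg)

/-- There is a program that computes the normal fan of `n` distinct points of the unit sphere in
quadratic time. -/
theorem exists_fan_program : ∃ (P : Prog) (C : ℕ), ∀ (n : ℕ) (p : ℕ → E3), 1 ≤ n → Sites n p →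
    ∀ s : Mem, (s.iVar 0 = n) → (∀ v ≠ 0, s.iVar v = 0) → (∀ b k, s.iArr b k = 0) →
      (∀ b ≥ 3, ∀ k, s.rArr b k = 0) → (∀ k, (!₂[s.rArr 0 k, s.rArr 1 k, s.rArr 2 k] : E3) = p k) →
      ∃ t s', Exec P s t s' ∧ t ≤ C * n ^ 2 ∧ IsComplete n p (outputFaces s') := by
  obtain ⟨c1, h1⟩ := exists_does_oneProg
  obtain ⟨c2, h2⟩ := exists_does_twoProg
  obtain ⟨c3, h3⟩ := exists_does_manyProg
  refine ⟨mainProg, 6 + c1 + c2 + 4 * c3, ?_⟩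
  intro n p hn hp s hs0 hs1 hs2 hs3 hs4
  have hrel : Rel n p ⟨0, 0, 0, 0, 0, 0, s.iArr 4, [], [], []⟩ s := by
    refine ⟨hs0, hs1 4 (by omega), hs1 5 (by omega), hs1 6 (by omega), hs1 7 (by omega),
      hs1 8 (by omega), hs1 9 (by omega), rfl, hs4, ?_⟩
    refine ⟨hs1 1 (by omega), rfl, fun q hq => ?_, fun q hq => ?_, fun q hq => ?_, fun k => ?_,
      ?_, ?_⟩
    · rw [hs2]; exact Nat.zero_le _
    · rw [hs2]; exact Nat.zero_le _
    · rw [hs2]; exact (Nat.le_zero.1 hq).symm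
    · exact ⟨hs3 3 le_rfl k, hs3 4 (by omega) k, hs3 5 (by omega) k⟩
    · rw [hs2, hs1 2 (by omega)]; exact slice_self _ _
    · rw [hs2, hs1 3 (by omega)]; exact slice_self _ _
  have hdoes : Does n p mainProg ⟨0, 0, 0, 0, 0, 0, s.iArr 4, [], [], []⟩
      (3 + (3 + (c1 + c2 + c3 * (n + 1) ^ 2))) (fun a' => IsComplete n p a'.L) := by
    refine does_cond (b := .ieq (.var 0) (.const 1)) (β := n = 1)
      (fun s h => by simp only [Test.Holds, IExpr.val, h.n_eq]) (fun h => ?_) (fun h => ?_)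
    · subst h
      exact (h1 p _ rfl rfl rfl).mono (by omega) fun _ h => h
    refine does_cond (b := .ieq (.var 0) (.const 2)) (β := n = 2)
      (fun s h => by simp only [Test.Holds, IExpr.val, h.n_eq]) (fun h => ?_) (fun h => ?_)
    · subst h
      exact (h2 p hp _ rfl rfl rfl).mono (by omega) fun _ h => h
    · exact (h3 n p hp (by omega) _ rfl rfl rfl).mono (by omega) fun _ h => h
  obtain ⟨t, s', a', e1, e2, e3, e4⟩ := hdoes s hrel
  refine ⟨t, s', e1, e2.trans ?_, ?_⟩
  · have h4 : (n + 1) ^ 2 ≤ 4 * n ^ 2 := by nlinarith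
    have h5 : 1 ≤ n ^ 2 := Nat.one_le_pow _ _ hn
    calc 3 + (3 + (c1 + c2 + c3 * (n + 1) ^ 2)) ≤ 6 * n ^ 2 + c1 * n ^ 2 + c2 * n ^ 2 +
          c3 * (4 * n ^ 2) := by nlinarith
      _ = _ := by ring
  · rw [outputFaces, e3.out.len, e3.out.faces]
    exact e4

end BlochFan

/-! ### One-qubit states in Bloch coordinates -/
namespace BlochFan

/-- The Hermitian matrix of trace one with Bloch vector `v`. -/
noncomputable def stateOf (v : E3) : QMat :=
  !![(1 + v 2 : ℂ) / 2, (v 0 - Complex.I * v 1) / 2;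
    (v 0 + Complex.I * v 1) / 2, (1 - v 2) / 2]

lemma bloch_stateOf (v : E3) : bloch (stateOf v) = v := by
  apply ext3 <;> simp [bloch, stateOf] <;> ring

lemma stateOf_bloch {ρ : QMat} (h : ρ.IsHermitian) (ht : ρ.trace = 1) :
    stateOf (bloch ρ) = ρ := by
  have h00 : (ρ 0 0).im = 0 := by
    have := congrArg Complex.im (h.apply 0 0); simp at this; linarith
  have h11 : (ρ 1 1).im = 0 := by
    have := congrArg Complex.im (h.apply 1 1); simp at this; linarith
  have h01 := h.apply 0 1
  have htr : (ρ 0 0).re + (ρ 1 1).re = 1 := by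
    have := congrArg Complex.re ht; simpa [Matrix.trace, Fin.sum_univ_two] using this
  have hre := congrArg Complex.re h01
  have him := congrArg Complex.im h01
  simp at hre him
  ext i j
  fin_cases i <;> fin_cases j <;> apply Complex.ext <;> simp [stateOf, bloch, h00, h11] <;> linarith

lemma isHermitian_stateOf (v : E3) : (stateOf v).IsHermitian := by
  ext i j
  fin_cases i <;> fin_cases j <;> apply Complex.ext <;> simp [stateOf]

lemma trace_stateOf (v : E3) : (stateOf v).trace = 1 := by
  simp [stateOf, Matrix.trace, Fin.sum_univ_two]; ring

lemma det_stateOf (v : E3) : (stateOf v).det = (((1 - dot v v) / 4 : ℝ) : ℂ) := by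
  rw [Matrix.det_fin_two]
  apply Complex.ext <;> simp [stateOf, dot] <;> ring

lemma stateOf_mul_self (v : E3) :
    stateOf v * stateOf v = stateOf v - ((1 - dot v v) / 4 : ℝ) • (1 : QMat) := by
  ext i j
  fin_cases i <;> fin_cases j <;> apply Complex.ext <;>
    simp [stateOf, dot, Matrix.mul_apply, Fin.sum_univ_two] <;> ring

lemma trace_stateOf_mul (v w : E3) :
    (stateOf v * stateOf w).trace = (((1 + dot v w) / 2 : ℝ) : ℂ) := by
  apply Complex.ext <;>
    simp [stateOf, dot, Matrix.trace, Fin.sum_univ_two] <;> ring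

/-- A pure state is a rank one projection, so that it compresses every matrix to a multiple of
itself. -/
lemma stateOf_mul_mul (v : E3) {w : E3} (hw : dot w w = 1) :
    stateOf w * stateOf v * stateOf w = ((1 + dot v w) / 2 : ℝ) • stateOf w := by
  have h0 : w 0 ^ 2 = 1 - w 1 ^ 2 - w 2 ^ 2 := by rw [← hw, dot]; ring
  ext i j
  fin_cases i <;> fin_cases j <;> apply Complex.ext <;>
    simp [stateOf, dot, Matrix.mul_apply, Fin.sum_univ_two] <;> ring_nf <;> simp only [h0] <;> ring

lemma continuous_stateOf : Continuous stateOf := by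
  refine continuous_matrix fun i j => ?_
  fin_cases i <;> fin_cases j <;> simp [stateOf] <;> fun_prop

lemma continuous_bloch : Continuous bloch := by
  unfold bloch
  fun_prop

/-- The spectrum of a root of a real quadratic polynomial consists of roots of this polynomial. -/
lemma quadratic_of_mem_spectrum {A : QMat} {b c x : ℝ} (h : A * A = b • A - c • (1 : QMat))
    (hx : x ∈ spectrum ℝ A) : x * x = b * x - c := by
  by_contra hne
  have hy : x * x - b * x + c ≠ 0 := fun h0 => hne (by linarith)
  have key : (algebraMap ℝ QMat x - A) *
      ((x * x - b * x + c)⁻¹ • (A + (x - b) • (1 : QMat))) = 1 := by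
    rw [mul_smul_comm, inv_smul_eq_iff₀ hy, Algebra.algebraMap_eq_smul_one, sub_mul, mul_add,
      mul_add, h]
    simp only [smul_mul_assoc, one_mul, mul_smul_comm, mul_one]
    module
  exact hx (IsUnit.of_mul_eq_one _ key)

/-- A function of a matrix which is affine on the spectrum. -/
lemma cfc_eq_affine {A : QMat} (hA : A.IsHermitian) {f : ℝ → ℝ} {b c : ℝ}
    (h : ∀ x ∈ spectrum ℝ A, f x = b * x + c) : cfc f A = b • A + c • (1 : QMat) := by
  have hA' : IsSelfAdjoint A := hA
  rw [cfc_congr (g := fun x => b * x + c) h, cfc_add_const c (fun x => b * x) A,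
    cfc_const_mul_id b A, Algebra.algebraMap_eq_smul_one]

lemma mem_qubitStates_stateOf {v : E3} : stateOf v ∈ qubitStates ↔ dot v v ≤ 1 := by
  constructor
  · rintro ⟨h, -⟩
    have := h.det_nonneg
    rw [det_stateOf, Complex.zero_le_real] at this
    linarith
  · intro h
    refine ⟨?_, trace_stateOf v⟩
    have hA := isHermitian_stateOf v
    refine hA.posSemidef_iff_eigenvalues_nonneg.2 fun i => ?_
    have hx := quadratic_of_mem_spectrum (b := 1) (by rw [one_smul]; exact stateOf_mul_self v)
      (hA.eigenvalues_mem_spectrum_real i)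
    show 0 ≤ hA.eigenvalues i
    nlinarith

lemma mem_qubitStates_iff {ρ : QMat} :
    ρ ∈ qubitStates ↔ stateOf (bloch ρ) = ρ ∧ dot (bloch ρ) (bloch ρ) ≤ 1 := by
  constructor
  · intro h
    have h1 := stateOf_bloch h.1.isHermitian h.2
    exact ⟨h1, mem_qubitStates_stateOf.1 (h1.symm ▸ h)⟩
  · rintro ⟨h1, h2⟩
    rw [← h1]
    exact mem_qubitStates_stateOf.2 h2

lemma rank_eq_two_iff (A : QMat) : A.rank = 2 ↔ A.det ≠ 0 := by
  constructor
  · intro h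
    have h1 : LinearMap.range A.mulVecLin = ⊤ := by
      apply Submodule.eq_top_of_finrank_eq
      rw [← Matrix.rank, h]
      simp
    have h2 : Function.Surjective A.mulVec := LinearMap.range_eq_top.1 h1
    exact ((Matrix.isUnit_iff_isUnit_det A).1 (Matrix.mulVec_surjective_iff_isUnit.1 h2)).ne_zero
  · intro h
    rw [Matrix.rank_of_det_ne_zero h, Fintype.card_fin]

lemma mem_faithfulStates_iff {ρ : QMat} :
    ρ ∈ faithfulStates ↔ stateOf (bloch ρ) = ρ ∧ dot (bloch ρ) (bloch ρ) < 1 := by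
  rw [faithfulStates, Set.mem_ofPred_eq, mem_qubitStates_iff, rank_eq_two_iff]
  constructor
  · rintro ⟨⟨h1, h2⟩, h3⟩
    refine ⟨h1, h2.lt_of_ne fun h4 => h3 ?_⟩
    rw [← h1, det_stateOf, h4]
    simp
  · rintro ⟨h1, h2⟩
    refine ⟨⟨h1, h2.le⟩, ?_⟩
    rw [← h1, det_stateOf]
    intro h3
    rw [Complex.ofReal_eq_zero] at h3
    linarith

lemma pure_iff {ρ : QMat} (h : ρ ∈ pureStates) :
    stateOf (bloch ρ) = ρ ∧ dot (bloch ρ) (bloch ρ) = 1 := by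
  obtain ⟨h1, h2⟩ := mem_qubitStates_iff.1 h.1
  refine ⟨h1, h2.antisymm (not_lt.1 fun h3 => ?_)⟩
  have h4 := (mem_faithfulStates_iff.2 ⟨h1, h3⟩).2
  rw [h.2] at h4
  omega

/-! ### The four diagrams coincide -/

/-- For a pure site, the Bures distance depends on the inner product of the Bloch vectors only. -/
lemma buresDist_stateOf {v w : E3} (hw : dot w w = 1) :
    buresDist (stateOf v) (stateOf w) = Real.sqrt (1 - Real.sqrt ((1 + dot v w) / 2)) := by
  set F := (1 + dot v w) / 2 with hF
  have hproj : stateOf w * stateOf w = stateOf w := by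
    rw [stateOf_mul_self, hw]; simp
  have h1 : cfc Real.sqrt (stateOf w) = stateOf w := by
    rw [cfc_eq_affine (isHermitian_stateOf w) (b := 1) (c := 0) fun x hx => ?_]
    · simp
    · have := quadratic_of_mem_spectrum (b := 1) (c := 0) (by simpa using hproj) hx
      have h2 : x * (x - 1) = 0 := by linarith
      rcases mul_eq_zero.1 h2 with h3 | h3
      · simp [h3]
      · rw [sub_eq_zero.1 h3]; simp
  have hherm : (F • stateOf w).IsHermitian := by
    rw [Matrix.IsHermitian, Matrix.conjTranspose_smul, isHermitian_stateOf w, star_trivial]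
  have h2 : cfc Real.sqrt (F • stateOf w) = (Real.sqrt F / F) • (F • stateOf w) := by
    rw [cfc_eq_affine hherm (b := Real.sqrt F / F) (c := 0) fun x hx => ?_]
    · simp
    · have := quadratic_of_mem_spectrum (b := F) (c := 0) (by simp [hproj, smul_smul]) hx
      have h2 : x * (x - F) = 0 := by linarith
      rcases mul_eq_zero.1 h2 with h3 | h3
      · simp [h3]
      · rw [sub_eq_zero.1 h3]
        by_cases hF0 : F = 0
        · simp [hF0]
        · rw [div_mul_cancel₀ _ hF0, add_zero]
  have h3 : Real.sqrt F / F * F = Real.sqrt F := by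
    by_cases hF0 : F = 0
    · simp [hF0]
    · rw [div_mul_cancel₀ _ hF0]
  rw [buresDist, h1, stateOf_mul_mul v hw, ← hF, h2, smul_smul, h3, Matrix.trace_smul,
    trace_stateOf]
  simp

/-- For all states of the same spectrum, the logarithm is the same increasing affine function. -/
lemma exists_log_affine {R : ℝ} (h0 : 0 ≤ R) (h1 : R < 1) : ∃ b c : ℝ, 0 < b ∧
    ∀ v : E3, dot v v = R → cfc Real.log (stateOf v) = b • stateOf v + c • (1 : QMat) := by
  obtain ⟨r, hr0, hr1, rfl⟩ : ∃ r : ℝ, 0 ≤ r ∧ r < 1 ∧ r ^ 2 = R :=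
    ⟨Real.sqrt R, Real.sqrt_nonneg R, by rwa [Real.sqrt_lt' one_pos, one_pow], Real.sq_sqrt h0⟩
  have hspec : ∀ v : E3, dot v v = r ^ 2 → ∀ x ∈ spectrum ℝ (stateOf v),
      x = (1 - r) / 2 ∨ x = (1 + r) / 2 := by
    intro v hv x hx
    have h2 := quadratic_of_mem_spectrum (b := 1) (by rw [one_smul]; exact stateOf_mul_self v) hx
    rw [hv] at h2
    have h3 : (x - (1 - r) / 2) * (x - (1 + r) / 2) = 0 := by linarith
    rcases mul_eq_zero.1 h3 with h4 | h4
    · exact Or.inl (sub_eq_zero.1 h4)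
    · exact Or.inr (sub_eq_zero.1 h4)
  rcases hr0.lt_or_eq with hr | rfl
  · have hlog : Real.log ((1 - r) / 2) < Real.log ((1 + r) / 2) :=
      Real.log_lt_log (by linarith) (by linarith)
    refine ⟨(Real.log ((1 + r) / 2) - Real.log ((1 - r) / 2)) / r, Real.log ((1 - r) / 2) -
      (Real.log ((1 + r) / 2) - Real.log ((1 - r) / 2)) / r * ((1 - r) / 2),
      div_pos (by linarith) hr, fun v hv => ?_⟩
    refine cfc_eq_affine (isHermitian_stateOf v) fun x hx => ?_
    rcases hspec v hv x hx with rfl | rfl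
    · ring
    · field_simp
      ring
  · refine ⟨1, Real.log (1 / 2) - 1 / 2, one_pos, fun v hv => ?_⟩
    refine cfc_eq_affine (isHermitian_stateOf v) fun x hx => ?_
    have : x = 1 / 2 := by
      rcases hspec v hv x hx with rfl | rfl <;> norm_num
    rw [this]
    ring

/-- The eigenvalues of a pure state are `0` and `1`, at both of which `Real.log` vanishes. -/
lemma cfc_log_pure {w : E3} (hw : dot w w = 1) : cfc Real.log (stateOf w) = 0 := by
  rw [cfc_eq_affine (isHermitian_stateOf w) (b := 0) (c := 0) fun x hx => ?_]
  · simp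
  · have := quadratic_of_mem_spectrum (b := 1) (by rw [one_smul]; exact stateOf_mul_self w) hx
    rw [hw] at this
    have h2 : x * (x - 1) = 0 := by linarith
    rcases mul_eq_zero.1 h2 with h3 | h3
    · simp [h3]
    · rw [sub_eq_zero.1 h3]; simp

lemma trace_mul_affine (v w : E3) (b c : ℝ) :
    (Matrix.trace (stateOf v * (b • stateOf w + c • (1 : QMat)))).re =
      b * ((1 + dot v w) / 2) + c := by
  rw [mul_add, mul_smul_comm, mul_smul_comm, mul_one, Matrix.trace_add, Matrix.trace_smul,
    Matrix.trace_smul, trace_stateOf_mul, trace_stateOf, Complex.add_re, Complex.smul_re,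
    Complex.smul_re, Complex.ofReal_re, Complex.one_re, smul_eq_mul, smul_eq_mul, mul_one]

lemma shrink_stateOf (a : ℝ) (w : E3) : shrink a (stateOf w) = stateOf (a • w) := by
  ext i j
  fin_cases i <;> fin_cases j <;> apply Complex.ext <;> simp [shrink, stateOf] <;> ring

variable {n : ℕ} {σ : Fin n → QMat}

/-- The states whose inner product with the `i`-th site is the largest one. -/
def coneRegion (σ : Fin n → QMat) (i : Fin n) : Set QMat :=
  {ρ | ρ ∈ qubitStates ∧ ∀ j, dot (bloch ρ) (bloch (σ j)) ≤ dot (bloch ρ) (bloch (σ i))}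

lemma abs_dot_le_one {v w : E3} (hv : dot v v ≤ 1) (hw : dot w w = 1) :
    -1 ≤ dot v w ∧ dot v w ≤ 1 := by
  have h1 := dot_self_nonneg (v + w)
  have h2 := dot_self_nonneg (v - w)
  simp only [dot_add_left, dot_add_right, dot_sub_left, dot_sub_right, dot_comm w v] at h1 h2
  constructor <;> linarith

theorem buresRegion_eq (hσ : ∀ i, σ i ∈ pureStates) : buresRegion σ = coneRegion σ := by
  funext i
  ext ρ
  refine and_congr_right fun hρ => forall_congr' fun j => ?_
  obtain ⟨h1, h2⟩ := mem_qubitStates_iff.1 hρ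
  have key : ∀ k, 0 ≤ (1 + dot (bloch ρ) (bloch (σ k))) / 2 ∧
      Real.sqrt ((1 + dot (bloch ρ) (bloch (σ k))) / 2) ≤ 1 ∧ buresDist ρ (σ k) =
        Real.sqrt (1 - Real.sqrt ((1 + dot (bloch ρ) (bloch (σ k))) / 2)) := by
    intro k
    obtain ⟨h3, h4⟩ := pure_iff (hσ k)
    have h5 := abs_dot_le_one h2 h4
    have h6 : 0 ≤ (1 + dot (bloch ρ) (bloch (σ k))) / 2 := by linarith
    refine ⟨h6, Real.sqrt_le_one.2 (by linarith), ?_⟩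
    rw [← buresDist_stateOf h4, h1, h3]
  obtain ⟨a1, a2, a3⟩ := key i
  obtain ⟨b1, b2, b3⟩ := key j
  rw [a3, b3, Real.sqrt_le_sqrt_iff (by linarith), sub_le_sub_iff_left, Real.sqrt_le_sqrt_iff a1]
  constructor <;> intro h <;> linarith

theorem euclidRegion_eq (hσ : ∀ i, σ i ∈ pureStates) : euclidRegion σ = coneRegion σ := by
  funext i
  ext ρ
  refine and_congr_right fun hρ => forall_congr' fun j => ?_
  have key : ∀ k, euclidDist ρ (σ k) =
      Real.sqrt (dot (bloch ρ) (bloch ρ) + 1 - 2 * dot (bloch ρ) (bloch (σ k))) ∧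
      0 ≤ dot (bloch ρ) (bloch ρ) + 1 - 2 * dot (bloch ρ) (bloch (σ k)) := by
    intro k
    obtain ⟨h3, h4⟩ := pure_iff (hσ k)
    have h5 : dot (bloch ρ) (bloch ρ) + 1 - 2 * dot (bloch ρ) (bloch (σ k)) =
        dot (bloch ρ - bloch (σ k)) (bloch ρ - bloch (σ k)) := by
      simp only [dot_sub_left, dot_sub_right, dot_comm (bloch (σ k)) (bloch ρ)]
      linarith
    refine ⟨?_, h5 ▸ dot_self_nonneg _⟩
    rw [euclidDist, EuclideanSpace.dist_eq, Fin.sum_univ_three, h5, dot]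
    simp only [Real.dist_eq, sq_abs, PiLp.sub_apply]
    congr 1
    ring
  rw [(key i).1, (key j).1, Real.sqrt_le_sqrt_iff (key j).2]
  constructor <;> intro h <;> linarith

lemma mem_cone_of_faithful {ρ : QMat} {i : Fin n} (h : ρ ∈ faithfulStates) : ρ ∈ coneRegion σ i ↔
    ∀ j, dot (bloch ρ) (bloch (σ j)) ≤ dot (bloch ρ) (bloch (σ i)) :=
  and_iff_right h.1

/-- The regions of the divergence diagram do not change with the radius of the sites. -/
theorem divergenceRegionAt_eq (hσ : ∀ i, σ i ∈ pureStates) {a : ℝ} (ha : a ∈ Set.Ioo (0 : ℝ) 1)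
    (i : Fin n) : divergenceRegionAt σ a i = faithfulStates ∩ coneRegion σ i := by
  ext ρ
  refine and_congr_right fun hρ => (forall_congr' fun j => ?_).trans (mem_cone_of_faithful hρ).symm
  obtain ⟨b, c, hb, hlog⟩ := exists_log_affine (R := a ^ 2) (by positivity)
    (pow_lt_one₀ ha.1.le ha.2 two_ne_zero)
  have key : ∀ k, divergence ρ (shrink a (σ k)) = (Matrix.trace (ρ * cfc Real.log ρ)).re -
      (b * ((1 + a * dot (bloch ρ) (bloch (σ k))) / 2) + c) := by
    intro k
    obtain ⟨h3, h4⟩ := pure_iff (hσ k)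
    have h5 := hlog (a • bloch (σ k)) (by
      rw [dot_smul_left, dot_smul_right, h4, mul_one, sq])
    rw [divergence, mul_sub, Matrix.trace_sub, Complex.sub_re, ← h3, shrink_stateOf, h5,
      bloch_stateOf, ← dot_smul_right, ← trace_mul_affine, (mem_faithfulStates_iff.1 hρ).1]
  show divergence ρ (shrink a (σ i)) ≤ divergence ρ (shrink a (σ j)) ↔ _
  rw [key i, key j, sub_le_sub_iff_left, add_le_add_iff_right, mul_le_mul_iff_right₀ hb,
    div_le_div_iff_of_pos_right two_pos, add_le_add_iff_left, mul_le_mul_iff_right₀ ha.1]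

lemma dualDivergence_eq (hσ : ∀ i, σ i ∈ pureStates) (i : Fin n) :
    voronoiRegion faithfulStates (fun ρ τ => divergence τ ρ) σ i =
      faithfulStates ∩ coneRegion σ i := by
  ext ρ
  refine and_congr_right fun hρ => (forall_congr' fun j => ?_).trans (mem_cone_of_faithful hρ).symm
  obtain ⟨h1, h2⟩ := mem_faithfulStates_iff.1 hρ
  obtain ⟨b, c, hb, hlog⟩ := exists_log_affine (dot_self_nonneg (bloch ρ)) h2
  have h6 := hlog (bloch ρ) rfl
  have key : ∀ k, divergence (σ k) ρ =
      - (b * ((1 + dot (bloch ρ) (bloch (σ k))) / 2) + c) := by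
    intro k
    obtain ⟨h3, h4⟩ := pure_iff (hσ k)
    rw [divergence, ← h1, ← h3, cfc_log_pure h4, h6, zero_sub, mul_neg, Matrix.trace_neg,
      Complex.neg_re, trace_mul_affine, bloch_stateOf, bloch_stateOf, dot_comm]
  show divergence (σ i) ρ ≤ divergence (σ j) ρ ↔ _
  rw [key i, key j, neg_le_neg_iff, add_le_add_iff_right, mul_le_mul_iff_right₀ hb,
    div_le_div_iff_of_pos_right two_pos, add_le_add_iff_left]

lemma continuous_dot_left (w : E3) : Continuous fun v => dot v w := by
  unfold dot; fun_prop

lemma isClosed_coneRegion (σ : Fin n → QMat) (i : Fin n) : IsClosed (coneRegion σ i) := by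
  have h1 : IsClosed qubitStates := by
    have : qubitStates = {ρ | stateOf (bloch ρ) = ρ} ∩ {ρ | dot (bloch ρ) (bloch ρ) ≤ 1} :=
      Set.ext fun ρ => mem_qubitStates_iff
    rw [this]
    refine (isClosed_eq (continuous_stateOf.comp continuous_bloch) continuous_id).inter
      (isClosed_le ?_ continuous_const)
    have := continuous_bloch
    unfold dot
    fun_prop
  have h2 : coneRegion σ i = qubitStates ∩ ⋂ j,
      {ρ | dot (bloch ρ) (bloch (σ j)) ≤ dot (bloch ρ) (bloch (σ i))} := by
    ext ρ; simp [coneRegion]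
  rw [h2]
  exact h1.inter (isClosed_iInter fun j => isClosed_le
    ((continuous_dot_left _).comp continuous_bloch) ((continuous_dot_left _).comp continuous_bloch))

/-- A region is the closure of its faithful states, as it is a cone in the Bloch ball: shrinking
a state towards the centre makes it faithful. -/
lemma closure_faithful (σ : Fin n → QMat) (i : Fin n) :
    closure (faithfulStates ∩ coneRegion σ i) = coneRegion σ i := by
  refine subset_antisymm
    (closure_minimal Set.inter_subset_right (isClosed_coneRegion σ i)) fun ρ hρ => ?_
  obtain ⟨h1, h2⟩ := mem_qubitStates_iff.1 hρ.1
  have hlim : Tendsto (fun a : ℝ => stateOf (a • bloch ρ)) (𝓝[<] 1) (𝓝 ρ) := by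
    have h3 : Continuous fun a : ℝ => stateOf (a • bloch ρ) := by
      have := continuous_stateOf
      fun_prop
    have h4 := h3.tendsto 1
    rw [one_smul, h1] at h4
    exact h4.mono_left nhdsWithin_le_nhds
  refine mem_closure_of_tendsto hlim ?_
  filter_upwards [Ioo_mem_nhdsLT (show (0 : ℝ) < 1 from one_pos)] with a ha
  have h5 : stateOf (a • bloch ρ) ∈ faithfulStates := by
    rw [mem_faithfulStates_iff, bloch_stateOf]
    refine ⟨rfl, ?_⟩
    rw [dot_smul_left, dot_smul_right]
    have := dot_self_nonneg (bloch ρ)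
    nlinarith [ha.1, ha.2, mul_lt_mul'' ha.2 ha.2 ha.1.le ha.1.le]
  refine ⟨h5, h5.1, fun j => ?_⟩
  rw [bloch_stateOf, dot_smul_left, dot_smul_left]
  exact mul_le_mul_of_nonneg_left (hρ.2 j) ha.1.le

lemma eventually_divergenceRegionAt_eq (hσ : ∀ i, σ i ∈ pureStates) (i : Fin n) :
    ∀ᶠ a in 𝓝[<] (1 : ℝ), divergenceRegionAt σ a i = faithfulStates ∩ coneRegion σ i := by
  filter_upwards [Ioo_mem_nhdsLT (show (0 : ℝ) < 1 from one_pos)] with a ha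
  exact divergenceRegionAt_eq hσ ha i

/-- The limit exists because the regions do not depend on `a`. -/
theorem divergenceLimitExists (hσ : ∀ i, σ i ∈ pureStates) : DivergenceLimitExists σ := by
  intro i ρ h
  obtain ⟨a, h1, h2⟩ := (h.and_eventually (eventually_divergenceRegionAt_eq hσ i)).exists
  filter_upwards [eventually_divergenceRegionAt_eq hσ i] with b hb
  rwa [hb, ← h2]

theorem divergenceRegion_eq (hσ : ∀ i, σ i ∈ pureStates) : divergenceRegion σ = coneRegion σ := by
  funext i
  rw [divergenceRegion, ← closure_faithful σ i]
  congr 1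
  ext ρ
  have h1 := eventually_divergenceRegionAt_eq hσ i
  constructor
  · intro (h : ∀ᶠ a in 𝓝[<] (1 : ℝ), ρ ∈ divergenceRegionAt σ a i)
    obtain ⟨a, h2, h3⟩ := (h.and h1).exists
    rwa [← h3]
  · intro h
    show ∀ᶠ a in 𝓝[<] (1 : ℝ), ρ ∈ divergenceRegionAt σ a i
    filter_upwards [h1] with a ha
    rwa [ha]

theorem dualDivergenceRegion_eq (hσ : ∀ i, σ i ∈ pureStates) :
    dualDivergenceRegion σ = coneRegion σ := by
  funext i
  rw [dualDivergenceRegion, dualDivergence_eq hσ, closure_faithful]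

end BlochFan

/-! ### From the fan to the diagrams -/
namespace BlochFan
open RealRAM

variable {n : ℕ} {σ : Fin n → QMat}

/-- The Bloch vectors of the sites, as they are stored in the input. -/
noncomputable def siteVec (σ : Fin n → QMat) (k : ℕ) : E3 :=
  !₂[(inputMem σ).rArr 0 k, (inputMem σ).rArr 1 k, (inputMem σ).rArr 2 k]

lemma siteVec_eq (σ : Fin n → QMat) (i : Fin n) : siteVec σ i = bloch (σ i) := by
  apply ext3 <;> simp [siteVec, inputMem]

lemma sites_siteVec (hσ : ∀ i, σ i ∈ pureStates) (hinj : Function.Injective σ) :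
    Sites n (siteVec σ) := by
  refine ⟨fun i hi => ?_, fun i hi j hj h => ?_⟩
  · have := siteVec_eq σ ⟨i, hi⟩
    rw [show siteVec σ i = bloch (σ ⟨i, hi⟩) from this]
    exact (pure_iff (hσ _)).2
  · have h1 : siteVec σ i = bloch (σ ⟨i, hi⟩) := siteVec_eq σ ⟨i, hi⟩
    have h2 : siteVec σ j = bloch (σ ⟨j, hj⟩) := siteVec_eq σ ⟨j, hj⟩
    rw [h1, h2] at h
    have h3 : σ ⟨i, hi⟩ = σ ⟨j, hj⟩ := by
      rw [← (pure_iff (hσ ⟨i, hi⟩)).1, h, (pure_iff (hσ ⟨j, hj⟩)).1]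
    exact congrArg Fin.val (hinj h3)

lemma mem_coneRegion_iff {ρ : QMat} (hρ : ρ ∈ qubitStates) (i : Fin n) :
    ρ ∈ coneRegion σ i ↔ (i : ℕ) ∈ argmaxSet n (siteVec σ) (bloch ρ) := by
  constructor
  · rintro ⟨-, h⟩
    refine ⟨i.2, fun l hl => ?_⟩
    rw [siteVec_eq σ i, show siteVec σ l = bloch (σ ⟨l, hl⟩) from siteVec_eq σ ⟨l, hl⟩]
    exact h ⟨l, hl⟩
  · rintro ⟨-, h⟩
    refine ⟨hρ, fun j => ?_⟩
    rw [← siteVec_eq σ i, ← siteVec_eq σ j]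
    exact h j j.2

lemma owners_coneRegion {ρ : QMat} (hρ : ρ ∈ qubitStates) :
    owners (coneRegion σ) ρ = argmaxSet n (siteVec σ) (bloch ρ) := by
  ext k
  constructor
  · rintro ⟨hk, h⟩
    exact (mem_coneRegion_iff hρ ⟨k, hk⟩).1 h
  · intro h
    exact ⟨h.1, (mem_coneRegion_iff hρ ⟨k, h.1⟩).2 h⟩

/-- Every set of maximizers occurs in the Bloch ball. -/
lemma exists_state_argmaxSet (n : ℕ) (p : ℕ → E3) (v : E3) :
    ∃ ρ ∈ qubitStates, argmaxSet n p (bloch ρ) = argmaxSet n p v := by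
  have h0 := dot_self_nonneg v
  have hpos : 0 < (1 + dot v v)⁻¹ := by positivity
  refine ⟨stateOf ((1 + dot v v)⁻¹ • v), mem_qubitStates_stateOf.2 ?_, ?_⟩
  · rw [dot_smul_left, dot_smul_right, ← mul_assoc, ← sq, inv_pow, inv_mul_le_one₀ (by positivity)]
    nlinarith
  · rw [bloch_stateOf]
    ext k
    simp only [argmaxSet, Set.mem_ofPred_eq, dot_smul_left, mul_le_mul_iff_right₀ hpos]

/-- The faces of the fan of the sites, cut with the Bloch ball, describe the diagram. -/
lemma IsComplete.describes {F : List FaceRecord} (h : IsComplete n (siteVec σ) F) :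
    DescribesDiagram (coneRegion σ) F := by
  refine ⟨fun f hf => (h.face f hf).nodup, h.nodup, fun I => ⟨?_, ?_⟩, fun f hf => ?_⟩
  · rintro ⟨f, hf, rfl⟩
    obtain ⟨v, hv⟩ := (h.face f hf).realized
    obtain ⟨ρ, hρ, h1⟩ := exists_state_argmaxSet n (siteVec σ) v
    exact ⟨ρ, hρ, by rw [owners_coneRegion hρ, h1, hv]⟩
  · rintro ⟨ρ, hρ, rfl⟩
    obtain ⟨f, hf, h1⟩ := h.complete (bloch ρ)
    exact ⟨f, hf, by rw [h1, owners_coneRegion hρ]⟩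
  · obtain ⟨v, hv⟩ := (h.face f hf).realized
    have hlt : ∀ k ∈ f.sites, k < n := fun k hk => by
      have : k ∈ argmaxSet n (siteVec σ) v := hv ▸ hk
      exact this.1
    ext ρ
    refine and_congr_right fun hρ => ?_
    rw [(h.face f hf).shape]
    exact ⟨fun h1 k hk => (mem_coneRegion_iff hρ ⟨k, hlt k hk⟩).1 (h1 ⟨k, hlt k hk⟩ hk),
      fun h1 i hi => (mem_coneRegion_iff hρ i).2 (h1 i hi)⟩

/-- A diagram whose regions, for pure sites, are the cones of the fan of their Bloch vectors can be
computed in quadratic time. -/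
theorem computableInTime_of_eq_coneRegion {V : ∀ n : ℕ, (Fin n → QMat) → Fin n → Set QMat}
    (hV : ∀ (n : ℕ) (σ : Fin n → QMat), (∀ i, σ i ∈ pureStates) → V n σ = coneRegion σ) :
    PureSiteDiagramComputableInTime V (fun n => (n : ℝ) ^ 2) := by
  obtain ⟨P, C, hP⟩ := exists_fan_program
  refine ⟨P, fun n => C * n ^ 2, ?_, ?_⟩
  · push_cast
    exact isBigO_const_mul_self _ _ _
  · intro n hn σ hinj hσ
    obtain ⟨t, s, h1, h2, h3⟩ := hP n (siteVec σ) hn (sites_siteVec hσ hinj) (inputMem σ)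
      (by simp [inputMem]) (fun v hv => by simp [inputMem, hv]) (fun b k => rfl)
      (fun b hb k => by simp [inputMem, hb]) (fun k => rfl)
    exact ⟨t, s, h1, h2, hV n σ hσ ▸ h3.describes⟩

end BlochFan

theorem mainTheorem12 :
    PureSiteDiagramComputableInTime (fun _ => buresRegion) (fun n => (n : ℝ) ^ 2) ∧
    PureSiteDiagramComputableInTime (fun _ => euclidRegion) (fun n => (n : ℝ) ^ 2) ∧
    (∀ (n : ℕ) (σ : Fin n → QMat), (∀ i, σ i ∈ pureStates) → DivergenceLimitExists σ) ∧
    PureSiteDiagramComputableInTime (fun _ => divergenceRegion) (fun n => (n : ℝ) ^ 2) ∧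
    PureSiteDiagramComputableInTime (fun _ => dualDivergenceRegion) (fun n => (n : ℝ) ^ 2) := by
  refine ⟨BlochFan.computableInTime_of_eq_coneRegion fun _ _ => BlochFan.buresRegion_eq,
    BlochFan.computableInTime_of_eq_coneRegion fun _ _ => BlochFan.euclidRegion_eq,
    fun _ _ => BlochFan.divergenceLimitExists,
    BlochFan.computableInTime_of_eq_coneRegion fun _ _ => BlochFan.divergenceRegion_eq,
    BlochFan.computableInTime_of_eq_coneRegion fun _ _ => BlochFan.dualDivergenceRegion_eq⟩
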